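/- A graph sequence $(G,\tau)$ consists of a finite simple graph $G=(V,E)$ with maximum degree $\Delta$, a ground set of time stamps $\mathcal T=\{1,\dots,t_{\max}\}$, and a map assigning to every edge $e\in E$ a nonempty set $\tau(e)\subseteq\mathcal T$ of time stamps at which $e$ is active. For $F\subseteq E$ put $\tau(F)=\bigcap_{e\in F}\tau(e)$, with $\tau(\emptyset)=\mathcal T$. A clique is given by its edge set: $K\subseteq E$ is a clique if any two distinct endpoints of members of $K$ are joined by an edge in $K$ (so $\emptyset$ is a, degenerate, clique). A clique $K$ is active if $\tau(K)\neq\emptyset$, and an active clique $K$ is closed if no clique $K'\supsetneq K$ satisfies $\tau(K')=\tau(K)$. The interval assumption says that $\tau(e)$ is an interval $\{t,t+1,\dots,t+\ell\}$, $\ell\ge 0$, for every $e\in E$. Under the interval assumption, all closed active cliques $K$ with $|\tau(K)|\ge\sigma$, for a given threshold $\sigma\in\mathbb N$, can be enumerated in $O(\min\{\Delta^5,|E|^2\Delta\})$ time for each (amortized, apart from $O(1+|E|)$ time to read the edges) and in $O(|V|+|E|)$ space. That is, there are one random access machine program and one constant $C$ such that for every graph sequence $(G,\tau)$ satisfying the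 interval assumption, given by $|V|$, $|E|$, $t_{\max}$ and a list of the edges in which every edge comes with its two endpoints and its first and last active time stamps, and for every $\sigma\in\mathbb N$, the program halts after having output every closed active clique $K$ with $|\tau(K)|\ge\sigma$ exactly once and nothing else; it takes at most $$C\,\bigl(1+|E|+N_\sigma\cdot\min\{\Delta^5,|E|^2\Delta\}\bigr)$$ steps, where $N_\sigma$ is the number of these cliques, and it uses a fixed number of registers and of arrays with at most $C(|V|+|E|+1)$ cells each, where every register and every cell holds, at any time, a natural number less than $C(|V|+|E|+t_{\max}+\sigma+1)$. The operations of the machine, each at unit cost, are copying, reading and writing array cells at computed addresses, addition, truncated subtraction, comparison, conditional jumps (if, while), and writing to a write-only output stream. -/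

import Mathlib

/-! ## Graph sequences and closed active cliques -/

/-- A graph sequence `(G, τ)` on the vertex set `Fin n`: a graph, the ground set `{1, …, tmax}` of
time stamps, and for every edge a nonempty set of time stamps at which the edge is active.
The values of `tau` off the edge set are irrelevant. -/
structure GraphSeq (n : ℕ) where
  graph : SimpleGraph (Fin n)
  tmax : ℕ
  tau : Sym2 (Fin n) → Finset ℕ
  tau_subset : ∀ e ∈ graph.edgeSet, tau e ⊆ Finset.Icc 1 tmax
  tau_nonempty : ∀ e ∈ graph.edgeSet, (tau e).Nonempty

namespace GraphSeq

variable {n : ℕ}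

/-- The interval assumption: the active time stamp set of every edge is `{t, t+1, …, t+ℓ}`. -/
def IntervalAssumption (S : GraphSeq n) : Prop :=
  ∀ e ∈ S.graph.edgeSet, ∃ t l : ℕ, S.tau e = Finset.Icc t (t + l)

/-- The active time stamp set `τ(F) = ⋂_{e ∈ F} τ(e)` of an edge set, the whole ground set of time
stamps if `F = ∅`. -/
def activeTime (S : GraphSeq n) (F : Finset (Sym2 (Fin n))) : Finset ℕ :=
  {t ∈ Finset.Icc 1 S.tmax | ∀ e ∈ F, t ∈ S.tau e}

/-- A clique, given by its edge set: a set of edges of `G` that joins any two distinct vertices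
among the endpoints of its members. -/
def IsClique (S : GraphSeq n) (K : Finset (Sym2 (Fin n))) : Prop :=
  (∀ e ∈ K, e ∈ S.graph.edgeSet) ∧
    ∀ u v : Fin n, (∃ e ∈ K, u ∈ e) → (∃ e ∈ K, v ∈ e) → u ≠ v → s(u, v) ∈ K

/-- A clique that is active (at some time stamp) and closed (no larger clique has the same
active time stamp set). -/
def IsClosedActiveClique (S : GraphSeq n) (K : Finset (Sym2 (Fin n))) : Prop :=
  S.IsClique K ∧ (S.activeTime K).Nonempty ∧
    ∀ K' : Finset (Sym2 (Fin n)), S.IsClique K' → K ⊂ K' → S.activeTime K' ≠ S.activeTime K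

/-- The closed active cliques whose active time stamp set has length at least `σ`. -/
def longCliques (S : GraphSeq n) (σ : ℕ) : Set (Finset (Sym2 (Fin n))) :=
  {K | S.IsClosedActiveClique K ∧ σ ≤ (S.activeTime K).card}

/-- `|E|`. -/
noncomputable def numEdges (S : GraphSeq n) : ℕ := S.graph.edgeSet.ncard

open Classical in
/-- `Δ`, the maximum degree of `G`. -/
noncomputable def maxDeg (S : GraphSeq n) : ℕ := S.graph.maxDegree

/-- `es` lists every edge of `G` exactly once (in any order and any orientation). -/
def IsEdgeList (S : GraphSeq n) (es : List (Fin n × Fin n)) : Prop :=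
  (es.map fun p => s(p.1, p.2)).Nodup ∧
    ∀ e : Sym2 (Fin n), e ∈ es.map (fun p => s(p.1, p.2)) ↔ e ∈ S.graph.edgeSet

end GraphSeq

/-! ## Random access machine -/

namespace RAM

/-- A machine state: registers, arrays of cells (`arr a j` is cell `j` of array `a`), and a
write-only output stream, consisting of the finished records and the record being written. -/
structure State where
  reg : ℕ → ℕ
  arr : ℕ → ℕ → ℕ
  out : List (List ℕ)
  cur : List ℕ

/-- Put `v` in register `x`. -/
def State.setReg (s : State) (x v : ℕ) : State :=
  { s with reg := Function.update s.reg x v }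

/-- Put `v` in cell `j` of array `a`. -/
def State.setCell (s : State) (a j v : ℕ) : State :=
  { s with arr := Function.update s.arr a (Function.update (s.arr a) j v) }

/-- Expressions; a given program names only finitely many registers and arrays. The comparisons
have value `1` (true) or `0` (false), and `sub` is truncated. -/
inductive Expr where
  | const (c : ℕ)
  | reg (x : ℕ)
  | read (a : ℕ) (i : Expr)
  | add (e f : Expr)
  | sub (e f : Expr)
  | lt (e f : Expr)
  | eq (e f : Expr)

namespace Expr

def eval (s : State) : Expr → ℕ
  | const c => c
  | reg x => s.reg x
  | read a i => s.arr a (i.eval s)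
  | add e f => e.eval s + f.eval s
  | sub e f => e.eval s - f.eval s
  | lt e f => if e.eval s < f.eval s then 1 else 0
  | eq e f => if e.eval s = f.eval s then 1 else 0

/-- Evaluation takes one step for each operation, constant, register and cell. -/
def cost : Expr → ℕ
  | const _ => 1
  | reg _ => 1
  | read _ i => i.cost + 1
  | add e f => e.cost + f.cost + 1
  | sub e f => e.cost + f.cost + 1
  | lt e f => e.cost + f.cost + 1
  | eq e f => e.cost + f.cost + 1

/-- The expression can be evaluated on a machine whose arrays have `m` cells each and whose words
hold the numbers below `w`: every address is below `m`, every value is below `w`. -/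
def Fits (m w : ℕ) (s : State) : Expr → Prop
  | const c => c < w
  | reg x => s.reg x < w
  | read a i => i.Fits m w s ∧ i.eval s < m ∧ s.arr a (i.eval s) < w
  | add e f => e.Fits m w s ∧ f.Fits m w s ∧ e.eval s + f.eval s < w
  | sub e f => e.Fits m w s ∧ f.Fits m w s
  | lt e f => e.Fits m w s ∧ f.Fits m w s ∧ 1 < w
  | eq e f => e.Fits m w s ∧ f.Fits m w s ∧ 1 < w

end Expr

inductive Prog where
  | skip
  /-- put the value of `e` in register `x` -/
  | assign (x : ℕ) (e : Expr)
  /-- put the value of `e` in the cell of array `a` whose address is the value of `i` -/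
  | write (a : ℕ) (i e : Expr)
  /-- append the value of `e` to the current output record -/
  | emit (e : Expr)
  /-- finish the current output record -/
  | flush
  | seq (p q : Prog)
  | ite (e : Expr) (p q : Prog)
  | while (e : Expr) (p : Prog)

/-- `Exec m w p s t s'`: on a machine whose arrays have `m` cells each and whose words hold the
numbers below `w`, the program `p`, started in the state `s`, halts after `t` steps in the
state `s'`. (A program that leaves these limits is stuck: it has no execution.) -/
inductive Exec (m w : ℕ) : Prog → State → ℕ → State → Prop where
  | skip (s : State) : Exec m w .skip s 1 s
  | assign (s : State) (x : ℕ) (e : Expr) (he : e.Fits m w s) :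
      Exec m w (.assign x e) s (e.cost + 1) (s.setReg x (e.eval s))
  | write (s : State) (a : ℕ) (i e : Expr) (hi : i.Fits m w s) (him : i.eval s < m)
      (he : e.Fits m w s) :
      Exec m w (.write a i e) s (i.cost + e.cost + 1)
        (s.setCell a (i.eval s) (e.eval s))
  | emit (s : State) (e : Expr) (he : e.Fits m w s) :
      Exec m w (.emit e) s (e.cost + 1) { s with cur := s.cur ++ [e.eval s] }
  | flush (s : State) :
      Exec m w .flush s 1 { s with out := s.out ++ [s.cur], cur := [] }
  | seq (s s₁ s₂ : State) (p q : Prog) (t₁ t₂ : ℕ) (hp : Exec m w p s t₁ s₁)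
      (hq : Exec m w q s₁ t₂ s₂) : Exec m w (.seq p q) s (t₁ + t₂) s₂
  | ite_true (s s' : State) (e : Expr) (p q : Prog) (t : ℕ) (he : e.Fits m w s)
      (h : e.eval s ≠ 0) (hp : Exec m w p s t s') : Exec m w (.ite e p q) s (e.cost + 1 + t) s'
  | ite_false (s s' : State) (e : Expr) (p q : Prog) (t : ℕ) (he : e.Fits m w s)
      (h : e.eval s = 0) (hq : Exec m w q s t s') : Exec m w (.ite e p q) s (e.cost + 1 + t) s'
  | while_true (s s₁ s₂ : State) (e : Expr) (p : Prog) (t₁ t₂ : ℕ) (he : e.Fits m w s)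
      (h : e.eval s ≠ 0) (hp : Exec m w p s t₁ s₁) (hw : Exec m w (.while e p) s₁ t₂ s₂) :
      Exec m w (.while e p) s (e.cost + 1 + t₁ + t₂) s₂
  | while_false (s : State) (e : Expr) (p : Prog) (he : e.Fits m w s) (h : e.eval s = 0) :
      Exec m w (.while e p) s (e.cost + 1) s

end RAM

/-! ## Input and output of an enumeration program -/

namespace GraphSeq

variable {n : ℕ}

/-- The initial state. Registers `0, 1, 2, 3` hold `|V|`, `|E|`, `tmax` and the threshold; cell `j`
of the arrays `0, 1, 2, 3` holds the two endpoints of the `j`-th edge and the first and the last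
time stamp at which it is active. Everything else is `0`, and the output is empty. -/
noncomputable def inputState (S : GraphSeq n) (es : List (Fin n × Fin n)) (σ : ℕ) :
    RAM.State where
  reg := fun x => match x with
    | 0 => n
    | 1 => es.length
    | 2 => S.tmax
    | 3 => σ
    | _ => 0
  arr := fun a j => match a, es[j]? with
    | 0, some p => p.1
    | 1, some p => p.2
    | 2, some p => sInf (S.tau s(p.1, p.2) : Set ℕ)
    | 3, some p => (S.tau s(p.1, p.2)).sup id
    | _, _ => 0
  out := []
  cur := []

/-- The output record `r` represents the edge set `K`: it lists the positions in `es` of the members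
of `K`, each exactly once. -/
def Encodes (es : List (Fin n × Fin n)) (r : List ℕ) (K : Finset (Sym2 (Fin n))) : Prop :=
  r.Nodup ∧ ∀ j : ℕ, j ∈ r ↔ ∃ p : Fin n × Fin n, es[j]? = some p ∧ s(p.1, p.2) ∈ K

/-- The output consists of one record for each member of the family `A`, without repetition, and of
nothing else. -/
def Enumerates (es : List (Fin n × Fin n)) (out : List (List ℕ))
    (A : Set (Finset (Sym2 (Fin n)))) : Prop :=
  ∃ Ks : List (Finset (Sym2 (Fin n))), Ks.Nodup ∧ (∀ K, K ∈ Ks ↔ K ∈ A) ∧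
    List.Forall₂ (Encodes es) out Ks

end GraphSeq

/-! A nonempty clique is determined by its vertex set `U`, and its active time is an interval `[a,
b]`: `a` is the latest start and `b` the earliest end of its edges. It is closed iff no vertex is
joined to all of `U` by edges active during the whole of `[a, b]`. The closed cliques are enumerated
by reverse search in a forest on these vertex sets; the empty clique is treated apart.

The greedy completion of a set `X` with active time `[a, b]` adds the least common neighbour again
and again, in the graph of the edges active during `[a, b]`. It keeps the active time and ends in a
closed clique if `[a, b]` is nonempty. Every set between `X` and its completion has the same
completion (`IsCl.sandwich`). For a closed clique `y` let `j` be least such that the members up to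
`j` have the active time of `y` and complete to `y`. The members before `j` have an active time of
their own, which contains that of `y`; their completion in it is the parent of `y`. The threshold is
inherited by parents, and the last generator `j` is smaller at the parent (`Par.lt`), so this is a
forest. Its roots are the cliques generated by the two ends of an edge (`IsNode.root_or_par`).

The interval assumption makes the children of `x` few. A child is determined by its last generator
`j` and its active time (`Par.eq_of`), and each end of that interval is an end of the interval of
`x` cut by one edge from `j` to `x` (`Par.left_candidate`, `Par.right_candidate`). So only pairs of
edges from `j` to `x` matter, and a proposed triple `(j, a, b)` is verified by two completions
(`par_of_test`).

Let `D` bound the sum of `deg + 1` over every clique; `D` can be taken of order `min(Δ², |E|)`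
(`degBound`). A completion costs `O(D)`. The search at `x` passes through the triples in
lexicographic order, and a potential shows that it makes at most `(Δ + 2) D + 1` steps (`pot_start`
and the lemmas `pot_lt_right`, `pot_lt_left`, `pot_lt_next`). This gives `O(Δ D²)`, that is
`O(min(Δ⁵, |E|² Δ))`, for each clique. Only edges that pass the threshold are tried as roots, and
each of them lies in some clique of the output (`card_longEdges_le`), so the root tests are paid for
as well.

Space stays linear because no clique is kept on a stack: the parent of `y` is recomputed from the
members of `y` before `j`. Only the last generator of the parent is remembered, in a cell indexed by
`j`; these indices increase along a path. The execution is verified by weakest preconditions with a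
frame rule, the main induction being `wp_search`. Finally `enumerates_of_nodes` translates vertex
sets back to edge sets and `time_bound` compares the costs. -/

/-! ## Cliques in graphs with interval labelled edges -/

/-- A simple graph on the vertices `0, …, n - 1` whose edges are numbered `0, …, E - 1`; edge `e`
joins `eu e` and `ev e` and is active from time `st e` to time `en e`. -/
structure IGraph where
  n : ℕ
  E : ℕ
  T : ℕ
  eu : ℕ → ℕ
  ev : ℕ → ℕ
  st : ℕ → ℕ
  en : ℕ → ℕ
  eu_lt : ∀ e < E, eu e < n
  ev_lt : ∀ e < E, ev e < n
  ne : ∀ e < E, eu e ≠ ev e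
  st_pos : ∀ e < E, 1 ≤ st e
  st_le : ∀ e < E, st e ≤ en e
  en_le : ∀ e < E, en e ≤ T
  simple : ∀ e < E, ∀ f < E,
    (eu e = eu f ∧ ev e = ev f) ∨ (eu e = ev f ∧ ev e = eu f) → e = f

namespace IGraph

variable (G : IGraph)

/-- Edge `e` joins `u` and `v`. -/
def Joins (e u v : ℕ) : Prop := (G.eu e = u ∧ G.ev e = v) ∨ (G.eu e = v ∧ G.ev e = u)

/-- `u` and `v` are joined by an edge that is active during the whole of `[a, b]`. -/
def Adj (a b u v : ℕ) : Prop := ∃ e < G.E, G.Joins e u v ∧ G.st e ≤ a ∧ b ≤ G.en e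

/-- `U` is a clique with at least two vertices and its active time is `[a, b]`. -/
def IsTau (U : Finset ℕ) (a b : ℕ) : Prop :=
  (∀ u ∈ U, ∀ v ∈ U, u ≠ v → G.Adj a b u v) ∧
  (∃ e < G.E, G.eu e ∈ U ∧ G.ev e ∈ U ∧ G.st e = a) ∧
  (∃ e < G.E, G.eu e ∈ U ∧ G.ev e ∈ U ∧ G.en e = b)

/-- `C` is the greedy completion of `X` in the graph of the edges active during `[a, b]`: vertices
are added in increasing order whenever they are adjacent to everything present. -/
def IsCl (a b : ℕ) (X C : Finset ℕ) : Prop :=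
  X ⊆ C ∧ ∀ z ∉ X, (z ∈ C ↔ (∀ x ∈ X, G.Adj a b x z) ∧ ∀ y ∈ C, y < z → G.Adj a b y z)

variable {G}

theorem Joins.symm {e u v : ℕ} (h : G.Joins e u v) : G.Joins e v u := Or.symm h

theorem Joins.eq {e f u v : ℕ} (he : e < G.E) (hf : f < G.E) (h : G.Joins e u v)
    (h' : G.Joins f u v) : e = f := by
  apply G.simple e he f hf
  rcases h with ⟨h1, h2⟩ | ⟨h1, h2⟩ <;> rcases h' with ⟨h3, h4⟩ | ⟨h3, h4⟩ <;> simp_all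

theorem Adj.symm {a b u v : ℕ} (h : G.Adj a b u v) : G.Adj a b v u := by
  obtain ⟨e, he, hj, h⟩ := h
  exact ⟨e, he, hj.symm, h⟩

theorem Adj.mono {a b a' b' u v : ℕ} (h : G.Adj a b u v) (ha : a ≤ a') (hb : b' ≤ b) :
    G.Adj a' b' u v := by
  obtain ⟨e, he, hj, h1, h2⟩ := h
  exact ⟨e, he, hj, h1.trans ha, hb.trans h2⟩

theorem Adj.ne {a b u v : ℕ} (h : G.Adj a b u v) : u ≠ v := by
  obtain ⟨e, he, hj, -⟩ := h
  have := G.ne e he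
  rcases hj with ⟨rfl, rfl⟩ | ⟨rfl, rfl⟩
  · exact this
  · exact this.symm

theorem Adj.lt {a b u v : ℕ} (h : G.Adj a b u v) : u < G.n := by
  obtain ⟨e, he, hj, -⟩ := h
  rcases hj with ⟨rfl, rfl⟩ | ⟨rfl, rfl⟩
  · exact G.eu_lt e he
  · exact G.ev_lt e he

theorem Adj.edge {a b u v e : ℕ} (h : G.Adj a b u v) (he : e < G.E) (hj : G.Joins e u v) :
    G.st e ≤ a ∧ b ≤ G.en e := by
  obtain ⟨f, hf, hjf, h⟩ := h
  rwa [hj.eq he hf hjf]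

/-! ### Active times of vertex sets. -/

namespace IsTau

variable {U X Y Z : Finset ℕ} {a b a' b' : ℕ}

theorem edge (h : G.IsTau U a b) {e : ℕ} (he : e < G.E) (hu : G.eu e ∈ U) (hv : G.ev e ∈ U) :
    G.st e ≤ a ∧ b ≤ G.en e :=
  (h.1 _ hu _ hv (G.ne e he)).edge he (Or.inl ⟨rfl, rfl⟩)

/-- The edges that attain `a` and `b` also lie in the larger clique, so they bound its interval. -/
theorem mono (h : G.IsTau X a b) (h' : G.IsTau Y a' b') (hXY : X ⊆ Y) : a ≤ a' ∧ b' ≤ b := by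
  obtain ⟨-, ⟨e, he, hu, hv, rfl⟩, ⟨f, hf, hu', hv', rfl⟩⟩ := h
  exact ⟨(h'.edge he (hXY hu) (hXY hv)).1, (h'.edge hf (hXY hu') (hXY hv')).2⟩

theorem unique (h : G.IsTau U a b) (h' : G.IsTau U a' b') : a = a' ∧ b = b' := by
  have h1 := h.mono h' subset_rfl
  have h2 := h'.mono h subset_rfl
  omega

/-- The extremal edges come from the smaller set and the adjacencies from the larger one. -/
theorem sandwich (h : G.IsTau X a b) (h' : G.IsTau Z a b) (hXY : X ⊆ Y) (hYZ : Y ⊆ Z) :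
    G.IsTau Y a b := by
  obtain ⟨-, ⟨e, he, hu, hv, rfl⟩, ⟨f, hf, hu', hv', rfl⟩⟩ := h
  exact ⟨fun u hu v hv => h'.1 u (hYZ hu) v (hYZ hv), ⟨e, he, hXY hu, hXY hv, rfl⟩,
    ⟨f, hf, hXY hu', hXY hv', rfl⟩⟩

theorem exists_ne (h : G.IsTau U a b) : ∃ u ∈ U, ∃ v ∈ U, u ≠ v := by
  obtain ⟨-, ⟨e, he, hu, hv, -⟩, -⟩ := h
  exact ⟨_, hu, _, hv, G.ne e he⟩

theorem nonempty (h : G.IsTau U a b) : U.Nonempty := by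
  obtain ⟨u, hu, -⟩ := h.exists_ne
  exact ⟨u, hu⟩

theorem lt (h : G.IsTau U a b) {u : ℕ} (hu : u ∈ U) : u < G.n := by
  obtain ⟨x, hx, y, hy, hxy⟩ := h.exists_ne
  by_cases hux : u = x
  · subst hux
    exact (h.1 _ hu _ hy hxy).lt
  · exact (h.1 _ hu _ hx hux).lt

theorem one_le (h : G.IsTau U a b) : 1 ≤ a := by
  obtain ⟨-, ⟨e, he, hu, hv, rfl⟩, -⟩ := h
  exact G.st_pos e he

theorem left_le (h : G.IsTau U a b) : a ≤ G.T := by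
  obtain ⟨-, ⟨e, he, hu, hv, rfl⟩, -⟩ := h
  exact (G.st_le e he).trans (G.en_le e he)

theorem right_le (h : G.IsTau U a b) : b ≤ G.T := by
  obtain ⟨-, -, ⟨e, he, hu, hv, rfl⟩⟩ := h
  exact G.en_le e he

theorem one_le_right (h : G.IsTau U a b) : 1 ≤ b := by
  obtain ⟨-, -, ⟨e, he, hu, hv, rfl⟩⟩ := h
  exact (G.st_pos e he).trans (G.st_le e he)

/-- Every clique with at least two vertices has an active time interval (possibly empty). -/
theorem exists_of_clique (hU : ∀ u ∈ U, ∀ v ∈ U, u ≠ v → ∃ e < G.E, G.Joins e u v)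
    (h2 : ∃ u ∈ U, ∃ v ∈ U, u ≠ v) : ∃ a b, G.IsTau U a b := by
  classical
  set F := (Finset.range G.E).filter fun e => G.eu e ∈ U ∧ G.ev e ∈ U with hF
  have mem : ∀ e, e ∈ F ↔ e < G.E ∧ G.eu e ∈ U ∧ G.ev e ∈ U := by simp [hF]
  have hne : F.Nonempty := by
    obtain ⟨u, hu, v, hv, huv⟩ := h2
    obtain ⟨e, he, hj⟩ := hU u hu v hv huv
    refine ⟨e, (mem e).2 ⟨he, ?_⟩⟩
    rcases hj with ⟨rfl, rfl⟩ | ⟨rfl, rfl⟩ <;> exact ⟨by assumption, by assumption⟩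
  -- An intersection of intervals runs from the latest start to the earliest end. Both are attained
  -- even if the intersection is empty, which is why active times are recorded as pairs of numbers.
  obtain ⟨e, heF, he⟩ := Finset.exists_max_image F G.st hne
  obtain ⟨f, hfF, hf⟩ := Finset.exists_min_image F G.en hne
  refine ⟨G.st e, G.en f, fun u hu v hv huv => ?_, ?_, ?_⟩
  · obtain ⟨g, hg, hj⟩ := hU u hu v hv huv
    have hgF : g ∈ F := by
      rw [mem]
      rcases hj with ⟨rfl, rfl⟩ | ⟨rfl, rfl⟩ <;> exact ⟨hg, by assumption, by assumption⟩
    exact ⟨g, hg, hj, he g hgF, hf g hgF⟩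
  · obtain ⟨h1, h2, h3⟩ := (mem e).1 heF
    exact ⟨e, h1, h2, h3, rfl⟩
  · obtain ⟨h1, h2, h3⟩ := (mem f).1 hfF
    exact ⟨f, h1, h2, h3, rfl⟩

end IsTau

/-! ### Greedy completion. -/

namespace IsCl

variable {X Y C D : Finset ℕ} {a b : ℕ}

/-- Whether `z` is admitted depends only on `X` and on the members below `z`. -/
theorem unique (h : G.IsCl a b X C) (h' : G.IsCl a b X D) : C = D := by
  ext z
  induction z using Nat.strong_induction_on with
  | _ z ih =>
    by_cases hz : z ∈ X
    · exact iff_of_true (h.1 hz) (h'.1 hz)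
    · rw [h.2 z hz, h'.2 z hz]
      refine and_congr_right fun _ => ⟨fun H y hy hyz => H y ((ih y hyz).2 hy) hyz,
        fun H y hy hyz => H y ((ih y hyz).1 hy) hyz⟩

theorem common (h : G.IsCl a b X C) {z : ℕ} (hz : z ∈ C) (hzX : z ∉ X) :
    ∀ x ∈ X, G.Adj a b x z := ((h.2 z hzX).1 hz).1

theorem clique (h : G.IsCl a b X C) (hX : ∀ u ∈ X, ∀ v ∈ X, u ≠ v → G.Adj a b u v) :
    ∀ u ∈ C, ∀ v ∈ C, u ≠ v → G.Adj a b u v := by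
  intro u hu v hv huv
  by_cases huX : u ∈ X <;> by_cases hvX : v ∈ X
  · exact hX u huX v hvX huv
  · exact h.common hv hvX u huX
  · exact (h.common hu huX v hvX).symm
  · rcases lt_or_gt_of_ne huv with hlt | hlt
    · exact ((h.2 v hvX).1 hv).2 u hu hlt
    · exact (((h.2 u huX).1 hu).2 v hv hlt).symm

/-- A common neighbour of `C` passes the greedy test, so it lies in `C` and would be adjacent to
itself. -/
theorem maximal (h : G.IsCl a b X C) : ∀ z, ¬ ∀ y ∈ C, G.Adj a b y z := by
  intro z hz
  have hzC : z ∈ C := by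
    by_cases hzX : z ∈ X
    · exact h.1 hzX
    · exact (h.2 z hzX).2 ⟨fun x hx => hz x (h.1 hx), fun y hy _ => hz y hy⟩
  exact (hz z hzC).ne rfl

theorem refl (hX : ∀ z, ¬ ∀ y ∈ X, G.Adj a b y z) : G.IsCl a b X X :=
  ⟨subset_rfl, fun z hz => iff_of_false hz fun H => hX z H.1⟩

/-- Adding in advance some vertices that would be admitted anyway changes nothing. The only new
requirement on `z` is adjacency to a `y` of `Y` above `z`, and this holds because `y` was itself
tested against the smaller member `z`. -/
theorem sandwich (h : G.IsCl a b X C) (hXY : X ⊆ Y) (hYC : Y ⊆ C) : G.IsCl a b Y C := by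
  refine ⟨hYC, fun z hz => ?_⟩
  have hzX : z ∉ X := fun hz' => hz (hXY hz')
  rw [h.2 z hzX]
  refine ⟨fun ⟨h1, h2⟩ => ⟨fun y hy => ?_, h2⟩, fun ⟨h1, h2⟩ => ⟨fun x hx => h1 x (hXY hx), h2⟩⟩
  by_cases hyX : y ∈ X
  · exact h1 y hyX
  · have hzC := (h.2 z hzX).2 ⟨h1, h2⟩
    have hyz : y ≠ z := fun e => hz (e ▸ hy)
    rcases lt_or_gt_of_ne hyz with hlt | hlt
    · exact h2 y (hYC hy) hlt
    · exact (((h.2 y hyX).1 (hYC hy)).2 z hzC hlt).symm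

theorem tau (h : G.IsCl a b X C) (hX : G.IsTau X a b) : G.IsTau C a b := by
  refine ⟨h.clique hX.1, ?_, ?_⟩
  · obtain ⟨-, ⟨e, he, hu, hv, hE⟩, -⟩ := hX
    exact ⟨e, he, h.1 hu, h.1 hv, hE⟩
  · obtain ⟨-, -, ⟨e, he, hu, hv, hE⟩⟩ := hX
    exact ⟨e, he, h.1 hu, h.1 hv, hE⟩

/-- The least common neighbour of `X` belongs to the greedy completion of `X`. -/
theorem least_mem (h : G.IsCl a b X C) {z : ℕ} (hz : ∀ x ∈ X, G.Adj a b x z)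
    (hmin : ∀ y, (∀ x ∈ X, G.Adj a b x y) → z ≤ y) : z ∈ C := by
  have hzX : z ∉ X := fun hzX => (hz z hzX).ne rfl
  refine (h.2 z hzX).2 ⟨hz, fun y hy hyz => ?_⟩
  by_cases hyX : y ∈ X
  · exact hz y hyX
  · have := hmin y (h.common hy hyX)
    omega

theorem eq_of_no_common (h : G.IsCl a b X C) (hX : ∀ z, ¬ ∀ x ∈ X, G.Adj a b x z) : C = X := by
  refine Finset.Subset.antisymm (fun z hz => ?_) h.1
  by_contra hzX
  exact hX z (h.common hz hzX)

/-- Induction on the number of common neighbours of `X`. Adding the least one lowers this number, as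
no vertex is adjacent to itself. -/
theorem exists_completion (hX : X.Nonempty) : ∃ C, G.IsCl a b X C := by
  classical
  obtain ⟨k, hk⟩ : ∃ k, ((Finset.range G.n).filter fun z => ∀ x ∈ X, G.Adj a b x z).card ≤ k :=
    ⟨_, le_rfl⟩
  induction k generalizing X with
  | zero =>
    refine ⟨X, refl fun z hz => ?_⟩
    obtain ⟨x, hx⟩ := hX
    have : z ∈ (Finset.range G.n).filter fun z => ∀ x ∈ X, G.Adj a b x z := by
      simpa using ⟨(hz x hx).symm.lt, hz⟩
    rw [Finset.card_eq_zero.1 (Nat.le_zero.1 hk)] at this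
    simp at this
  | succ k ih =>
    by_cases hc : ∃ z, ∀ x ∈ X, G.Adj a b x z
    · set z := Nat.find hc with hzdef
      have hz : ∀ x ∈ X, G.Adj a b x z := Nat.find_spec hc
      have hmin : ∀ y, (∀ x ∈ X, G.Adj a b x y) → z ≤ y := fun y hy => Nat.find_min' hc hy
      have hzX : z ∉ X := fun hzX => (hz z hzX).ne rfl
      obtain ⟨x, hx⟩ := hX
      have hlt : ((Finset.range G.n).filter fun y => ∀ x ∈ insert z X, G.Adj a b x y).card
          < ((Finset.range G.n).filter fun z => ∀ x ∈ X, G.Adj a b x z).card := by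
        refine Finset.card_lt_card ⟨fun y hy => ?_, fun hsub => ?_⟩
        · simp only [Finset.mem_filter, Finset.mem_range, Finset.mem_insert, forall_eq_or_imp]
            at hy ⊢
          exact ⟨hy.1, hy.2.2⟩
        · have : z ∈ (Finset.range G.n).filter fun y => ∀ x ∈ insert z X, G.Adj a b x y := by
            apply hsub
            simpa using ⟨(hz x hx).symm.lt, hz⟩
          simp only [Finset.mem_filter, Finset.mem_insert, forall_eq_or_imp] at this
          exact this.2.1.ne rfl
      obtain ⟨C, hC⟩ := ih (X := insert z X) ⟨z, by simp⟩ (by omega)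
      refine ⟨C, fun x hx => hC.1 (Finset.mem_insert_of_mem hx), fun y hy => ?_⟩
      -- The completion of `insert z X` serves for `X`. Any other common neighbour `y` of `X`
      -- exceeds the least one, `z`, so the test of `y` against the smaller members includes
      -- adjacency to `z`.
      by_cases hyz : y = z
      · refine iff_of_true (hC.1 (by simp [hyz])) ⟨hyz ▸ hz, fun w hw hwy => ?_⟩
        subst hyz
        by_cases hwX : w ∈ X
        · exact hz w hwX
        · have hw' : w ∉ insert z X := by
            simp only [Finset.mem_insert, not_or]
            exact ⟨by omega, hwX⟩
          exact ((hC.2 w hw').1 hw).1 z (by simp) |>.symm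
      · have hy' : y ∉ insert z X := by simp [hyz, hy]
        rw [hC.2 y hy']
        simp only [Finset.mem_insert, forall_eq_or_imp]
        refine ⟨fun h => ⟨h.1.2, h.2⟩, fun h => ⟨⟨?_, h.1⟩, h.2⟩⟩
        have := hmin y h.1
        exact h.2 z (hC.1 (by simp)) (by omega)
    · push Not at hc
      refine ⟨X, refl fun z hz => ?_⟩
      obtain ⟨x, hx, hn⟩ := hc z
      exact hn (hz x hx)

end IsCl

/-! ### The forest of closed cliques -/

variable (G)

/-- `U` is a vertex set with at least two elements that spans a closed clique whose active time
`[a, b]` is nonempty and contains at least `σ` time stamps. -/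
structure IsClosed (σ : ℕ) (U : Finset ℕ) (a b : ℕ) : Prop where
  tau : G.IsTau U a b
  max : ∀ z, ¬ ∀ u ∈ U, G.Adj a b u z
  le : a ≤ b
  long : σ + a ≤ b + 1

/-- `U` is the greedy completion of its members up to `i`. -/
def Gen (U : Finset ℕ) (a b i : ℕ) : Prop :=
  i ∈ U ∧ G.IsTau (U.filter (· ≤ i)) a b ∧ G.IsCl a b (U.filter (· ≤ i)) U

/-- A vertex set together with its active time `[a, b]` and the least `j` such that the set is the
greedy completion of its members up to `j`. -/
structure Nd where
  U : Finset ℕ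
  a : ℕ
  b : ℕ
  j : ℕ

structure IsNode (σ : ℕ) (x : Nd) : Prop where
  closed : G.IsClosed σ x.U x.a x.b
  gen : G.Gen x.U x.a x.b x.j
  least : ∀ i < x.j, ¬ G.Gen x.U x.a x.b i

/-- The vertices before the last generator. -/
def Nd.pre (x : Nd) : Finset ℕ := x.U.filter (· < x.j)

/-- `x` is the parent of `y`. -/
structure Par (σ : ℕ) (x y : Nd) : Prop where
  left : G.IsNode σ x
  right : G.IsNode σ y
  tau : G.IsTau y.pre x.a x.b
  cl : G.IsCl x.a x.b y.pre x.U

/-- `y` is generated by the two endpoints of edge `e`. -/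
structure IsRoot (σ : ℕ) (e : ℕ) (y : Nd) : Prop where
  node : G.IsNode σ y
  lt : e < G.E
  eq : y.U.filter (· ≤ y.j) = {G.eu e, G.ev e}

variable {G} {σ : ℕ}

theorem filter_le_eq {x : Nd} (h : x.j ∈ x.U) : x.U.filter (· ≤ x.j) = insert x.j x.pre := by
  ext z
  simp only [Nd.pre, Finset.mem_filter, Finset.mem_insert]
  constructor
  · rintro ⟨h1, h2⟩
    rcases h2.eq_or_lt with h2 | h2
    · exact Or.inl h2
    · exact Or.inr ⟨h1, h2⟩
  · rintro (rfl | ⟨h1, h2⟩)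
    · exact ⟨h, le_rfl⟩
    · exact ⟨h1, h2.le⟩

/-- Nothing can be added to a closed clique, so the whole set generates itself. Its largest member
is therefore an admissible index, and a least one exists. -/
theorem IsClosed.exists_node {U : Finset ℕ} {a b : ℕ} (h : G.IsClosed σ U a b) :
    ∃ j, G.IsNode σ ⟨U, a, b, j⟩ := by
  classical
  have hne := h.tau.nonempty
  have hall : U.filter (· ≤ U.max' hne) = U :=
    Finset.filter_true_of_mem fun x hx => U.le_max' x hx
  have hg : ∃ i, G.Gen U a b i :=
    ⟨U.max' hne, U.max'_mem hne, by rw [hall]; exact h.tau, by rw [hall]; exact IsCl.refl h.max⟩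
  exact ⟨Nat.find hg, h, Nat.find_spec hg, fun i hi => Nat.find_min hg hi⟩

theorem IsNode.ext {x y : Nd} (hx : G.IsNode σ x) (hy : G.IsNode σ y) (h : x.U = y.U) : x = y := by
  obtain ⟨U, a, b, j⟩ := x
  obtain ⟨V, c, d, i⟩ := y
  obtain rfl : U = V := h
  obtain ⟨rfl, rfl⟩ : a = c ∧ b = d := hx.closed.tau.unique hy.closed.tau
  have h1 := hx.least i
  have h2 := hy.least j
  have h3 := hx.gen
  have h4 := hy.gen
  simp only at h1 h2 h3 h4
  have : j = i := by
    by_contra hne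
    rcases lt_or_gt_of_ne hne with h | h
    · exact h2 h h3
    · exact h1 h h4
  rw [this]

theorem IsNode.lt {x : Nd} (hx : G.IsNode σ x) {u : ℕ} (hu : u ∈ x.U) : u < G.n :=
  hx.closed.tau.lt hu

theorem IsNode.j_lt {x : Nd} (hx : G.IsNode σ x) : x.j < G.n := hx.lt hx.gen.1

theorem IsNode.j_notMem_pre (x : Nd) : x.j ∉ x.pre := by simp [Nd.pre]

/-- The set `y.pre` determines its active time, and both determine the completion. -/
theorem Par.unique {x x' y : Nd} (h : G.Par σ x y) (h' : G.Par σ x' y) : x = x' := by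
  obtain ⟨h1, h2⟩ := h.tau.unique h'.tau
  apply h.left.ext h'.left
  have := h'.cl
  rw [← h1, ← h2] at this
  exact h.cl.unique this

/-- If `x` were its own parent, the members before `x.j` would already generate it, against the
minimality of `x.j`. -/
theorem Par.ne {x y : Nd} (h : G.Par σ x y) : x.U ≠ y.U := by
  intro he
  obtain rfl := h.left.ext h.right he
  have hlt : ∃ i ∈ x.pre, ∀ k ∈ x.pre, k ≤ i := by
    obtain ⟨i, hi, hmax⟩ := Finset.exists_max_image x.pre id h.tau.nonempty
    exact ⟨i, hi, hmax⟩
  obtain ⟨i, hi, hmax⟩ := hlt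
  have hi' := hi
  simp only [Nd.pre, Finset.mem_filter] at hi'
  have heq : x.U.filter (· ≤ i) = x.pre := by
    ext z
    simp only [Finset.mem_filter]
    refine ⟨fun hz => ?_, fun hz => ⟨h.cl.1 hz, hmax z hz⟩⟩
    simp only [Nd.pre, Finset.mem_filter]
    exact ⟨hz.1, by omega⟩
  exact h.left.least i hi'.2 ⟨hi'.1, heq ▸ h.tau, heq ▸ h.cl⟩

/-- The last generator of the parent is smaller. -/
theorem Par.lt {x y : Nd} (h : G.Par σ x y) : x.j < y.j := by
  by_contra hle
  push Not at hle
  -- Suppose `y.j ≤ x.j`. This prefix of `x.U` lies between `y.pre` and `x.U`, so it generates `x`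
  -- too, but its last member is below `x.j`.
  set Q := x.U.filter (· < y.j) with hQ
  have h1 : y.pre ⊆ Q := by
    intro z hz
    simp only [hQ, Finset.mem_filter]
    refine ⟨h.cl.1 hz, ?_⟩
    simp only [Nd.pre, Finset.mem_filter] at hz
    exact hz.2
  have h2 : Q ⊆ x.U := Finset.filter_subset _ _
  have ht : G.IsTau Q x.a x.b := h.tau.sandwich h.left.closed.tau h1 h2
  have hc : G.IsCl x.a x.b Q x.U := h.cl.sandwich h1 h2
  obtain ⟨i, hi, hmax⟩ := Finset.exists_max_image Q id ht.nonempty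
  have hi' := hi
  simp only [hQ, Finset.mem_filter] at hi'
  have heq : x.U.filter (· ≤ i) = Q := by
    ext z
    simp only [Finset.mem_filter, hQ]
    refine ⟨fun hz => ⟨hz.1, by omega⟩, fun hz => ⟨hz.1, hmax z ?_⟩⟩
    simp only [hQ, Finset.mem_filter]
    exact hz
  exact h.left.least i (by omega) ⟨hi'.1, heq ▸ ht, heq ▸ hc⟩

theorem Par.subset {x y : Nd} (_ : G.Par σ x y) : y.pre ⊆ y.U := Finset.filter_subset _ _

theorem Par.times {x y : Nd} (h : G.Par σ x y) : x.a ≤ y.a ∧ y.b ≤ x.b :=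
  h.tau.mono h.right.closed.tau h.subset

/-- Otherwise the generators of `y` lie between `y.pre` and its completion `x.U`. They would then
have the active time and the completion of `x`, and `y` would have the vertex set of `x`. -/
theorem Par.j_notMem {x y : Nd} (h : G.Par σ x y) : y.j ∉ x.U := by
  intro hj
  have hjpre := IsNode.j_notMem_pre y
  have hsub : insert y.j y.pre ⊆ x.U := by
    intro z hz
    rcases Finset.mem_insert.1 hz with rfl | hz
    · exact hj
    · exact h.cl.1 hz
  have hc := h.cl.sandwich (Finset.subset_insert _ _) hsub
  have ht := h.tau.sandwich h.left.closed.tau (Finset.subset_insert _ _) hsub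
  have hg := h.right.gen.2
  rw [filter_le_eq h.right.gen.1] at hg
  obtain ⟨h1, h2⟩ := ht.unique hg.1
  have := hg.2
  rw [← h1, ← h2] at this
  exact h.ne (hc.unique this)

/-- The generators of a child are determined by its last generator and its active time. -/
theorem Par.mem_pre_iff {x y : Nd} (h : G.Par σ x y) (z : ℕ) :
    z ∈ y.pre ↔ z ∈ x.U ∧ z < y.j ∧ G.Adj y.a y.b z y.j := by
  constructor
  · intro hz
    have hz' := hz
    simp only [Nd.pre, Finset.mem_filter] at hz'
    exact ⟨h.cl.1 hz, hz'.2, h.right.closed.tau.1 z hz'.1 y.j h.right.gen.1 (by omega)⟩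
  -- During `[y.a, y.b]` such a `z` is adjacent to `y.j` by assumption and to `y.pre` inside the
  -- clique `x`, whose interval contains `[y.a, y.b]`. The members of `y` below `z` belong to
  -- `y.pre`, so the greedy completion would have admitted `z`.
  · rintro ⟨hzx, hzj, hadj⟩
    by_contra hz
    have hzy : z ∉ y.U := fun hzy => hz (by simp [Nd.pre, hzy, hzj])
    have hg := h.right.gen.2.2
    rw [filter_le_eq h.right.gen.1] at hg
    have hzi : z ∉ insert y.j y.pre := by
      simp only [Finset.mem_insert, not_or]
      exact ⟨by omega, hz⟩
    refine hzy ((hg.2 z hzi).2 ⟨fun w hw => ?_, fun w hw hwz => ?_⟩)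
    · rcases Finset.mem_insert.1 hw with rfl | hw
      · exact hadj.symm
      · exact (h.left.closed.tau.1 w (h.cl.1 hw) z hzx (fun e => hz (e ▸ hw))).mono h.times.1
          h.times.2
    · have hwp : w ∈ y.pre := by
        simp only [Nd.pre, Finset.mem_filter]
        exact ⟨hw, by omega⟩
      exact (h.left.closed.tau.1 w (h.cl.1 hwp) z hzx (by omega)).mono h.times.1 h.times.2

/-- By `Par.mem_pre_iff` the triple fixes all generators of the child, and the child is their
completion. The search for children can therefore run over triples. -/
theorem Par.eq_of {x y z : Nd} (h : G.Par σ x y) (h' : G.Par σ x z) (hj : y.j = z.j)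
    (ha : y.a = z.a) (hb : y.b = z.b) : y = z := by
  have hpre : y.pre = z.pre := by
    ext w
    rw [h.mem_pre_iff, h'.mem_pre_iff, hj, ha, hb]
  apply h.right.ext h'.right
  have h1 := h.right.gen.2.2
  have h2 := h'.right.gen.2.2
  rw [filter_le_eq h.right.gen.1, hpre, hj, ha, hb] at h1
  rw [filter_le_eq h'.right.gen.1] at h2
  exact h1.unique h2

/-- The start of the active time of a child is an obvious candidate. -/
theorem Par.left_candidate {x y : Nd} (h : G.Par σ x y) :
    ∃ e < G.E, ∃ p ∈ x.U, p < y.j ∧ G.Joins e y.j p ∧ max x.a (G.st e) = y.a := by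
  have hg := h.right.gen.2.1
  rw [filter_le_eq h.right.gen.1] at hg
  have hle := h.times
  obtain ⟨-, ⟨e, he, hu, hv, hea⟩, -⟩ := hg
  have hpre : ∀ p ∈ y.pre, p ∈ x.U ∧ p < y.j := fun p hp =>
    ⟨((h.mem_pre_iff p).1 hp).1, ((h.mem_pre_iff p).1 hp).2.1⟩
  have hne := G.ne e he
  rcases Finset.mem_insert.1 hu with hu | hu <;> rcases Finset.mem_insert.1 hv with hv | hv
  · exact absurd (hu.trans hv.symm) hne
  · exact ⟨e, he, _, (hpre _ hv).1, (hpre _ hv).2, Or.inl ⟨hu, rfl⟩, by omega⟩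
  · exact ⟨e, he, _, (hpre _ hu).1, (hpre _ hu).2, Or.inr ⟨rfl, hv⟩, by omega⟩
  -- If an edge inside `y.pre` has the latest start, then `y.a ≤ x.a`, so the two are equal. Any
  -- edge from `y.j` to `y.pre` starts no later than `y.a`, so cutting its start at `x.a` gives
  -- `y.a` again.
  · have h1 := (h.tau.edge he hu hv).1
    obtain ⟨p, hp⟩ := h.tau.nonempty
    obtain ⟨f, hf, hj, h2, h3⟩ := ((h.mem_pre_iff p).1 hp).2.2
    exact ⟨f, hf, p, (hpre p hp).1, (hpre p hp).2, hj.symm, by omega⟩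

theorem Par.right_candidate {x y : Nd} (h : G.Par σ x y) :
    ∃ e < G.E, ∃ p ∈ x.U, p < y.j ∧ G.Joins e y.j p ∧ min x.b (G.en e) = y.b := by
  have hg := h.right.gen.2.1
  rw [filter_le_eq h.right.gen.1] at hg
  have hle := h.times
  obtain ⟨-, -, ⟨e, he, hu, hv, hea⟩⟩ := hg
  have hpre : ∀ p ∈ y.pre, p ∈ x.U ∧ p < y.j := fun p hp =>
    ⟨((h.mem_pre_iff p).1 hp).1, ((h.mem_pre_iff p).1 hp).2.1⟩
  have hne := G.ne e he
  rcases Finset.mem_insert.1 hu with hu | hu <;> rcases Finset.mem_insert.1 hv with hv | hv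
  · exact absurd (hu.trans hv.symm) hne
  · exact ⟨e, he, _, (hpre _ hv).1, (hpre _ hv).2, Or.inl ⟨hu, rfl⟩, by omega⟩
  · exact ⟨e, he, _, (hpre _ hu).1, (hpre _ hu).2, Or.inr ⟨rfl, hv⟩, by omega⟩
  · have h1 := (h.tau.edge he hu hv).2
    obtain ⟨p, hp⟩ := h.tau.nonempty
    obtain ⟨f, hf, hj, h2, h3⟩ := ((h.mem_pre_iff p).1 hp).2.2
    exact ⟨f, hf, p, (hpre p hp).1, (hpre p hp).2, hj.symm, by omega⟩

/-- The members up to `j` of the completion of `insert j Y`, when completion adds only vertices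
after `j`. -/
theorem IsCl.filter_le {Y C : Finset ℕ} {a b j : ℕ} (hC : G.IsCl a b (insert j Y) C)
    (hY : ∀ y ∈ Y, y < j) (hext : ∀ z ∈ C, z ∉ insert j Y → j < z) :
    C.filter (· ≤ j) = insert j Y ∧ C.filter (· < j) = Y := by
  constructor
  · ext z
    simp only [Finset.mem_filter]
    refine ⟨fun hz => ?_, fun hz => ⟨hC.1 hz, ?_⟩⟩
    · by_contra hzn
      have := hext z hz.1 hzn
      omega
    · rcases Finset.mem_insert.1 hz with rfl | hz
      · exact le_rfl
      · exact (hY z hz).le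
  · ext z
    simp only [Finset.mem_filter]
    refine ⟨fun hz => ?_, fun hz => ⟨hC.1 (Finset.mem_insert_of_mem hz), hY z hz⟩⟩
    by_contra hzn
    have := hext z hz.1 (by simp only [Finset.mem_insert, not_or]; exact ⟨by omega, hzn⟩)
    omega

/-- The test that recognizes the children of a node. -/
theorem par_of_test {x : Nd} (hx : G.IsNode σ x) {Y C : Finset ℕ} {a b j : ℕ} (hj : j ∉ x.U)
    (hY : ∀ y ∈ Y, y < j) (ht : G.IsTau Y x.a x.b) (hc : G.IsCl x.a x.b Y x.U)
    (ht' : G.IsTau (insert j Y) a b) (hC : G.IsCl a b (insert j Y) C)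
    (hext : ∀ z ∈ C, z ∉ insert j Y → j < z) (hab : a ≤ b) (hlong : σ + a ≤ b + 1) :
    G.Par σ x ⟨C, a, b, j⟩ := by
  obtain ⟨h1, h2⟩ := hC.filter_le hY hext
  have hjC : j ∈ C := hC.1 (Finset.mem_insert_self _ _)
  have hnode : G.IsNode σ ⟨C, a, b, j⟩ := by
    refine ⟨⟨hC.tau ht', hC.maximal, hab, hlong⟩, ⟨hjC, by simpa only [h1] using ht',
      by simpa only [h1] using hC⟩, fun i hi hg => ?_⟩
    simp only at hi hg
    -- A generating prefix of `C` that ends before `j` would be contained in `Y`, and by the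
    -- sandwich lemmas `Y` would complete to `C`. But `Y` completes to `x.U`, which does not contain
    -- `j`.
    have hsub : C.filter (· ≤ i) ⊆ Y := by
      rw [← h2]
      intro z hz
      simp only [Finset.mem_filter] at hz ⊢
      exact ⟨hz.1, by omega⟩
    have hYC : Y ⊆ C := fun z hz => hC.1 (Finset.mem_insert_of_mem hz)
    have htY := hg.2.1.sandwich (hC.tau ht') hsub hYC
    have hcY := hg.2.2.sandwich hsub hYC
    obtain ⟨e1, e2⟩ := ht.unique htY
    rw [e1, e2] at hc
    rw [hc.unique hcY] at hj
    exact hj hjC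
  exact ⟨hx, hnode, by simpa only [Nd.pre, h2] using ht, by simpa only [Nd.pre, h2] using hc⟩

/-- A node that is not generated by an edge has a parent. -/
theorem IsNode.root_or_par {y : Nd} (hy : G.IsNode σ y) :
    (∃ e, G.IsRoot σ e y) ∨ ∃ x, G.Par σ x y := by
  have hg := hy.gen.2.1
  rw [filter_le_eq hy.gen.1] at hg
  by_cases h2 : ∃ u ∈ y.pre, ∃ v ∈ y.pre, u ≠ v
  · right
    have hsub : y.pre ⊆ y.U := Finset.filter_subset _ _
    obtain ⟨a, b, hab⟩ := IsTau.exists_of_clique (G := G) (U := y.pre) (fun u hu v hv huv => by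
      obtain ⟨e, he, hj, -⟩ := hy.closed.tau.1 u (hsub hu) v (hsub hv) huv
      exact ⟨e, he, hj⟩) h2
    obtain ⟨C, hC⟩ := IsCl.exists_completion (G := G) (a := a) (b := b) hab.nonempty
    -- The active time of `y.pre` contains that of `y`, so its completion meets the threshold as
    -- well.
    have hle := hab.mono hy.closed.tau hsub
    have hcl : G.IsClosed σ C a b :=
      ⟨hC.tau hab, hC.maximal, by have := hy.closed.le; omega, by have := hy.closed.long; omega⟩
    obtain ⟨i, hi⟩ := hcl.exists_node
    exact ⟨⟨C, a, b, i⟩, hi, hy, hab, hC⟩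
  · left
    push Not at h2
    have hne : y.pre.Nonempty := by
      obtain ⟨u, hu, v, hv, huv⟩ := hg.exists_ne
      rcases Finset.mem_insert.1 hu with rfl | hu
      · rcases Finset.mem_insert.1 hv with rfl | hv
        · exact absurd rfl huv
        · exact ⟨v, hv⟩
      · exact ⟨u, hu⟩
    obtain ⟨u, hu⟩ := hne
    have hpre : y.pre = {u} := by
      ext z
      simp only [Finset.mem_singleton]
      exact ⟨fun hz => h2 z hz u hu, fun hz => hz ▸ hu⟩
    rw [hpre] at hg
    have huj : u ≠ y.j := by
      rintro rfl
      exact IsNode.j_notMem_pre y hu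
    obtain ⟨e, he, hj, -⟩ := hg.1 u (by simp) y.j (by simp) huj
    refine ⟨e, hy, he, ?_⟩
    rw [filter_le_eq hy.gen.1, hpre]
    rcases hj with ⟨rfl, h⟩ | ⟨h, rfl⟩
    · rw [h, Finset.pair_comm]
    · rw [h]

/-- A clique with a parent has at least two vertices before its last generator, hence three
generators; a root has two. -/
theorem IsRoot.not_par {e : ℕ} {x y : Nd} (h : G.IsRoot σ e y) : ¬ G.Par σ x y := by
  intro hp
  obtain ⟨u, hu, v, hv, huv⟩ := hp.tau.exists_ne
  have huj : u ≠ y.j := fun e => IsNode.j_notMem_pre y (e ▸ hu)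
  have hvj : v ≠ y.j := fun e => IsNode.j_notMem_pre y (e ▸ hv)
  have heq := h.eq
  rw [filter_le_eq h.node.gen.1] at heq
  have h1 : u ∈ ({G.eu e, G.ev e} : Finset ℕ) := heq ▸ Finset.mem_insert_of_mem hu
  have h2 : v ∈ ({G.eu e, G.ev e} : Finset ℕ) := heq ▸ Finset.mem_insert_of_mem hv
  have h3 : y.j ∈ ({G.eu e, G.ev e} : Finset ℕ) := heq ▸ Finset.mem_insert_self _ _
  simp only [Finset.mem_insert, Finset.mem_singleton] at h1 h2 h3
  omega

theorem pair_inj {e f : ℕ} (he : e < G.E) (hf : f < G.E)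
    (h : ({G.eu e, G.ev e} : Finset ℕ) = {G.eu f, G.ev f}) : e = f := by
  apply G.simple e he f hf
  have h1 : G.eu e ∈ ({G.eu f, G.ev f} : Finset ℕ) := h ▸ by simp
  have h2 : G.ev e ∈ ({G.eu f, G.ev f} : Finset ℕ) := h ▸ by simp
  have := G.ne e he
  simp only [Finset.mem_insert, Finset.mem_singleton] at h1 h2
  omega

theorem IsRoot.unique {e f : ℕ} {y : Nd} (h : G.IsRoot σ e y) (h' : G.IsRoot σ f y) : e = f :=
  pair_inj h.lt h'.lt (h.eq.symm.trans h'.eq)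

theorem isTau_pair {e : ℕ} (he : e < G.E) : G.IsTau {G.eu e, G.ev e} (G.st e) (G.en e) := by
  have hadj : G.Adj (G.st e) (G.en e) (G.eu e) (G.ev e) :=
    ⟨e, he, Or.inl ⟨rfl, rfl⟩, le_rfl, le_rfl⟩
  refine ⟨fun u hu v hv huv => ?_, ⟨e, he, by simp, by simp, rfl⟩, ⟨e, he, by simp, by simp, rfl⟩⟩
  simp only [Finset.mem_insert, Finset.mem_singleton] at hu hv
  rcases hu with rfl | rfl <;> rcases hv with rfl | rfl
  · exact absurd rfl huv
  · exact hadj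
  · exact hadj.symm
  · exact absurd rfl huv

/-- The ends of `e` have exactly the active time of `e`, so the root can be computed from `e` alone.
-/
theorem IsRoot.eq_cl {e : ℕ} {y : Nd} (h : G.IsRoot σ e y) :
    y.a = G.st e ∧ y.b = G.en e ∧ y.j = max (G.eu e) (G.ev e) ∧
      G.IsCl (G.st e) (G.en e) {G.eu e, G.ev e} y.U := by
  have hg := h.node.gen
  have h1 := hg.2
  rw [h.eq] at h1
  obtain ⟨ha, hb⟩ := h1.1.unique (isTau_pair h.lt)
  refine ⟨ha, hb, ?_, by simpa only [ha, hb] using h1.2⟩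
  have hj : y.j ∈ ({G.eu e, G.ev e} : Finset ℕ) := by
    rw [← h.eq]
    simp [hg.1]
  have h3 : ∀ z ∈ ({G.eu e, G.ev e} : Finset ℕ), z ≤ y.j := by
    rw [← h.eq]
    simp
  have h4 := h3 (G.eu e) (by simp)
  have h5 := h3 (G.ev e) (by simp)
  simp only [Finset.mem_insert, Finset.mem_singleton] at hj
  omega

theorem IsRoot.unique_right {e : ℕ} {y z : Nd} (h : G.IsRoot σ e y) (h' : G.IsRoot σ e z) :
    y = z :=
  h.node.ext h'.node (h.eq_cl.2.2.2.unique h'.eq_cl.2.2.2)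

/-- The test that recognizes the roots. -/
theorem isRoot_of_test {e : ℕ} (he : e < G.E) {C : Finset ℕ}
    (hC : G.IsCl (G.st e) (G.en e) {G.eu e, G.ev e} C)
    (hext : ∀ z ∈ C, z ∉ ({G.eu e, G.ev e} : Finset ℕ) → max (G.eu e) (G.ev e) < z)
    (hlong : σ + G.st e ≤ G.en e + 1) :
    G.IsRoot σ e ⟨C, G.st e, G.en e, max (G.eu e) (G.ev e)⟩ := by
  have hne := G.ne e he
  set j := max (G.eu e) (G.ev e) with hj
  have hins : insert j {min (G.eu e) (G.ev e)} = ({G.eu e, G.ev e} : Finset ℕ) := by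
    ext z
    simp only [Finset.mem_insert, Finset.mem_singleton]
    omega
  rw [← hins] at hC hext
  have hlt : ∀ y ∈ ({min (G.eu e) (G.ev e)} : Finset ℕ), y < j := by
    simp only [Finset.mem_singleton, forall_eq]
    omega
  obtain ⟨h1, h2⟩ := hC.filter_le hlt hext
  have ht := isTau_pair (G := G) he
  refine ⟨⟨⟨(hins ▸ hC).tau ht, hC.maximal, G.st_le e he, hlong⟩,
    ⟨hC.1 (Finset.mem_insert_self _ _), ?_, ?_⟩, fun i hi hg => ?_⟩, he, ?_⟩
  · simp only [h1, hins]
    exact ht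
  · simp only [h1]
    exact hC
  -- A prefix that ends before the larger end of `e` has at most one vertex, so it contains no edge
  -- and has no active time.
  · simp only at hi hg
    obtain ⟨u, hu, v, hv, huv⟩ := hg.2.1.exists_ne
    have hsub : ∀ w ∈ C.filter (· ≤ i), w = min (G.eu e) (G.ev e) := by
      intro w hw
      rw [← Finset.mem_singleton, ← h2]
      simp only [Finset.mem_filter] at hw ⊢
      exact ⟨hw.1, by omega⟩
    exact huv ((hsub u hu).trans (hsub v hv).symm)
  · simp only [h1]
    exact hins

/-! ### Descendants -/

/-- The extension of the parent relation to descendants. -/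
def Desc (G : IGraph) (σ : ℕ) : Nd → Nd → Prop := Relation.ReflTransGen (G.Par σ)

theorem Desc.le {x y : Nd} (h : G.Desc σ x y) : x = y ∨ x.j < y.j := by
  induction h with
  | refl => exact Or.inl rfl
  | tail _ hp ih =>
    right
    rcases ih with rfl | ih
    · exact hp.lt
    · exact ih.trans hp.lt

/-- Parents are unique, so the ancestors of `z` form a chain. -/
theorem Desc.total {x y z : Nd} (hx : G.Desc σ x z) (hy : G.Desc σ y z) :
    G.Desc σ x y ∨ G.Desc σ y x := by
  have hu : Relator.RightUnique (Function.swap (G.Par σ)) := fun _ _ _ h h' => Par.unique h h'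
  rcases Relation.ReflTransGen.total_of_right_unique hu (Relation.reflTransGen_swap.2 hx)
    (Relation.reflTransGen_swap.2 hy) with h | h
  · exact Or.inr (Relation.reflTransGen_swap.1 h)
  · exact Or.inl (Relation.reflTransGen_swap.1 h)

/-- One of two distinct siblings with a common descendant would be above the other, hence above or
equal to the parent `p`. But its last generator exceeds that of `p`. This excludes repeated output.
-/
theorem Desc.eq_of_siblings {p x y z : Nd} (hpx : G.Par σ p x) (hpy : G.Par σ p y)
    (hx : G.Desc σ x z) (hy : G.Desc σ y z) : x = y := by
  have key : ∀ {x y : Nd}, G.Par σ p x → G.Par σ p y → G.Desc σ x y → x = y := by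
    intro x y hpx hpy h
    rcases Relation.ReflTransGen.cases_tail h with rfl | ⟨q, hq, hqy⟩
    · rfl
    · obtain rfl := hqy.unique hpy
      rcases Desc.le hq with rfl | hlt
      · exact absurd hpx.lt (lt_irrefl _)
      · exact absurd (hlt.trans hpx.lt) (lt_irrefl _)
  rcases hx.total hy with h | h
  · exact key hpx hpy h
  · exact (key hpy hpx h).symm

theorem Desc.eq_of_roots {e f : ℕ} {x y z : Nd} (hex : G.IsRoot σ e x) (hfy : G.IsRoot σ f y)
    (hx : G.Desc σ x z) (hy : G.Desc σ y z) : e = f := by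
  have key : ∀ {e f : ℕ} {x y : Nd}, G.IsRoot σ e x → G.IsRoot σ f y → G.Desc σ x y → e = f := by
    intro e f x y hex hfy h
    rcases Relation.ReflTransGen.cases_tail h with rfl | ⟨q, hq, hqy⟩
    · exact hex.unique hfy
    · exact absurd hqy hfy.not_par
  rcases hx.total hy with h | h
  · exact key hex hfy h
  · exact (key hfy hex h).symm

theorem Desc.isNode {x y : Nd} (hx : G.IsNode σ x) (h : G.Desc σ x y) : G.IsNode σ y := by
  rcases Relation.ReflTransGen.cases_tail h with rfl | ⟨q, -, hq⟩
  · exact hx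
  · exact hq.right

/-- The last generator drops at every step to the parent, so climbing ends at a root. -/
theorem IsNode.exists_root {y : Nd} (hy : G.IsNode σ y) :
    ∃ e x, G.IsRoot σ e x ∧ G.Desc σ x y := by
  obtain ⟨k, hk⟩ : ∃ k, y.j ≤ k := ⟨_, le_rfl⟩
  induction k using Nat.strong_induction_on generalizing y with
  | _ k ih =>
    rcases hy.root_or_par with ⟨e, he⟩ | ⟨x, hx⟩
    · exact ⟨e, y, he, Relation.ReflTransGen.refl⟩
    · have := hx.lt
      obtain ⟨e, r, hr, hd⟩ := ih x.j (by omega) hx.left le_rfl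
      exact ⟨e, r, hr, hd.tail hx⟩

end IGraph

/-! ## A Hoare logic for the random access machine -/

namespace RAM

infixr:60 " ;; " => Prog.seq

@[simp] theorem State.setReg_reg (s : State) (x v y : ℕ) :
    (s.setReg x v).reg y = if y = x then v else s.reg y := by
  simp [State.setReg, Function.update_apply]

@[simp] theorem State.setReg_arr (s : State) (x v : ℕ) : (s.setReg x v).arr = s.arr := rfl
@[simp] theorem State.setReg_out (s : State) (x v : ℕ) : (s.setReg x v).out = s.out := rfl
@[simp] theorem State.setReg_cur (s : State) (x v : ℕ) : (s.setReg x v).cur = s.cur := rfl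
@[simp] theorem State.setCell_reg (s : State) (a j v : ℕ) : (s.setCell a j v).reg = s.reg := rfl
@[simp] theorem State.setCell_out (s : State) (a j v : ℕ) : (s.setCell a j v).out = s.out := rfl
@[simp] theorem State.setCell_cur (s : State) (a j v : ℕ) : (s.setCell a j v).cur = s.cur := rfl

@[simp] theorem State.setCell_arr (s : State) (a j v b : ℕ) :
    (s.setCell a j v).arr b = if b = a then Function.update (s.arr a) j v else s.arr b := by
  by_cases h : b = a
  · subst h; simp [State.setCell]
  · simp [State.setCell, h]

namespace Prog

/-- The program contains an assignment to register `x`. -/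
def writesReg : Prog → ℕ → Bool
  | skip, _ => false
  | assign y _, x => x == y
  | write _ _ _, _ => false
  | emit _, _ => false
  | flush, _ => false
  | seq p q, x => p.writesReg x || q.writesReg x
  | ite _ p q, x => p.writesReg x || q.writesReg x
  | .while _ p, x => p.writesReg x

/-- The program contains a write to array `a`. -/
def writesArr : Prog → ℕ → Bool
  | skip, _ => false
  | assign _ _, _ => false
  | write b _ _, a => a == b
  | emit _, _ => false
  | flush, _ => false
  | seq p q, a => p.writesArr a || q.writesArr a
  | ite _ p q, a => p.writesArr a || q.writesArr a
  | .while _ p, a => p.writesArr a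

/-- The program contains an output command. -/
def emits : Prog → Bool
  | skip => false
  | assign _ _ => false
  | write _ _ _ => false
  | emit _ => true
  | flush => true
  | seq p q => p.emits || q.emits
  | ite _ p q => p.emits || q.emits
  | .while _ p => p.emits

end Prog

/-- `s'` differs from `s` only where the program `p` writes. -/
structure Agree (p : Prog) (s s' : State) : Prop where
  reg : ∀ x, p.writesReg x = false → s'.reg x = s.reg x
  arr : ∀ a, p.writesArr a = false → s'.arr a = s.arr a
  out : p.emits = false → s'.out = s.out
  cur : p.emits = false → s'.cur = s.cur

theorem Agree.refl (p : Prog) (s : State) : Agree p s s :=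
  ⟨fun _ _ => rfl, fun _ _ => rfl, fun _ => rfl, fun _ => rfl⟩

theorem Agree.trans {p : Prog} {s s' s'' : State} (h : Agree p s s') (h' : Agree p s' s'') :
    Agree p s s'' :=
  ⟨fun x hx => (h'.reg x hx).trans (h.reg x hx), fun x hx => (h'.arr x hx).trans (h.arr x hx),
    fun hx => (h'.out hx).trans (h.out hx), fun hx => (h'.cur hx).trans (h.cur hx)⟩

theorem Agree.mono {p q : Prog} {s s' : State} (h : Agree p s s')
    (hr : ∀ x, q.writesReg x = false → p.writesReg x = false)
    (ha : ∀ x, q.writesArr x = false → p.writesArr x = false)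
    (ho : q.emits = false → p.emits = false) : Agree q s s' :=
  ⟨fun x hx => h.reg x (hr x hx), fun x hx => h.arr x (ha x hx), fun hx => h.out (ho hx),
    fun hx => h.cur (ho hx)⟩

/-- This is the frame rule. Since the written registers and arrays are computed from the syntax, the
preservation of a fixed register or array is usually checked by `rfl`. -/
theorem Exec.agree {m w : ℕ} {p : Prog} {s s' : State} {t : ℕ} (h : Exec m w p s t s') :
    Agree p s s' := by
  induction h with
  | skip s => exact Agree.refl _ _
  | assign s x e he =>
    refine ⟨fun y hy => ?_, fun _ _ => rfl, fun _ => rfl, fun _ => rfl⟩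
    simp only [Prog.writesReg, beq_eq_false_iff_ne] at hy
    simp [hy]
  | write s a i e =>
    refine ⟨fun _ _ => rfl, fun b hb => ?_, fun _ => rfl, fun _ => rfl⟩
    simp only [Prog.writesArr, beq_eq_false_iff_ne] at hb
    simp [hb]
  | emit s e => exact ⟨fun _ _ => rfl, fun _ _ => rfl, by simp [Prog.emits], by simp [Prog.emits]⟩
  | flush s => exact ⟨fun _ _ => rfl, fun _ _ => rfl, by simp [Prog.emits], by simp [Prog.emits]⟩
  | seq s s₁ s₂ p q t₁ t₂ _ _ ihp ihq =>
    refine Agree.trans (ihp.mono ?_ ?_ ?_) (ihq.mono ?_ ?_ ?_) <;>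
      simp +contextual [Prog.writesReg, Prog.writesArr, Prog.emits]
  | ite_true s s' e p q t _ _ _ ih =>
    refine ih.mono ?_ ?_ ?_ <;> simp +contextual [Prog.writesReg, Prog.writesArr, Prog.emits]
  | ite_false s s' e p q t _ _ _ ih =>
    refine ih.mono ?_ ?_ ?_ <;> simp +contextual [Prog.writesReg, Prog.writesArr, Prog.emits]
  | while_true s s₁ s₂ e p t₁ t₂ _ _ _ _ ihp ihq =>
    refine Agree.trans (ihp.mono ?_ ?_ ?_) ihq <;>
      simp +contextual [Prog.writesReg, Prog.writesArr, Prog.emits]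
  | while_false s e p => exact Agree.refl _ _

/-- The program halts from `s`, and its running time and final state satisfy `Q`. -/
def WP (m w : ℕ) (p : Prog) (s : State) (Q : ℕ → State → Prop) : Prop :=
  ∃ t s', Exec m w p s t s' ∧ Q t s'

section

variable {m w : ℕ} {p q : Prog} {s : State} {Q R : ℕ → State → Prop}

theorem WP.mono (h : WP m w p s Q) (hQ : ∀ t s', Agree p s s' → Q t s' → R t s') :
    WP m w p s R := by
  obtain ⟨t, s', he, hq⟩ := h
  exact ⟨t, s', he, hQ t s' he.agree hq⟩

theorem wp_skip : WP m w .skip s Q ↔ Q 1 s :=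
  ⟨fun ⟨_, _, he, hq⟩ => by cases he; exact hq, fun h => ⟨1, s, .skip s, h⟩⟩

theorem wp_assign {x : ℕ} {e : Expr} :
    WP m w (.assign x e) s Q ↔ e.Fits m w s ∧ Q (e.cost + 1) (s.setReg x (e.eval s)) :=
  ⟨fun ⟨_, _, he, hq⟩ => by cases he with | assign _ _ _ hf => exact ⟨hf, hq⟩,
    fun h => ⟨_, _, .assign s x e h.1, h.2⟩⟩

theorem wp_write {a : ℕ} {i e : Expr} :
    WP m w (.write a i e) s Q ↔ i.Fits m w s ∧ i.eval s < m ∧ e.Fits m w s ∧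
      Q (i.cost + e.cost + 1) (s.setCell a (i.eval s) (e.eval s)) :=
  ⟨fun ⟨_, _, he, hq⟩ => by cases he with | write _ _ _ _ h1 h2 h3 => exact ⟨h1, h2, h3, hq⟩,
    fun h => ⟨_, _, .write s a i e h.1 h.2.1 h.2.2.1, h.2.2.2⟩⟩

theorem wp_emit {e : Expr} :
    WP m w (.emit e) s Q ↔
      e.Fits m w s ∧ Q (e.cost + 1) { s with cur := s.cur ++ [e.eval s] } :=
  ⟨fun ⟨_, _, he, hq⟩ => by cases he with | emit _ _ hf => exact ⟨hf, hq⟩,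
    fun h => ⟨_, _, .emit s e h.1, h.2⟩⟩

theorem wp_flush :
    WP m w .flush s Q ↔ Q 1 { s with out := s.out ++ [s.cur], cur := [] } :=
  ⟨fun ⟨_, _, he, hq⟩ => by cases he; exact hq, fun h => ⟨_, _, .flush s, h⟩⟩

theorem wp_seq :
    WP m w (.seq p q) s Q ↔ WP m w p s fun t s' => WP m w q s' fun t' s'' => Q (t + t') s'' := by
  constructor
  · rintro ⟨_, _, he, hq⟩
    cases he with
    | seq _ s₁ _ _ _ t₁ t₂ h1 h2 => exact ⟨t₁, s₁, h1, t₂, _, h2, hq⟩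
  · rintro ⟨t₁, s₁, h1, t₂, s₂, h2, hq⟩
    exact ⟨_, _, .seq s s₁ s₂ p q t₁ t₂ h1 h2, hq⟩

theorem wp_ite {e : Expr} :
    WP m w (.ite e p q) s Q ↔ e.Fits m w s ∧
      (e.eval s ≠ 0 → WP m w p s fun t s' => Q (e.cost + 1 + t) s') ∧
      (e.eval s = 0 → WP m w q s fun t s' => Q (e.cost + 1 + t) s') := by
  constructor
  · rintro ⟨_, _, he, hq⟩
    cases he with
    | ite_true _ _ _ _ _ t hf h hp => exact ⟨hf, fun _ => ⟨t, _, hp, hq⟩, fun h' => absurd h' h⟩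
    | ite_false _ _ _ _ _ t hf h hp => exact ⟨hf, fun h' => absurd h h', fun _ => ⟨t, _, hp, hq⟩⟩
  · rintro ⟨hf, h1, h2⟩
    by_cases h : e.eval s = 0
    · obtain ⟨t, s', he, hq⟩ := h2 h
      exact ⟨_, _, .ite_false s s' e p q t hf h he, hq⟩
    · obtain ⟨t, s', he, hq⟩ := h1 h
      exact ⟨_, _, .ite_true s s' e p q t hf h he, hq⟩

theorem wp_while_true {e : Expr} (hf : e.Fits m w s) (h : e.eval s ≠ 0)
    (hp : WP m w p s fun t s' => WP m w (.while e p) s' fun t' s'' => Q (e.cost + 1 + t + t') s'') :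
    WP m w (.while e p) s Q := by
  obtain ⟨t₁, s₁, h1, t₂, s₂, h2, hq⟩ := hp
  exact ⟨_, _, .while_true s s₁ s₂ e p t₁ t₂ hf h h1 h2, hq⟩

theorem wp_while_false {e : Expr} (hf : e.Fits m w s) (h : e.eval s = 0)
    (hp : Q (e.cost + 1) s) : WP m w (.while e p) s Q :=
  ⟨_, _, .while_false s e p hf h, hp⟩

/-- A loop with a known number `N` of iterations. The invariant `I i t s` speaks of the state `s`
after `i` iterations that took time `t`. -/
theorem wp_while {e : Expr} {N : ℕ} (I : ℕ → ℕ → State → Prop) (h0 : I 0 0 s)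
    (hstep : ∀ i < N, ∀ t s', I i t s' → Agree p s s' → e.Fits m w s' ∧ e.eval s' ≠ 0 ∧
      WP m w p s' fun t' s'' => I (i + 1) (t + (e.cost + 1 + t')) s'')
    (hend : ∀ t s', I N t s' → Agree p s s' → e.Fits m w s' ∧ e.eval s' = 0) :
    WP m w (.while e p) s fun t s' => ∃ t₀, t = t₀ + (e.cost + 1) ∧ I N t₀ s' := by
  suffices H : ∀ k i t s', i + k = N → I i t s' → Agree p s s' →
      WP m w (.while e p) s' fun t' s'' => ∃ t₀, t + t' = t₀ + (e.cost + 1) ∧ I N t₀ s'' by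
    refine (H N 0 0 s (by simp) h0 (Agree.refl _ _)).mono ?_
    rintro t s' - ⟨t₀, h1, h2⟩
    exact ⟨t₀, by omega, h2⟩
  intro k
  induction k with
  | zero =>
    rintro i t s' rfl hI ha
    obtain ⟨h1, h2⟩ := hend t s' hI ha
    exact wp_while_false h1 h2 ⟨t, rfl, hI⟩
  | succ k ih =>
    intro i t s' hi hI ha
    obtain ⟨h1, h2, h3⟩ := hstep i (by omega) t s' hI ha
    refine wp_while_true h1 h2 (h3.mono ?_)
    intro t' s'' ha' hI'
    refine (ih (i + 1) _ s'' (by omega) hI' (ha.trans ha')).mono ?_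
    rintro t'' s₃ - ⟨t₀, h4, h5⟩
    exact ⟨t₀, by omega, h5⟩

end

/-- `L` is the list of the nodes of the linked list that starts at `x`, in which node `h` is
followed by node `f h`, and which ends at `0`. -/
def Chain (f : ℕ → ℕ) : ℕ → List ℕ → Prop
  | x, [] => x = 0
  | x, h :: L => x = h ∧ h ≠ 0 ∧ Chain f (f h) L

/-- Run `body` for every node of the linked list that starts at cell `v` of array `4` and is
linked through array `5`, with the node in register `6`. -/
def forAdj (v : Expr) (body : Prog) : Prog :=
  .assign 6 (.read 4 v) ;; .while (.reg 6) (body ;; .assign 6 (.read 5 (.reg 6)))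

/-- The invariant is indexed by the part of the list already visited. It has to be insensitive to
register `6`, which is the pointer of the loop; the body must leave this register and the links
alone. -/
theorem wp_forAdj {m w : ℕ} {v : Expr} {body : Prog} {s : State} {L : List ℕ}
    (I : List ℕ → State → Prop) (c : ℕ) (hw0 : 0 < w) (hv : v.Fits m w s) (hvm : v.eval s < m)
    (hL : Chain (s.arr 5) (s.arr 4 (v.eval s)) L) (hb : ∀ h ∈ L, h < m ∧ h < w)
    (h6 : body.writesReg 6 = false) (h5 : body.writesArr 5 = false)
    (h0 : I [] s) (hst : ∀ pre s' x, I pre s' → I pre (s'.setReg 6 x))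
    (hstep : ∀ pre h post, L = pre ++ h :: post → ∀ s', Agree (forAdj v body) s s' →
      s'.reg 6 = h → I pre s' → WP m w body s' fun t s'' => t ≤ c ∧ I (pre ++ [h]) s'') :
    WP m w (forAdj v body) s fun t s' => t ≤ (c + 5) * L.length + v.cost + 4 ∧ I L s' := by
  have hchain : ∀ x rest, Chain (s.arr 5) x rest → (∀ h ∈ rest, h < m ∧ h < w) → x < w := by
    intro x rest hc hr
    cases rest with
    | nil => rw [show x = 0 from hc]; exact hw0
    | cons h rest => rw [hc.1]; exact (hr h (by simp)).2
  suffices H : ∀ rest pre s', L = pre ++ rest → Agree (forAdj v body) s s' →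
      Chain (s.arr 5) (s'.reg 6) rest → I pre s' →
      WP m w (.while (.reg 6) (body ;; .assign 6 (.read 5 (.reg 6)))) s'
        fun t s'' => t ≤ (c + 5) * rest.length + 2 ∧ I L s'' by
    have hx := hchain _ L hL hb
    unfold forAdj
    rw [wp_seq, wp_assign]
    refine ⟨⟨hv, hvm, hx⟩, ?_⟩
    refine (H L [] _ rfl ?_ (by simpa [Expr.eval] using hL) (hst _ _ _ h0)).mono ?_
    · refine ⟨fun x hx => ?_, fun _ _ => rfl, fun _ => rfl, fun _ => rfl⟩
      simp only [forAdj, Prog.writesReg, Bool.or_eq_false_iff, beq_eq_false_iff_ne] at hx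
      simp [hx.1]
    · rintro t s' - ⟨h1, h2⟩
      refine ⟨?_, h2⟩
      simp only [Expr.cost]
      omega
  intro rest
  induction rest with
  | nil =>
    intro pre s' hpre ha hc hI
    have hc : s'.reg 6 = 0 := hc
    refine wp_while_false (by simp [Expr.Fits, hc, hw0]) hc ⟨by simp [Expr.cost], ?_⟩
    rw [hpre, List.append_nil]
    exact hI
  | cons h rest ih =>
    intro pre s' hpre ha hc hI
    obtain ⟨h1, h2, h3⟩ := hc
    have hhL : h ∈ L := by simp [hpre]
    refine wp_while_true ?_ (by simpa [Expr.eval, h1] using h2) ?_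
    · simp only [Expr.Fits, h1]
      exact (hb h hhL).2
    · rw [wp_seq]
      refine (hstep pre h rest hpre s' ha h1 hI).mono ?_
      rintro t s₁ ha₁ ⟨ht, hI₁⟩
      have h6' : s₁.reg 6 = h := (ha₁.reg 6 h6).trans h1
      have ha1' : Agree (forAdj v body) s s₁ := by
        refine ha.trans (ha₁.mono ?_ ?_ ?_) <;>
          simp +contextual [forAdj, Prog.writesReg, Prog.writesArr, Prog.emits]
      have h5' : s₁.arr 5 = s.arr 5 := ha1'.arr 5 (by
        simp [forAdj, Prog.writesArr, h5])
      have hx := hchain _ rest h3 fun g hg => hb g (by simp [hpre, hg])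
      rw [wp_assign]
      refine ⟨?_, ?_⟩
      · simp only [Expr.Fits, Expr.eval, h6', h5']
        exact ⟨(hb h hhL).2, (hb h hhL).1, hx⟩
      · refine (ih (pre ++ [h]) _ (by simp [hpre]) ?_ ?_ (hst _ _ _ hI₁)).mono ?_
        · refine ha1'.trans ⟨fun x hx => ?_, fun _ _ => rfl, fun _ => rfl, fun _ => rfl⟩
          simp only [forAdj, Prog.writesReg, Bool.or_eq_false_iff, beq_eq_false_iff_ne] at hx
          simp [hx.1]
        · simpa [Expr.eval, h6', h5'] using h3
        · rintro t' s₂ - ⟨ht', hI₂⟩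
          refine ⟨?_, hI₂⟩
          simp only [Expr.cost, List.length_cons]
          nlinarith

/-- The first `k` values of `f`. -/
def lst (f : ℕ → ℕ) (k : ℕ) : List ℕ := (List.range k).map f

@[simp] theorem lst_length (f : ℕ → ℕ) (k : ℕ) : (lst f k).length = k := by simp [lst]

theorem lst_succ (f : ℕ → ℕ) (k : ℕ) : lst f (k + 1) = lst f k ++ [f k] := by
  simp [lst, List.range_succ]

theorem lst_congr {f g : ℕ → ℕ} {k : ℕ} (h : ∀ i < k, f i = g i) : lst f k = lst g k := by
  simpa [lst] using h

theorem lst_update (f : ℕ → ℕ) (k v : ℕ) :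
    lst (Function.update f k v) (k + 1) = lst f k ++ [v] := by
  rw [lst_succ, Function.update_self]
  congr 1
  exact lst_congr fun i hi => by rw [Function.update_of_ne hi.ne]

theorem mem_lst {f : ℕ → ℕ} {k x : ℕ} : x ∈ lst f k ↔ ∃ i < k, f i = x := by simp [lst]

/-- Run `body` for every entry of the list stored in array `a` whose length is in register `k`,
with the index of the next entry in register `23` and the entry in register `24`. -/
def forList (a k : ℕ) (body : Prog) : Prog :=
  .assign 23 (.const 0) ;; .while (.lt (.reg 23) (.reg k))
    (.assign 24 (.read a (.reg 23)) ;; .assign 23 (.add (.reg 23) (.const 1)) ;; body)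

/-- The cost of the body may depend on the entry, so that scans of adjacency lists add up to a sum
of degrees instead of the length times the maximum degree. -/
theorem wp_forList {m w a k : ℕ} {body : Prog} {s : State} (I : List ℕ → State → Prop)
    (c : ℕ → ℕ) (hw : 1 < w) (hkm : s.reg k ≤ m) (hkw : s.reg k < w)
    (hb : ∀ y ∈ lst (s.arr a) (s.reg k), y < w)
    (hk1 : k ≠ 23) (hk2 : k ≠ 24) (hrk : body.writesReg k = false)
    (hr : body.writesReg 23 = false) (ha : body.writesArr a = false) (h0 : I [] s)
    (hst : ∀ pre s' x, I pre s' → I pre (s'.setReg 23 x) ∧ I pre (s'.setReg 24 x))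
    (hstep : ∀ pre y post, lst (s.arr a) (s.reg k) = pre ++ y :: post → ∀ s',
      Agree (forList a k body) s s' → s'.reg 24 = y → I pre s' →
      WP m w body s' fun t s'' => t ≤ c y ∧ I (pre ++ [y]) s'') :
    WP m w (forList a k body) s fun t s' =>
      t ≤ ((lst (s.arr a) (s.reg k)).map fun y => c y + 11).sum + 6 ∧
        I (lst (s.arr a) (s.reg k)) s' := by
  unfold forList
  rw [wp_seq, wp_assign]
  refine ⟨by simp only [Expr.Fits]; omega, ?_⟩
  refine (wp_while (N := s.reg k) (fun i t s' => s'.reg 23 = i ∧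
    I (lst (s.arr a) i) s' ∧ t ≤ ((lst (s.arr a) i).map fun y => c y + 11).sum) ?_ ?_ ?_).mono ?_
  · refine ⟨by simp [Expr.eval], ?_, by simp⟩
    simpa [lst] using (hst _ _ _ h0).1
  · rintro i hi t s' ⟨h1, h2, h3⟩ hag
    have hag' : Agree (forList a k body) s s' := by
      refine Agree.trans (s' := s.setReg 23 (Expr.eval s (.const 0)))
        ⟨fun x hx => ?_, fun _ _ => rfl, fun _ => rfl, fun _ => rfl⟩ (hag.mono ?_ ?_ ?_)
      · simp only [forList, Prog.writesReg, Bool.or_eq_false_iff, beq_eq_false_iff_ne] at hx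
        simp [hx.1]
      all_goals simp +contextual [forList, Prog.writesReg, Prog.writesArr, Prog.emits]
    have hk : s'.reg k = s.reg k := by
      rw [hag'.reg k (by simp [forList, Prog.writesReg, hk1, hk2, hrk])]
    have ha' : s'.arr a = s.arr a := hag'.arr a (by simp [forList, Prog.writesArr, ha])
    have hy : s.arr a i < w := hb _ (mem_lst.2 ⟨i, hi, rfl⟩)
    refine ⟨?_, ?_, ?_⟩
    · simp only [Expr.Fits, hk, h1]
      omega
    · simp [Expr.eval, h1, hk, hi]
    · simp only [wp_seq, wp_assign, Expr.Fits, Expr.eval, ha', h1, State.setReg_reg]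
      refine ⟨by omega, by simp; omega, ?_⟩
      have hsplit : lst (s.arr a) (s.reg k) = lst (s.arr a) i ++ s.arr a i ::
          (((List.range (s.reg k)).map (s.arr a)).drop (i + 1)) := by
        conv_lhs => rw [lst, ← List.take_append_drop (i + 1) ((List.range (s.reg k)).map (s.arr a))]
        rw [← List.map_take, List.take_range, min_eq_left (by omega), List.range_succ]
        simp [lst]
      refine (hstep _ _ _ hsplit _ ?_ (by simp) ?_).mono ?_
      · refine hag'.trans ⟨fun x hx => ?_, fun _ _ => rfl, fun _ => rfl, fun _ => rfl⟩
        simp only [forList, Prog.writesReg, Bool.or_eq_false_iff, beq_eq_false_iff_ne] at hx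
        simp [hx.1, hx.2.1]
      · exact (hst _ _ _ (hst _ _ _ h2).2).1
      · rintro t' s'' hag2 ⟨h4, h5⟩
        refine ⟨?_, ?_, ?_⟩
        · rw [hag2.reg 23 hr]
          simp
        · rw [lst_succ]
          exact h5
        · rw [lst_succ]
          simp only [List.map_append, List.sum_append, List.map_cons, List.map_nil, List.sum_cons,
            List.sum_nil, Expr.cost]
          omega
  · rintro t s' ⟨h1, h2, h3⟩ hag
    have hk : s'.reg k = s.reg k := by
      rw [hag.reg k (by simp [Prog.writesReg, hk1, hk2, hrk])]
      simp [hk1]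
    simp only [Expr.Fits, Expr.eval, h1, hk]
    simp
    omega
  · rintro t s' - ⟨t₀, rfl, h1, h2, h3⟩
    refine ⟨?_, h2⟩
    simp only [Expr.cost]
    omega

end RAM

/-! ## Adjacency lists in memory -/

namespace IGraph

/-- The half-edges leaving `v` that belong to the first `i` edges; edge `e` has the half-edges
`2 e + 1` from `eu e` to `ev e` and `2 e + 2` from `ev e` to `eu e`. -/
def halves (G : IGraph) : ℕ → ℕ → List ℕ
  | 0, _ => []
  | i + 1, v =>
    if v = G.ev i then (i + i + 2) :: halves G i v
    else if v = G.eu i then (i + i + 1) :: halves G i v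
    else halves G i v

/-- New half-edges go to the front, as in memory. Their numbers start at `1` because `0` ends a
linked list. -/
def adjL (G : IGraph) (v : ℕ) : List ℕ := G.halves G.E v

def deg (G : IGraph) (v : ℕ) : ℕ := (G.adjL v).length

/-- The edge of a half-edge. -/
def eid (h : ℕ) : ℕ := (h - 1) / 2

/-- The end of a half-edge. -/
def tgt (G : IGraph) (h : ℕ) : ℕ := if h % 2 = 1 then G.ev (eid h) else G.eu (eid h)

variable {G : IGraph}

theorem mem_halves {i v h : ℕ} :
    h ∈ G.halves i v ↔ ∃ e < i, (h = e + e + 2 ∧ v = G.ev e) ∨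
      (h = e + e + 1 ∧ v = G.eu e ∧ v ≠ G.ev e) := by
  induction i with
  | zero => simp [halves]
  | succ i ih =>
    have key : (∃ e < i + 1, (h = e + e + 2 ∧ v = G.ev e) ∨
        (h = e + e + 1 ∧ v = G.eu e ∧ v ≠ G.ev e)) ↔
        ((h = i + i + 2 ∧ v = G.ev i) ∨ (h = i + i + 1 ∧ v = G.eu i ∧ v ≠ G.ev i)) ∨
        h ∈ G.halves i v := by
      rw [ih]
      constructor
      · rintro ⟨e, he, h'⟩
        rcases Nat.lt_succ_iff_lt_or_eq.1 he with he | rfl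
        · exact Or.inr ⟨e, he, h'⟩
        · exact Or.inl h'
      · rintro (h' | ⟨e, he, h'⟩)
        · exact ⟨i, by omega, h'⟩
        · exact ⟨e, by omega, h'⟩
    rw [key, halves]
    split_ifs with h1 h2
    · simp [← h1]
    · simp [← h2, h1]
    · simp [h1, h2]

theorem eid_even (e : ℕ) : eid (e + e + 2) = e := by simp only [eid]; omega
theorem eid_odd (e : ℕ) : eid (e + e + 1) = e := by simp only [eid]; omega
theorem tgt_even (e : ℕ) : G.tgt (e + e + 2) = G.eu e := by
  rw [tgt, eid_even, if_neg (by omega)]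
theorem tgt_odd (e : ℕ) : G.tgt (e + e + 1) = G.ev e := by
  rw [tgt, eid_odd, if_pos (by omega)]

theorem mem_adjL {v h : ℕ} (hh : h ∈ G.adjL v) :
    1 ≤ h ∧ h ≤ 2 * G.E ∧ eid h < G.E ∧ G.Joins (eid h) v (G.tgt h) := by
  obtain ⟨e, he, ⟨rfl, rfl⟩ | ⟨rfl, rfl, -⟩⟩ := mem_halves.1 hh
  · rw [eid_even, tgt_even]
    exact ⟨by omega, by omega, he, Or.inr ⟨rfl, rfl⟩⟩
  · rw [eid_odd, tgt_odd]
    exact ⟨by omega, by omega, he, Or.inl ⟨rfl, rfl⟩⟩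

theorem exists_half {e v z : ℕ} (he : e < G.E) (hj : G.Joins e v z) :
    ∃ h ∈ G.adjL v, eid h = e ∧ G.tgt h = z := by
  rcases hj with ⟨rfl, rfl⟩ | ⟨rfl, rfl⟩
  · exact ⟨e + e + 1, mem_halves.2 ⟨e, he, Or.inr ⟨rfl, rfl, G.ne e he⟩⟩, eid_odd e, tgt_odd e⟩
  · exact ⟨e + e + 2, mem_halves.2 ⟨e, he, Or.inl ⟨rfl, rfl⟩⟩, eid_even e, tgt_even e⟩

theorem tgt_lt {v h : ℕ} (hh : h ∈ G.adjL v) : G.tgt h < G.n := by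
  obtain ⟨-, -, he, hj⟩ := mem_adjL hh
  rcases hj with ⟨-, h⟩ | ⟨h, -⟩
  · exact h ▸ G.ev_lt _ he
  · exact h ▸ G.eu_lt _ he

theorem adj_iff_half {a b v z : ℕ} :
    G.Adj a b v z ↔ ∃ h ∈ G.adjL v, G.tgt h = z ∧ G.st (eid h) ≤ a ∧ b ≤ G.en (eid h) := by
  constructor
  · rintro ⟨e, he, hj, h1, h2⟩
    obtain ⟨h, hh, rfl, rfl⟩ := exists_half he hj
    exact ⟨h, hh, rfl, h1, h2⟩
  · rintro ⟨h, hh, rfl, h1, h2⟩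
    obtain ⟨-, -, he, hj⟩ := mem_adjL hh
    exact ⟨_, he, hj, h1, h2⟩

theorem halves_eid_lt {i v h : ℕ} (hh : h ∈ G.halves i v) : h ≤ 2 * i ∧ eid h < i := by
  obtain ⟨e, he, ⟨rfl, -⟩ | ⟨rfl, -⟩⟩ := mem_halves.1 hh
  · rw [eid_even]; omega
  · rw [eid_odd]; omega

theorem nodup_eid (i v : ℕ) : ((G.halves i v).map eid).Nodup := by
  induction i with
  | zero => simp [halves]
  | succ i ih =>
    have hn : i ∉ (G.halves i v).map eid := by
      simp only [List.mem_map, not_exists, not_and]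
      intro h hh he
      have := halves_eid_lt hh
      omega
    rw [halves]
    split_ifs
    · rw [List.map_cons, List.nodup_cons, eid_even]
      exact ⟨hn, ih⟩
    · rw [List.map_cons, List.nodup_cons, eid_odd]
      exact ⟨hn, ih⟩
    · exact ih

theorem nodup_adjL (v : ℕ) : (G.adjL v).Nodup := List.Nodup.of_map _ (nodup_eid _ _)

theorem tgt_inj {v h h' : ℕ} (hh : h ∈ G.adjL v) (hh' : h' ∈ G.adjL v) (ht : G.tgt h = G.tgt h') :
    h = h' := by
  obtain ⟨-, -, he, hj⟩ := mem_adjL hh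
  obtain ⟨-, -, he', hj'⟩ := mem_adjL hh'
  rw [← ht] at hj'
  exact List.inj_on_of_nodup_map (nodup_eid _ _) hh hh' (hj.eq he he' hj')

/-- The graph is simple, so the scan of one adjacency list meets every neighbour once. A counter of
neighbours thus grows by at most one during the scan. -/
theorem tgt_notMem {v h : ℕ} {pre post : List ℕ} (hL : G.adjL v = pre ++ h :: post) :
    ∀ g ∈ pre, G.tgt g ≠ G.tgt h := by
  intro g hg he
  have hn := nodup_adjL (G := G) v
  have : g = h := tgt_inj (v := v) (by simp [hL, hg]) (by simp [hL]) he
  subst this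
  rw [hL, List.nodup_append] at hn
  exact hn.2.2 g hg g (by simp) rfl

end IGraph

namespace RAM

open IGraph

/-- The limits of the machine are large enough for the graph and the threshold. -/
structure Big (G : IGraph) (σ m w : ℕ) : Prop where
  m_ge : G.n + 2 * G.E + 4 ≤ m
  w_ge : m + G.T + σ + 4 ≤ w

/-- The input and the adjacency lists are in memory. -/
structure Env (G : IGraph) (σ : ℕ) (s : State) : Prop where
  r0 : s.reg 0 = G.n
  r1 : s.reg 1 = G.E
  r2 : s.reg 2 = G.T
  r3 : s.reg 3 = σ
  a0 : ∀ e < G.E, s.arr 0 e = G.eu e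
  a1 : ∀ e < G.E, s.arr 1 e = G.ev e
  a2 : ∀ e < G.E, s.arr 2 e = G.st e
  a3 : ∀ e < G.E, s.arr 3 e = G.en e
  chain : ∀ v < G.n, Chain (s.arr 5) (s.arr 4 v) (G.adjL v)
  a6 : ∀ h, 1 ≤ h → h ≤ 2 * G.E → s.arr 6 h = G.tgt h
  a7 : ∀ h, 1 ≤ h → h ≤ 2 * G.E → s.arr 7 h = eid h

/-- The program does not write to the registers and arrays that hold the graph. -/
def Prog.static (p : Prog) : Bool :=
  (List.range 4).all (fun x => !p.writesReg x) && (List.range 8).all (fun a => !p.writesArr a)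

theorem Env.agree {G : IGraph} {σ : ℕ} {s s' : State} {p : Prog} (h : Env G σ s)
    (ha : Agree p s s') (hp : p.static = true) : Env G σ s' := by
  simp only [Prog.static, Bool.and_eq_true, List.all_eq_true, List.mem_range,
    Bool.not_eq_true'] at hp
  obtain ⟨hr, hw⟩ := hp
  have hr' := fun x hx => ha.reg x (hr x hx)
  have hw' := fun x hx => ha.arr x (hw x hx)
  constructor
  · rw [hr' 0 (by omega), h.r0]
  · rw [hr' 1 (by omega), h.r1]
  · rw [hr' 2 (by omega), h.r2]
  · rw [hr' 3 (by omega), h.r3]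
  · rw [hw' 0 (by omega)]; exact h.a0
  · rw [hw' 1 (by omega)]; exact h.a1
  · rw [hw' 2 (by omega)]; exact h.a2
  · rw [hw' 3 (by omega)]; exact h.a3
  · rw [hw' 4 (by omega), hw' 5 (by omega)]; exact h.chain
  · rw [hw' 6 (by omega)]; exact h.a6
  · rw [hw' 7 (by omega)]; exact h.a7

theorem Env.setReg {G : IGraph} {σ : ℕ} {s : State} (h : Env G σ s) (x v : ℕ) (hx : 4 ≤ x) :
    Env G σ (s.setReg x v) := by
  constructor <;> simp only [State.setReg_arr, State.setReg_reg]
  · rw [if_neg (by omega), h.r0]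
  · rw [if_neg (by omega), h.r1]
  · rw [if_neg (by omega), h.r2]
  · rw [if_neg (by omega), h.r3]
  · exact h.a0
  · exact h.a1
  · exact h.a2
  · exact h.a3
  · exact h.chain
  · exact h.a6
  · exact h.a7

/-- What the machine sees of a half-edge. -/
structure Half (G : IGraph) (m w : ℕ) (v h : ℕ) (s : State) : Prop where
  mem : h ∈ G.adjL v
  r6 : s.reg 6 = h
  a6 : s.arr 6 h = G.tgt h
  a7 : s.arr 7 h = eid h
  a2 : s.arr 2 (eid h) = G.st (eid h)
  a3 : s.arr 3 (eid h) = G.en (eid h)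
  hm : h < m
  hw : h < w
  em : eid h < m
  ew : eid h < w
  tn : G.tgt h < G.n
  tm : G.tgt h < m
  tw : G.tgt h < w
  sw : G.st (eid h) < w
  nw : G.en (eid h) < w

section

variable {G : IGraph} {σ m w : ℕ} {s : State}

theorem Env.half (hE : Env G σ s) (hB : Big G σ m w) {v h : ℕ} (hh : h ∈ G.adjL v)
    (h6 : s.reg 6 = h) : Half G m w v h s := by
  obtain ⟨h1, h2, he, hj⟩ := mem_adjL hh
  have h3 := tgt_lt hh
  have h4 := hB.m_ge
  have h5 := hB.w_ge
  have h7 := G.st_le _ he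
  have h8 := G.en_le _ he
  exact ⟨hh, h6, hE.a6 h h1 h2, hE.a7 h h1 h2, hE.a2 _ he, hE.a3 _ he, by omega, by omega,
    by omega, by omega, h3, by omega, by omega, by omega, by omega⟩

/-- The constant overhead of the loop is absorbed by the summand `1` in `deg v + 1`. -/
theorem wp_adj (hB : Big G σ m w) (hE : Env G σ s) {x v : ℕ} {body : Prog} (hx : s.reg x = v)
    (hv : v < G.n) (I : List ℕ → State → Prop) (c : ℕ) (h6 : body.writesReg 6 = false)
    (hs : body.static = true) (h0 : I [] s) (hst : ∀ pre s' x, I pre s' → I pre (s'.setReg 6 x))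
    (hstep : ∀ pre h post, G.adjL v = pre ++ h :: post → ∀ s', Agree (forAdj (.reg x) body) s s' →
      Env G σ s' → Half G m w v h s' → I pre s' →
      WP m w body s' fun t s'' => t ≤ c ∧ I (pre ++ [h]) s'') :
    WP m w (forAdj (.reg x) body) s fun t s' => t ≤ (c + 5) * (G.deg v + 1) ∧ I (G.adjL v) s' := by
  have h1 := hB.m_ge
  have h2 := hB.w_ge
  have hstat := hs
  simp only [Prog.static, Bool.and_eq_true, List.all_eq_true, List.mem_range,
    Bool.not_eq_true'] at hs
  have hs' : (forAdj (.reg x) body).static = true := by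
    simp only [Prog.static, Bool.and_eq_true, List.all_eq_true, List.mem_range, Bool.not_eq_true',
      forAdj, Prog.writesReg, Prog.writesArr, Bool.or_eq_false_iff, beq_eq_false_iff_ne]
    exact ⟨fun y hy => ⟨by omega, hs.1 y hy, by omega⟩, fun y hy => ⟨trivial, hs.2 y hy, trivial⟩⟩
  refine (wp_forAdj (L := G.adjL v) I c (by omega) ?_ ?_ ?_ ?_ h6 (hs.2 5 (by omega)) h0 hst
    ?_).mono ?_
  · simp only [Expr.Fits, hx]; omega
  · simp only [Expr.eval, hx]; omega
  · simpa only [Expr.eval, hx] using hE.chain v hv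
  · intro h hh
    have := mem_adjL hh
    omega
  · intro pre h post hL s' ha hr hI
    have hE' := hE.agree ha hs'
    exact hstep pre h post hL s' ha hE' (hE'.half hB (by simp [hL]) hr) hI
  · rintro t s' - ⟨ht, hI⟩
    refine ⟨?_, hI⟩
    simp only [Expr.cost, deg] at ht ⊢
    nlinarith

/-- The vertex list of length `reg k` in array `a`. -/
theorem wp_list (hB : Big G σ m w) (hE : Env G σ s) {a k : ℕ} {body : Prog}
    {l : List ℕ} (hl : lst (s.arr a) (s.reg k) = l) (hln : ∀ y ∈ l, y < G.n)
    (hk : s.reg k ≤ G.n) (I : List ℕ → State → Prop) (c : ℕ)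
    (hk1 : k ≠ 23) (hk2 : k ≠ 24) (hrk : body.writesReg k = false)
    (hr : body.writesReg 23 = false) (ha : body.writesArr a = false)
    (hs : body.static = true) (h0 : I [] s)
    (hst : ∀ pre s' x, I pre s' → I pre (s'.setReg 23 x) ∧ I pre (s'.setReg 24 x))
    (hstep : ∀ pre y post, l = pre ++ y :: post → ∀ s', Agree (forList a k body) s s' →
      Env G σ s' → s'.reg 24 = y → y < G.n → I pre s' →
      WP m w body s' fun t s'' => t ≤ c * (G.deg y + 1) ∧ I (pre ++ [y]) s'') :
    WP m w (forList a k body) s fun t s' =>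
      t ≤ (c + 11) * (l.map fun y => G.deg y + 1).sum + 6 ∧ I l s' := by
  have h1 := hB.m_ge
  have h2 := hB.w_ge
  subst hl
  simp only [Prog.static, Bool.and_eq_true, List.all_eq_true, List.mem_range,
    Bool.not_eq_true'] at hs
  have hs' : (forList a k body).static = true := by
    simp only [Prog.static, Bool.and_eq_true, List.all_eq_true, List.mem_range, Bool.not_eq_true',
      forList, Prog.writesReg, Prog.writesArr, Bool.or_eq_false_iff, beq_eq_false_iff_ne]
    exact ⟨fun y hy => ⟨by omega, by omega, by omega, hs.1 y hy⟩,
      fun y hy => ⟨trivial, trivial, trivial, hs.2 y hy⟩⟩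
  refine (wp_forList I (fun y => c * (G.deg y + 1)) (by omega) (by omega) (by omega) ?_ hk1 hk2 hrk
    hr ha h0 hst ?_).mono ?_
  · intro y hy
    have := hln y hy
    omega
  · intro pre y post hL s' hag hy hI
    exact hstep pre y post hL s' hag (hE.agree hag hs') hy (hln y (by rw [hL]; simp)) hI
  · rintro t s' - ⟨ht, hI⟩
    refine ⟨ht.trans ?_, hI⟩
    rw [← List.sum_map_mul_left]
    refine Nat.add_le_add_right (List.sum_le_sum fun y _ => ?_) 6
    nlinarith

end

end RAM

/-! ## Completion of a clique -/

namespace IGraph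

variable (G : IGraph)

/-- `a` is the last start and `b` the first end of the edges in `F`, with defaults for `F = ∅`. -/
def Bounds (F : ℕ → Prop) (a b : ℕ) : Prop :=
  (∀ e, F e → G.st e ≤ a ∧ b ≤ G.en e) ∧ (a = 0 ∨ ∃ e, F e ∧ G.st e = a) ∧
    (b = G.T ∨ ∃ e, F e ∧ G.en e = b)

/-- The edges with both ends in `l`. -/
def Inside (l : List ℕ) (e : ℕ) : Prop := e < G.E ∧ G.eu e ∈ l ∧ G.ev e ∈ l

open Classical in
/-- The number of neighbours of `z` in `l`, in the graph of the edges active during `[a, b]`. -/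
noncomputable def count (a b : ℕ) (l : List ℕ) (z : ℕ) : ℕ := l.countP fun x => G.Adj a b x z

/-- `D` bounds the sum of the degrees plus one over every clique. -/
def DegBound (D : ℕ) : Prop :=
  ∀ U : Finset ℕ, (∀ u ∈ U, u < G.n) → (∀ u ∈ U, ∀ v ∈ U, u ≠ v → ∃ e < G.E, G.Joins e u v) →
    ∑ u ∈ U, (G.deg u + 1) ≤ D

variable {G}

theorem Bounds.empty : G.Bounds (fun _ => False) 0 G.T :=
  ⟨fun _ h => h.elim, Or.inl rfl, Or.inl rfl⟩

theorem Bounds.insert {F : ℕ → Prop} {a b e : ℕ} (h : G.Bounds F a b) :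
    G.Bounds (fun f => F f ∨ f = e) (if a < G.st e then G.st e else a)
      (if G.en e < b then G.en e else b) := by
  obtain ⟨h1, h2, h3⟩ := h
  refine ⟨?_, ?_, ?_⟩
  · rintro f (hf | rfl)
    · have := h1 f hf
      split_ifs <;> omega
    · split_ifs <;> omega
  · split_ifs
    · exact Or.inr ⟨e, Or.inr rfl, rfl⟩
    · rcases h2 with h2 | ⟨f, hf, hf'⟩
      · exact Or.inl h2
      · exact Or.inr ⟨f, Or.inl hf, hf'⟩
  · split_ifs
    · exact Or.inr ⟨e, Or.inr rfl, rfl⟩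
    · rcases h3 with h3 | ⟨f, hf, hf'⟩
      · exact Or.inl h3
      · exact Or.inr ⟨f, Or.inl hf, hf'⟩

theorem Bounds.congr {F F' : ℕ → Prop} {a b : ℕ} (h : G.Bounds F a b) (hF : ∀ e, F e ↔ F' e) :
    G.Bounds F' a b := by
  obtain rfl : F = F' := funext fun e => propext (hF e)
  exact h

theorem Bounds.isTau {l : List ℕ} {a b : ℕ} (h : G.Bounds (G.Inside l) a b)
    (hl : ∀ u ∈ l, ∀ v ∈ l, u ≠ v → ∃ e < G.E, G.Joins e u v) (h2 : ∃ u ∈ l, ∃ v ∈ l, u ≠ v) :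
    G.IsTau l.toFinset a b := by
  have key : ∀ u ∈ l, ∀ v ∈ l, u ≠ v → ∃ e, G.Inside l e ∧ G.Joins e u v := by
    intro u hu v hv huv
    obtain ⟨e, he, hj⟩ := hl u hu v hv huv
    refine ⟨e, ⟨he, ?_⟩, hj⟩
    rcases hj with ⟨rfl, rfl⟩ | ⟨rfl, rfl⟩ <;> exact ⟨by assumption, by assumption⟩
  obtain ⟨u, hu, v, hv, huv⟩ := h2
  obtain ⟨e, he, -⟩ := key u hu v hv huv
  have h1 := h.1 e he
  have h3 := G.st_pos e he.1
  have h4 := G.en_le e he.1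
  refine ⟨fun u hu v hv huv => ?_, ?_, ?_⟩
  · obtain ⟨f, hf, hj⟩ := key u (by simpa using hu) v (by simpa using hv) huv
    exact ⟨f, hf.1, hj, h.1 f hf⟩
  -- The default `a = 0` is impossible, as some edge is present and starts are at least `1`. The
  -- default `b = T` is harmless: the edge `e` ends between `b` and `T`, hence attains `b`.
  · rcases h.2.1 with h0 | ⟨f, hf, hf'⟩
    · omega
    · exact ⟨f, hf.1, by simpa using hf.2.1, by simpa using hf.2.2, hf'⟩
  · rcases h.2.2 with h0 | ⟨f, hf, hf'⟩
    · exact ⟨e, he.1, by simpa using he.2.1, by simpa using he.2.2, by omega⟩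
    · exact ⟨f, hf.1, by simpa using hf.2.1, by simpa using hf.2.2, hf'⟩

theorem count_nil (a b : ℕ) : G.count a b [] = fun _ => 0 := by
  ext z; simp [count]

open Classical in
theorem count_append (a b : ℕ) (l : List ℕ) (y z : ℕ) :
    G.count a b (l ++ [y]) z = G.count a b l z + if G.Adj a b y z then 1 else 0 := by
  simp [count, List.countP_append, List.countP_singleton]

theorem count_le (a b : ℕ) (l : List ℕ) (z : ℕ) : G.count a b l z ≤ l.length :=
  List.countP_le_length

theorem count_eq_length {a b : ℕ} {l : List ℕ} {z : ℕ} :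
    G.count a b l z = l.length ↔ ∀ x ∈ l, G.Adj a b x z := by
  simp [count, List.countP_eq_length]

theorem exists_of_count {a b : ℕ} {l : List ℕ} {z : ℕ} (h : G.count a b l z ≠ 0) :
    ∃ x ∈ l, G.Adj a b x z := by
  have := List.countP_pos_iff.1 (Nat.pos_of_ne_zero h)
  simpa using this

theorem DegBound.list {D : ℕ} (hD : G.DegBound D) {l : List ℕ} (hn : l.Nodup)
    (hlt : ∀ u ∈ l, u < G.n) (hl : ∀ u ∈ l, ∀ v ∈ l, u ≠ v → ∃ e < G.E, G.Joins e u v) :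
    (l.map fun y => G.deg y + 1).sum ≤ D := by
  have := hD l.toFinset (by simpa using hlt) (by simpa using hl)
  rwa [List.sum_toFinset _ hn] at this

theorem length_le {l : List ℕ} (hn : l.Nodup) (hlt : ∀ u ∈ l, u < G.n) : l.length ≤ G.n := by
  rw [← List.toFinset_card_of_nodup hn, ← Finset.card_range G.n]
  exact Finset.card_le_card fun x hx => by simpa using hlt x (by simpa using hx)

end IGraph

namespace RAM

open IGraph

/-- The end of the current half-edge, and the first and the last active time of its edge. -/
abbrev eTo : Expr := .read 6 (.reg 6)
abbrev eSt : Expr := .read 2 (.read 7 (.reg 6))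
abbrev eEn : Expr := .read 3 (.read 7 (.reg 6))

/-- Array `12` marks the vertices already scanned, so an edge inside the list is taken into account
once, when its second end is scanned. -/
def tauBody : Prog :=
  .ite (.read 12 eTo)
    (.ite (.lt (.reg 21) eSt) (.assign 21 eSt) .skip ;;
      .ite (.lt eEn (.reg 22)) (.assign 22 eEn) .skip)
    .skip

/-- Compute the active time of the clique in array `10` into registers `21` and `22`. -/
def tauLoop : Prog :=
  .assign 21 (.const 0) ;; .assign 22 (.reg 2) ;;
    forList 10 20 (forAdj (.reg 24) tauBody ;; .write 12 (.reg 24) (.const 1))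

/-- Array `11` counts, for every vertex, its neighbours among the members scanned so far. A count
equal to the length of the list reveals a common neighbour of the whole list, and register `25`
keeps the least of them. -/
def greedyBody : Prog :=
  .ite (.lt (.reg 21) eSt) .skip
    (.ite (.lt eEn (.reg 22)) .skip
      (.write 11 eTo (.add (.read 11 eTo) (.const 1)) ;;
        .ite (.eq (.read 11 eTo) (.reg 20))
          (.ite (.lt eTo (.reg 25)) (.assign 25 eTo) .skip) .skip))

/-- A count reaches the length only while the last member is scanned. A vertex is therefore added
only then, and it is the next one to be scanned. In this way every member of the completion is
scanned exactly once. -/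
def greedyStep : Prog :=
  .assign 24 (.read 10 (.reg 23)) ;; .assign 23 (.add (.reg 23) (.const 1)) ;;
    .assign 25 (.reg 0) ;; forAdj (.reg 24) greedyBody ;;
    .ite (.lt (.reg 25) (.reg 0))
      (.write 10 (.reg 20) (.reg 25) ;; .assign 20 (.add (.reg 20) (.const 1)) ;;
        .ite (.lt (.reg 25) (.reg 26)) (.assign 26 (.reg 25)) .skip) .skip

/-- Extend the clique in array `10` greedily; register `26` receives the least added vertex. -/
def greedy : Prog :=
  .assign 23 (.const 0) ;; .assign 26 (.reg 0) ;; .while (.lt (.reg 23) (.reg 20)) greedyStep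

/-- Reset the arrays `11` and `12`. -/
def cleanup : Prog :=
  forList 10 20 (.write 12 (.reg 24) (.const 0) ;; forAdj (.reg 24) (.write 11 eTo (.const 0)))

/-- Each of the three passes is linear in the degree sum of the completed clique. The work space is
cleaned only where it may have been changed, since a pass over all vertices would be too expensive.
-/
def closure : Prog := tauLoop ;; greedy ;; cleanup

section

variable {G : IGraph} {σ m w : ℕ} {s : State}

theorem wp_tauBody {v h : ℕ} (hw : 1 < w) (hh : Half G m w v h s) (F : ℕ → Prop)
    (hb : G.Bounds F (s.reg 21) (s.reg 22)) (h21 : s.reg 21 < w) (h22 : s.reg 22 < w)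
    (h12 : s.arr 12 (G.tgt h) ≤ 1) :
    WP m w tauBody s fun t s' => t ≤ 30 ∧
      G.Bounds (fun e => F e ∨ (s.arr 12 (G.tgt h) = 1 ∧ e = eid h)) (s'.reg 21) (s'.reg 22) ∧
      s'.reg 21 < w ∧ s'.reg 22 < w := by
  have hi := hb.insert (e := eid h)
  have := hh.sw
  have := hh.nw
  have := hh.hw
  have := hh.ew
  unfold tauBody
  rcases Nat.le_one_iff_eq_zero_or_eq_one.1 h12 with h0 | h0
  · simp [wp_seq, wp_ite, wp_assign, wp_skip, Expr.Fits, Expr.eval, Expr.cost, hh.r6, hh.a6,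
      hh.hm, hh.hw, hh.tm, hh.tw, h0, h21, h22, hb]
    omega
  · simp [wp_seq, wp_ite, wp_assign, wp_skip, Expr.Fits, Expr.eval, Expr.cost, hh.r6, hh.a6,
      hh.a7, hh.a2, hh.a3, hh.hm, hh.hw, hh.em, hh.ew, hh.tm, hh.tw, hh.sw, hh.nw, h21, h22, h0, hw]
    split_ifs at hi ⊢ <;> simp_all

theorem wp_tauLoop (hB : Big G σ m w) (hE : Env G σ s) {l : List ℕ}
    (hl : lst (s.arr 10) (s.reg 20) = l) (hln : ∀ y ∈ l, y < G.n) (hnd : l.Nodup)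
    (h12 : s.arr 12 = fun _ => 0) :
    WP m w tauLoop s fun t s' => t ≤ 60 * (l.map fun y => G.deg y + 1).sum + 20 ∧
      G.Bounds (G.Inside l) (s'.reg 21) (s'.reg 22) ∧
      s'.arr 12 = fun z => if z ∈ l then 1 else 0 := by
  have hm := hB.m_ge
  have hw := hB.w_ge
  have hlen : s.reg 20 ≤ G.n := by
    have := length_le hnd hln
    rwa [← hl, lst_length] at this
  unfold tauLoop
  simp only [wp_seq, wp_assign, Expr.Fits, Expr.eval, Expr.cost, State.setReg_reg]
  refine ⟨by omega, by simp [hE.r2]; omega, ?_⟩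
  have hE' := (hE.setReg 21 0 (by omega)).setReg 22 G.T (by omega)
  have e2 : (if 2 = 21 then 0 else s.reg 2) = G.T := by simp [hE.r2]
  rw [e2]
  refine (wp_list hB hE' (l := l) (by simpa using hl) hln (by simpa using hlen)
    (fun pre s' => G.Bounds (G.Inside pre) (s'.reg 21) (s'.reg 22) ∧ s'.reg 21 < w ∧
      s'.reg 22 < w ∧ s'.arr 12 = fun z => if z ∈ pre then 1 else 0) 40
    (by decide) (by decide) rfl rfl rfl rfl ?_ ?_ ?_).mono ?_
  · refine ⟨?_, by simp; omega, by simp; omega, by simp [h12]⟩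
    simpa using Bounds.empty.congr (fun e => by simp [Inside])
  · intro pre s' x hI
    simpa using hI
  · rintro pre y post hsplit s' hag hEs hy hyn ⟨hb, h21, h22, h12'⟩
    rw [wp_seq]
    refine (wp_adj hB hEs hy hyn (fun pre' s'' => G.Bounds (fun e => G.Inside pre e ∨
        ∃ h ∈ pre', G.tgt h ∈ pre ∧ eid h = e) (s''.reg 21) (s''.reg 22) ∧ s''.reg 21 < w ∧
        s''.reg 22 < w) 30 rfl rfl ?_ ?_ ?_).mono ?_
    · exact ⟨hb.congr (by simp), h21, h22⟩
    · intro pre' s'' x hI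
      simpa using hI
    · rintro pre' h post' hsplit' s'' hag' hEs' hh ⟨hb', h21', h22'⟩
      have h12'' : s''.arr 12 = fun z => if z ∈ pre then 1 else 0 := (hag'.arr 12 rfl).trans h12'
      refine (wp_tauBody (by omega) hh _ hb' h21' h22' ?_).mono ?_
      · rw [h12'']
        dsimp only
        split_ifs <;> omega
      · rintro t s₃ - ⟨ht, hb3, h213, h223⟩
        refine ⟨ht, hb3.congr fun e => ?_, h213, h223⟩
        rw [h12'']
        simp only [ite_eq_left_iff, zero_ne_one, imp_false, not_not, List.mem_append,
          List.mem_singleton]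
        constructor
        · rintro ((h1 | ⟨g, h1, h2, h3⟩) | ⟨h1, h2⟩)
          · exact Or.inl h1
          · exact Or.inr ⟨g, Or.inl h1, h2, h3⟩
          · exact Or.inr ⟨h, Or.inr rfl, h1, h2.symm⟩
        · rintro (h1 | ⟨g, h1 | rfl, h2, h3⟩)
          · exact Or.inl (Or.inl h1)
          · exact Or.inl (Or.inr ⟨g, h1, h2, h3⟩)
          · exact Or.inr ⟨h2, h3.symm⟩
    · rintro t s'' hag' ⟨ht, hb', h21', h22'⟩
      have h24 : s''.reg 24 = y := (hag'.reg 24 rfl).trans hy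
      have h12'' : s''.arr 12 = fun z => if z ∈ pre then 1 else 0 := (hag'.arr 12 rfl).trans h12'
      rw [wp_write]
      simp only [Expr.Fits, Expr.eval, Expr.cost, h24, State.setCell_reg, State.setCell_arr]
      refine ⟨by omega, by omega, by omega, by omega, hb'.congr fun e => ?_, h21', h22', ?_⟩
      · simp only [Inside, List.mem_append, List.mem_singleton]
        constructor
        · rintro (⟨h1, h2, h3⟩ | ⟨h, h1, h2, rfl⟩)
          · exact ⟨h1, Or.inl h2, Or.inl h3⟩
          · obtain ⟨-, -, he, hj⟩ := mem_adjL h1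
            rcases hj with ⟨h4, h5⟩ | ⟨h4, h5⟩
            · exact ⟨he, Or.inr h4, Or.inl (h5 ▸ h2)⟩
            · exact ⟨he, Or.inl (h4 ▸ h2), Or.inr h5⟩
        · rintro ⟨h1, h2 | h2, h3 | h3⟩
          · exact Or.inl ⟨h1, h2, h3⟩
          · obtain ⟨h, hh, he, ht⟩ := exists_half h1 (Or.inr ⟨rfl, h3⟩)
            exact Or.inr ⟨h, hh, ht ▸ h2, he⟩
          · obtain ⟨h, hh, he, ht⟩ := exists_half h1 (Or.inl ⟨h2, rfl⟩)
            exact Or.inr ⟨h, hh, ht ▸ h3, he⟩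
          · exact absurd (h2.trans h3.symm) (G.ne e h1)
      · rw [if_pos trivial, h12'']
        ext z
        by_cases hz : z = y
        · subst hz; simp
        · simp [hz]
  · rintro t s' - ⟨ht, hb, -, -, h12'⟩
    exact ⟨by omega, hb, h12'⟩

end

end RAM

namespace RAM

open IGraph

section

variable {G : IGraph} {σ m w : ℕ} {s : State}

/-- The edge of half-edge `h` is active during `[a, b]`. -/
def Ok (G : IGraph) (a b h : ℕ) : Prop := G.st (eid h) ≤ a ∧ b ≤ G.en (eid h)

open Classical in
/-- The invariant of the scan of a vertex `y` in the greedy completion, where `pre` is the list of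
the vertices scanned before and `done` is the list of the half-edges of `y` seen so far. -/
structure ScanInv (G : IGraph) (a b k : ℕ) (pre done : List ℕ) (s : State) : Prop where
  cnt : s.arr 11 = fun z => G.count a b pre z + if ∃ h ∈ done, G.tgt h = z ∧ Ok G a b h then 1 else 0
  le : s.reg 25 ≤ G.n
  best : s.reg 25 = G.n ∨
    ∃ h ∈ done, Ok G a b h ∧ G.tgt h = s.reg 25 ∧ G.count a b pre (G.tgt h) + 1 = k
  min : ∀ h ∈ done, Ok G a b h → G.count a b pre (G.tgt h) + 1 = k → s.reg 25 ≤ G.tgt h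

open Classical in
theorem wp_greedyBody (hB : Big G σ m w) {a b k y h : ℕ} {pre done post : List ℕ}
    (hL : G.adjL y = done ++ h :: post) (hh : Half G m w y h s) (ha : s.reg 21 = a)
    (hb : s.reg 22 = b) (haw : a < w) (hbw : b < w) (hk : s.reg 20 = k) (hkw : k < w)
    (hpre : pre.length ≤ G.n) (hI : ScanInv G a b k pre done s) :
    WP m w greedyBody s fun t s' => t ≤ 45 ∧ ScanInv G a b k pre (done ++ [h]) s' := by
  have hm := hB.m_ge
  have hw := hB.w_ge
  have hw1 : 1 < w := by omega
  -- The half-edges seen before in this scan have other ends, so this cell still holds the count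
  -- over `pre`.
  have hcnt : s.arr 11 (G.tgt h) = G.count a b pre (G.tgt h) := by
    rw [hI.cnt]
    simp only [Nat.add_eq_left, ite_eq_right_iff, one_ne_zero, imp_false, not_exists, not_and]
    intro g hg ht
    exact absurd ht (tgt_notMem hL g hg)
  have hle := G.count_le a b pre (G.tgt h)
  have hc1 : G.count a b pre (G.tgt h) < w := by omega
  have hc2 : G.count a b pre (G.tgt h) + 1 < w := by omega
  have hr25 : s.reg 25 < w := by have := hI.le; omega
  have := hh.tn
  unfold greedyBody
  by_cases hok : Ok G a b h
  · have hnew : Function.update (s.arr 11) (G.tgt h) (G.count a b pre (G.tgt h) + 1) =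
        fun z => G.count a b pre z +
          if ∃ g ∈ done ++ [h], G.tgt g = z ∧ Ok G a b g then 1 else 0 := by
      ext z
      by_cases hz : z = G.tgt h
      · subst hz
        rw [Function.update_self, if_pos ⟨h, by simp, rfl, hok⟩]
      · rw [Function.update_of_ne hz, hI.cnt]
        have hiff : (∃ g ∈ done ++ [h], G.tgt g = z ∧ Ok G a b g) ↔
            ∃ g ∈ done, G.tgt g = z ∧ Ok G a b g := by
          simp only [List.mem_append, List.mem_singleton, or_and_right, exists_or, exists_eq_left]
          refine or_iff_left ?_
          rintro ⟨h1, -⟩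
          exact hz h1.symm
        simp only [hiff]
    obtain ⟨hok1, hok2⟩ := hok
    simp only [wp_seq, wp_ite, wp_assign, wp_skip, wp_write, Expr.Fits, Expr.eval, Expr.cost,
      hh.r6, hh.a6, hh.a7, hh.a2, hh.a3, hh.hm, hh.hw, hh.em, hh.ew, hh.tm, hh.tw, hh.sw, hh.nw,
      ha, hb, hk, State.setCell_reg, State.setCell_arr, hcnt, haw, hbw, hw1, hkw, hr25, hc1, hc2,
      not_lt.2 hok1, not_lt.2 hok2]
    simp [hh.a6, hh.tm, hh.tw, hc2]
    by_cases hck : G.count a b pre (G.tgt h) + 1 = k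
    · refine ⟨fun _ => ⟨fun hlt => ⟨hnew, ?_, ?_, ?_⟩, fun hge => ⟨hnew, hI.le, ?_, ?_⟩⟩,
        fun hne => absurd hck hne⟩
      · simp only [State.setReg_reg, if_true]
        omega
      · exact Or.inr ⟨h, by simp, ⟨hok1, hok2⟩, by simp, hck⟩
      · intro g hg hgok hgc
        simp only [State.setReg_reg, if_true]
        rcases List.mem_append.1 hg with hg | hg
        · have := hI.min g hg hgok hgc
          omega
        · rw [List.mem_singleton.1 hg]
      · rcases hI.best with hbest | ⟨g, hg, h2⟩
        · exact Or.inl hbest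
        · exact Or.inr ⟨g, by simp [hg], h2⟩
      · intro g hg hgok hgc
        rcases List.mem_append.1 hg with hg | hg
        · exact hI.min g hg hgok hgc
        · rw [List.mem_singleton.1 hg]
          exact hge
    · refine ⟨fun he => absurd he hck, fun _ => ⟨hnew, hI.le, ?_, ?_⟩⟩
      · rcases hI.best with hbest | ⟨g, hg, h2⟩
        · exact Or.inl hbest
        · exact Or.inr ⟨g, by simp [hg], h2⟩
      · intro g hg hgok hgc
        rcases List.mem_append.1 hg with hg | hg
        · exact hI.min g hg hgok hgc
        · rw [List.mem_singleton.1 hg] at hgc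
          exact absurd hgc hck
  · have hI' : ScanInv G a b k pre (done ++ [h]) s := by
      have hiff : ∀ P : ℕ → Prop, (∃ g ∈ done ++ [h], P g ∧ Ok G a b g) ↔
          ∃ g ∈ done, P g ∧ Ok G a b g := by
        intro P
        constructor
        · rintro ⟨g, hg, h1, h2⟩
          rcases List.mem_append.1 hg with hg | hg
          · exact ⟨g, hg, h1, h2⟩
          · rw [List.mem_singleton.1 hg] at h2
            exact absurd h2 hok
        · rintro ⟨g, hg, h1⟩
          exact ⟨g, by simp [hg], h1⟩
      refine ⟨?_, hI.le, ?_, ?_⟩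
      · rw [hI.cnt]
        ext z
        congr 1
        exact if_congr (hiff fun g => G.tgt g = z).symm rfl rfl
      · rcases hI.best with hbest | ⟨g, hg, h2⟩
        · exact Or.inl hbest
        · exact Or.inr ⟨g, by simp [hg], h2⟩
      · intro g hg hgok
        rcases List.mem_append.1 hg with hg | hg
        · exact hI.min g hg hgok
        · rw [List.mem_singleton.1 hg] at hgok
          exact absurd hgok hok
    simp only [wp_seq, wp_ite, wp_assign, wp_skip, wp_write, Expr.Fits, Expr.eval, Expr.cost,
      hh.r6, hh.a6, hh.a7, hh.a2, hh.a3, hh.hm, hh.hw, hh.em, hh.ew, hh.tm, hh.tw, hh.sw, hh.nw,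
      ha, hb, haw, hbw, hw1]
    have hok' : ¬ (G.st (eid h) ≤ a ∧ b ≤ G.en (eid h)) := hok
    by_cases h1 : a < G.st (eid h)
    · simp [h1, hI']
    · have h2 : G.en (eid h) < b := by omega
      simp [h1, h2, hI']

open Classical in
theorem wp_scan (hB : Big G σ m w) (hE : Env G σ s) {a b k y : ℕ} {pre : List ℕ}
    (hy : s.reg 24 = y) (hyn : y < G.n) (ha : s.reg 21 = a)
    (hb : s.reg 22 = b) (haw : a < w) (hbw : b < w) (hk : s.reg 20 = k) (hkw : k < w)
    (hpre : pre.length ≤ G.n) (h25 : s.reg 25 = G.n) (h11 : s.arr 11 = G.count a b pre) :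
    WP m w (forAdj (.reg 24) greedyBody) s fun t s' => t ≤ 50 * (G.deg y + 1) ∧
      s'.arr 11 = G.count a b (pre ++ [y]) ∧ s'.reg 25 ≤ G.n ∧
      (s'.reg 25 = G.n ∨ (G.Adj a b y (s'.reg 25) ∧ G.count a b (pre ++ [y]) (s'.reg 25) = k)) ∧
      ∀ z, G.Adj a b y z → G.count a b (pre ++ [y]) z = k → s'.reg 25 ≤ z := by
  refine (wp_adj hB hE hy hyn (fun done s' => ScanInv G a b k pre done s') 45 rfl rfl
    ?_ ?_ ?_).mono ?_
  · exact ⟨by simp [h11], h25.le, Or.inl h25, by simp⟩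
  · intro pre s' x hI
    exact ⟨hI.cnt, by simpa using hI.le, by simpa using hI.best, by simpa using hI.min⟩
  · intro done h post hL s' hag hE' hh hI
    exact wp_greedyBody hB hL hh ((hag.reg 21 rfl).trans ha) ((hag.reg 22 rfl).trans hb) haw hbw
      ((hag.reg 20 rfl).trans hk) hkw hpre hI
  · rintro t s' - ⟨ht, hI⟩
    have hadj : ∀ z, (∃ h ∈ G.adjL y, G.tgt h = z ∧ Ok G a b h) ↔ G.Adj a b y z :=
      fun z => adj_iff_half.symm
    refine ⟨ht, ?_, hI.le, ?_, ?_⟩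
    · rw [hI.cnt]
      ext z
      rw [count_append]
      congr 1
      exact if_congr (hadj z) rfl rfl
    · rcases hI.best with h | ⟨h, hh, hok, ht, hc⟩
      · exact Or.inl h
      · right
        have := (hadj _).1 ⟨h, hh, ht, hok⟩
        refine ⟨this, ?_⟩
        rw [count_append, if_pos this, ← ht]
        exact hc
    · intro z hz hc
      obtain ⟨h, hh, rfl, hok⟩ := (hadj z).2 hz
      rw [count_append, if_pos hz] at hc
      exact hI.min h hh hok hc

/-- The state of the greedy completion of `l₀` to `C` after `i` vertices were scanned. -/
structure GreedyInv (G : IGraph) (a b : ℕ) (l₀ : List ℕ) (C : Finset ℕ) (i t : ℕ) (s : State) :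
    Prop where
  r21 : s.reg 21 = a
  r22 : s.reg 22 = b
  r23 : s.reg 23 = i
  ext : ∃ ext, lst (s.arr 10) (s.reg 20) = l₀ ++ ext ∧ (∀ z ∈ ext, s.reg 26 ≤ z) ∧
    (s.reg 26 = G.n ∨ s.reg 26 ∈ ext)
  nodup : (lst (s.arr 10) (s.reg 20)).Nodup
  sub : ∀ x ∈ lst (s.arr 10) (s.reg 20), x ∈ C
  cl : G.IsCl a b (lst (s.arr 10) (s.reg 20)).toFinset C
  le : i ≤ s.reg 20
  full : i < s.reg 20 ∨ (lst (s.arr 10) (s.reg 20)).toFinset = C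
  cnt : s.arr 11 = G.count a b (lst (s.arr 10) i)
  time : t ≤ 100 * ((lst (s.arr 10) i).map fun y => G.deg y + 1).sum

theorem wp_greedyStep (hB : Big G σ m w) (hE : Env G σ s) {a b i t : ℕ} {l₀ : List ℕ}
    {C : Finset ℕ} (hC : ∀ z ∈ C, z < G.n) (haw : a < w) (hbw : b < w)
    (hI : GreedyInv G a b l₀ C i t s) (hi : i < s.reg 20) :
    WP m w greedyStep s fun t' s' => GreedyInv G a b l₀ C (i + 1) (t + (4 + t')) s' := by
  have hm := hB.m_ge
  have hw := hB.w_ge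
  set k := s.reg 20 with hk
  set l := lst (s.arr 10) k with hl
  have hlen : k ≤ G.n := by
    have := length_le hI.nodup fun u hu => hC u (hI.sub u hu)
    rwa [lst_length] at this
  set y := s.arr 10 i with hy
  have hyl : y ∈ l := mem_lst.2 ⟨i, hi, rfl⟩
  have hyn : y < G.n := hC y (hI.sub y hyl)
  unfold greedyStep
  rw [wp_seq, wp_assign]
  refine ⟨by simp only [Expr.Fits, Expr.eval, hI.r23]; omega, ?_⟩
  rw [wp_seq, wp_assign]
  refine ⟨by simp [Expr.Fits, Expr.eval, hI.r23]; omega, ?_⟩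
  rw [wp_seq, wp_assign]
  refine ⟨by simp [Expr.Fits, hE.r0]; omega, ?_⟩
  simp only [Expr.eval, hI.r23, State.setReg_reg]
  rw [wp_seq]
  refine (wp_scan hB (((hE.setReg 24 _ (by omega)).setReg 23 _ (by omega)).setReg 25 _ (by omega))
    (a := a) (b := b) (k := k) (y := y) (pre := lst (s.arr 10) i) (by simp [hy]) hyn
    (by simp [hI.r21]) (by simp [hI.r22]) haw hbw (by simp [hk]) (by omega) (by simp; omega)
    (by simp [hE.r0]) (by simpa using hI.cnt)).mono ?_
  rintro t' s' hag ⟨ht', h11, h25n, h25, hmin⟩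
  have h10 : s'.arr 10 = s.arr 10 := hag.arr 10 rfl
  have h20 : s'.reg 20 = k := (hag.reg 20 rfl).trans (by simp [hk])
  have h21 : s'.reg 21 = a := (hag.reg 21 rfl).trans (by simp [hI.r21])
  have h22 : s'.reg 22 = b := (hag.reg 22 rfl).trans (by simp [hI.r22])
  have h23 : s'.reg 23 = i + 1 := (hag.reg 23 rfl).trans (by simp)
  have h26 : s'.reg 26 = s.reg 26 := (hag.reg 26 rfl).trans (by simp)
  have h0 : s'.reg 0 = G.n := (hag.reg 0 rfl).trans (by simp [hE.r0])
  rw [← show lst (s.arr 10) (i + 1) = lst (s.arr 10) i ++ [y] from lst_succ _ _] at h11 h25 hmin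
  obtain ⟨ext, hext, hlow, hmem⟩ := hI.ext
  rw [← hk, ← hl] at hext
  have hle26 : s.reg 26 ≤ G.n := by
    rcases hmem with h | h
    · exact h.le
    · refine (hC _ (hI.sub _ ?_)).le
      rw [← hk, ← hl, hext]
      simp [h]
  -- A count is at most the number `i + 1` of scanned members, so the value `k` forces that all
  -- members have been scanned and that all are neighbours of `z`.
  have hcle : ∀ z, G.count a b (lst (s.arr 10) (i + 1)) z = k →
      i + 1 = k ∧ ∀ x ∈ l, G.Adj a b x z := by
    intro z hz
    have := G.count_le a b (lst (s.arr 10) (i + 1)) z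
    rw [lst_length] at this
    have hik : i + 1 = k := by omega
    refine ⟨hik, ?_⟩
    rw [hl, ← hik, ← count_eq_length, lst_length, hz, hik]
  rw [wp_ite]
  refine ⟨by simp only [Expr.Fits]; omega, fun hlt => ?_, fun hge => ?_⟩
  · simp only [Expr.eval, h0, ne_eq, ite_eq_right_iff, one_ne_zero, imp_false, not_not] at hlt
    set v := s'.reg 25 with hv
    obtain ⟨hadj, hcv⟩ := h25.resolve_left (by omega)
    obtain ⟨hik, hall⟩ := hcle v hcv
    have hleast : ∀ z, (∀ x ∈ l.toFinset, G.Adj a b x z) → v ≤ z := by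
      intro z hz
      refine hmin z (hz y (by simpa using hyl)) ?_
      have : G.count a b (lst (s.arr 10) (i + 1)) z = (lst (s.arr 10) (i + 1)).length := by
        rw [count_eq_length, hik]
        intro x hx
        exact hz x (by simpa using hx)
      rw [this, lst_length, hik]
    -- The vertex found is the least common neighbour of the list, so it belongs to the completion
    -- `C`. By the sandwich lemma `C` is still the completion after it is appended.
    have hvC : v ∈ C := hI.cl.least_mem (fun x hx => hall x (by simpa using hx)) hleast
    have hvl : v ∉ l := fun hvl => (hall v hvl).ne rfl
    have hk1 : k + 1 ≤ G.n := by
      have := length_le (G := G) (l := l ++ [v]) (by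
        rw [List.nodup_append]
        refine ⟨hI.nodup, by simp, ?_⟩
        intro x hx z hz
        rw [List.mem_singleton.1 hz]
        rintro rfl
        exact hvl hx) (by
        intro u hu
        rcases List.mem_append.1 hu with hu | hu
        · exact hC u (hI.sub u hu)
        · rw [List.mem_singleton.1 hu]
          exact hlt)
      simpa [hl] using this
    have hnew : lst (Function.update (s.arr 10) k v) (k + 1) = l ++ [v] := lst_update _ _ _
    have hold : lst (Function.update (s.arr 10) k v) (i + 1) = lst (s.arr 10) (i + 1) :=
      lst_congr fun j hj => Function.update_of_ne (by omega) _ _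
    have hres : ∀ s'' : State, s''.arr = (s'.setCell 10 k v).arr → s''.reg 20 = k + 1 →
        s''.reg 21 = a → s''.reg 22 = b → s''.reg 23 = i + 1 →
        s''.reg 26 = min v (s.reg 26) → ∀ t'', t'' ≤ 100 * (G.deg y + 1) + t →
        GreedyInv G a b l₀ C (i + 1) t'' s'' := by
      intro s'' ha h20' h21' h22' h23' h26' t'' ht''
      have h10' : s''.arr 10 = Function.update (s.arr 10) k v := by rw [ha]; simp [h10]
      have h11' : s''.arr 11 = s'.arr 11 := by rw [ha]; simp
      have hl' : lst (s''.arr 10) (s''.reg 20) = l ++ [v] := by rw [h10', h20', hnew]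
      refine ⟨h21', h22', h23', ⟨ext ++ [v], ?_, ?_, ?_⟩, ?_, ?_, ?_, by omega, by omega, ?_, ?_⟩
      · rw [hl', hext, List.append_assoc]
      · intro z hz
        rcases List.mem_append.1 hz with hz | hz
        · have := hlow z hz
          omega
        · rw [List.mem_singleton.1 hz]
          omega
      · rw [h26']
        right
        rcases min_choice v (s.reg 26) with h | h
        · simp [h]
        · rw [h]
          rcases hmem with h' | h'
          · exfalso
            omega
          · simp [h']
      · rw [hl', List.nodup_append]
        refine ⟨hI.nodup, by simp, ?_⟩
        intro x hx z hz
        rw [List.mem_singleton.1 hz]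
        rintro rfl
        exact hvl hx
      · rw [hl']
        intro x hx
        rcases List.mem_append.1 hx with hx | hx
        · exact hI.sub x hx
        · rw [List.mem_singleton.1 hx]
          exact hvC
      · rw [hl']
        refine hI.cl.sandwich ?_ ?_
        · intro x hx
          simp only [List.toFinset_append, Finset.mem_union]
          exact Or.inl hx
        · intro x hx
          simp only [List.toFinset_append, Finset.mem_union, List.mem_toFinset,
            List.mem_singleton] at hx
          rcases hx with hx | hx
          · exact hI.sub x hx
          · rw [hx]
            exact hvC
      · rw [h11', h11, h10', hold]
      · rw [h10', hold, lst_succ]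
        have := hI.time
        simp only [List.map_append, List.sum_append, List.map_cons, List.map_nil, List.sum_cons,
          List.sum_nil, ← hy]
        omega
    simp only [wp_seq, wp_ite, wp_assign, wp_skip, wp_write, Expr.Fits, Expr.eval, Expr.cost,
      State.setCell_reg, h20, ← hv]
    refine ⟨by omega, by omega, by omega, by omega, by simp [← hv, h26]; omega, ?_, ?_⟩
    · intro hc
      simp [h26, ← hv] at hc
      refine ⟨by simp [← hv]; omega, ?_⟩
      refine hres _ (by rfl) (by simp) (by simp [h21]) (by simp [h22]) (by simp [h23]) ?_ _ ?_
      · simp [← hv]; omega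
      · omega
    · intro hc
      simp [h26, ← hv] at hc
      refine hres _ (by rfl) (by simp) (by simp [h21]) (by simp [h22]) (by simp [h23]) ?_ _ ?_
      · simp [h26]; omega
      · omega
  · simp only [Expr.eval, h0, ite_eq_right_iff, one_ne_zero, imp_false, not_lt] at hge
    rw [wp_skip]
    refine ⟨h21, h22, h23, ⟨ext, ?_, by rwa [h26], by rwa [h26]⟩, by rw [h10, h20]; exact hI.nodup,
      by rw [h10, h20]; exact hI.sub, by rw [h10, h20]; exact hI.cl, by omega, ?_, by rw [h11, h10],
      ?_⟩
    · rw [h10, h20, ← hl, hext]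
    · rw [h10, h20]
      rcases Nat.lt_or_ge (i + 1) k with h | h
      · exact Or.inl h
      · right
        -- The last member was scanned and no candidate turned up. The list has no common neighbour
        -- and so equals its completion.
        have hik : i + 1 = k := by omega
        refine (hI.cl.eq_of_no_common fun z hz => ?_).symm
        have hzy := hz y (by simpa using hyl)
        have hzn := hzy.symm.lt
        have : G.count a b (lst (s.arr 10) (i + 1)) z = (lst (s.arr 10) (i + 1)).length := by
          rw [count_eq_length, hik]
          intro x hx
          exact hz x (by simpa using hx)
        rw [lst_length, hik] at this
        have := hmin z hzy (by rw [hik]; exact this)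
        omega
    · rw [h10, lst_succ]
      have := hI.time
      simp only [List.map_append, List.sum_append, List.map_cons, List.map_nil, List.sum_cons,
        List.sum_nil, ← hy, Expr.cost]
      omega

theorem wp_greedy (hB : Big G σ m w) (hE : Env G σ s) {a b : ℕ} {l : List ℕ}
    {C : Finset ℕ} (hl : lst (s.arr 10) (s.reg 20) = l) (hne : l ≠ []) (hnd : l.Nodup)
    (hC : ∀ z ∈ C, z < G.n) (haw : a < w) (hbw : b < w) (ha : s.reg 21 = a) (hb : s.reg 22 = b)
    (hcl : G.IsCl a b l.toFinset C) (h11 : s.arr 11 = fun _ => 0) :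
    WP m w greedy s fun t s' => ∃ ext, lst (s'.arr 10) (s'.reg 20) = l ++ ext ∧
      (∀ z ∈ ext, s'.reg 26 ≤ z) ∧ (s'.reg 26 = G.n ∨ s'.reg 26 ∈ ext) ∧ (l ++ ext).Nodup ∧
      (l ++ ext).toFinset = C ∧ s'.arr 11 = G.count a b (l ++ ext) ∧
      t ≤ 100 * ((l ++ ext).map fun y => G.deg y + 1).sum + 10 := by
  have hm := hB.m_ge
  have hw := hB.w_ge
  have hpos : 0 < s.reg 20 := by
    have := List.length_pos_iff.2 hne
    rwa [← hl, lst_length] at this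
  have hsub : ∀ x ∈ l, x ∈ C := fun x hx => hcl.1 (by simpa using hx)
  unfold greedy
  rw [wp_seq, wp_assign]
  refine ⟨by simp only [Expr.Fits]; omega, ?_⟩
  rw [wp_seq, wp_assign]
  refine ⟨by simp [Expr.Fits, hE.r0]; omega, ?_⟩
  simp only [Expr.eval, State.setReg_reg]
  have hE' : Env G σ ((s.setReg 23 0).setReg 26 (if 0 = 23 then 0 else s.reg 0)) :=
    (hE.setReg 23 _ (by omega)).setReg 26 _ (by omega)
  have hloop : ∀ i t s', GreedyInv G a b l C i t s' → s'.reg 20 ≤ C.card := by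
    intro i t s' hI
    rw [← lst_length (s'.arr 10) (s'.reg 20), ← List.toFinset_card_of_nodup hI.nodup]
    exact Finset.card_le_card fun x hx => hI.sub x (by simpa using hx)
  have hCn : C.card ≤ G.n := by
    rw [← Finset.card_range G.n]
    exact Finset.card_le_card fun x hx => by simpa using hC x hx
  -- Although the list grows during the loop, the number of iterations is known in advance: each
  -- member of `C` is scanned once, and the scan ends only when the list is all of `C`.
  refine (wp_while (N := C.card) (GreedyInv G a b l C) ?_ ?_ ?_).mono ?_
  · refine ⟨by simp [ha], by simp [hb], by simp, ⟨[], by simp [hl], by simp, ?_⟩, ?_, ?_, ?_,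
      by omega, Or.inl ?_, ?_, by omega⟩
    · left; simp [hE.r0]
    · simpa [hl] using hnd
    · simpa [hl] using hsub
    · simpa [hl] using hcl
    · simpa using hpos
    · simp [h11, lst, count_nil]
  · intro i hi t s' hI hag
    have hi' : i < s'.reg 20 := by
      rcases hI.full with h | h
      · exact h
      · have := List.toFinset_card_of_nodup hI.nodup
        rw [h, lst_length] at this
        omega
    have := hloop i t s' hI
    refine ⟨?_, ?_, ?_⟩
    · simp only [Expr.Fits, hI.r23]; omega
    · simp [Expr.eval, hI.r23, hi']
    · refine (wp_greedyStep hB (hE'.agree hag rfl) hC haw hbw hI hi').mono ?_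
      intro t' s'' _ h
      exact h
  · intro t s' hI hag
    have := hloop _ t s' hI
    have := hI.le
    simp only [Expr.Fits, Expr.eval, hI.r23]
    simp
    omega
  · rintro t s' - ⟨t₀, rfl, hI⟩
    have h1 := hloop _ _ _ hI
    have h2 := hI.le
    have h3 : s'.reg 20 = C.card := by omega
    have hfull := hI.full.resolve_left (by omega)
    obtain ⟨ext, hext, hlow, hmem⟩ := hI.ext
    have hcnt := hI.cnt
    have htime := hI.time
    have hnd' := hI.nodup
    rw [← h3, hext] at hcnt htime
    rw [hext] at hfull hnd'
    refine ⟨ext, hext, hlow, hmem, hnd', hfull, hcnt, ?_⟩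
    simp only [Expr.cost]
    omega

end

end RAM

/-! ### Cleaning the work space, and the complete closure operation. -/

namespace RAM

open IGraph

section

variable {G : IGraph} {σ m w : ℕ} {s : State}

/-- Only members are marked in array `12`, and only neighbours of members have nonzero counts in
array `11`. One pass over the adjacency lists of the members therefore clears both. -/
theorem wp_cleanup (hB : Big G σ m w) (hE : Env G σ s) {l : List ℕ}
    (hl : lst (s.arr 10) (s.reg 20) = l) (hln : ∀ y ∈ l, y < G.n) (hnd : l.Nodup)
    (h12 : ∀ z, s.arr 12 z ≠ 0 → z ∈ l)
    (h11 : ∀ z, s.arr 11 z ≠ 0 → ∃ y ∈ l, ∃ h ∈ G.adjL y, G.tgt h = z) :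
    WP m w cleanup s fun t s' => t ≤ 40 * (l.map fun y => G.deg y + 1).sum + 6 ∧
      s'.arr 11 = (fun _ => 0) ∧ s'.arr 12 = fun _ => 0 := by
  have hm := hB.m_ge
  have hw := hB.w_ge
  have hlen : s.reg 20 ≤ G.n := by
    have := length_le hnd hln
    rwa [← hl, lst_length] at this
  refine (wp_list hB hE hl hln hlen
    (fun pre s' => (∀ z, s'.arr 12 z ≠ 0 → z ∈ l ∧ z ∉ pre) ∧
      ∀ z, s'.arr 11 z ≠ 0 → (∃ y ∈ l, ∃ h ∈ G.adjL y, G.tgt h = z) ∧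
        ∀ y ∈ pre, ∀ h ∈ G.adjL y, G.tgt h ≠ z) 25
    (by decide) (by decide) rfl rfl rfl rfl ?_ ?_ ?_).mono ?_
  · exact ⟨fun z hz => ⟨h12 z hz, by simp⟩, fun z hz => ⟨h11 z hz, by simp⟩⟩
  · intro pre s' x hI
    exact ⟨hI, hI⟩
  · rintro pre y post hsplit s' hag hEs hy hyn ⟨hI12, hI11⟩
    rw [wp_seq, wp_write]
    refine ⟨by simp only [Expr.Fits]; omega, by simp only [Expr.eval]; omega,
      by simp only [Expr.Fits]; omega, ?_⟩
    simp only [Expr.eval, hy]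
    set s₁ := s'.setCell 12 y 0 with hs₁
    have hE₁ : Env G σ s₁ := by
      refine hEs.agree (p := .write 12 (.reg 24) (.const 0)) ⟨fun _ _ => rfl, fun a ha => ?_,
        fun _ => rfl, fun _ => rfl⟩ rfl
      simp only [Prog.writesArr, beq_eq_false_iff_ne] at ha
      simp [hs₁, ha]
    refine (wp_adj hB hE₁ (v := y) (by simp [hs₁, hy]) hyn (fun done s'' =>
      (∀ z, s''.arr 11 z ≠ 0 → ((∃ y ∈ l, ∃ h ∈ G.adjL y, G.tgt h = z) ∧
        ∀ y ∈ pre, ∀ h ∈ G.adjL y, G.tgt h ≠ z) ∧ ∀ h ∈ done, G.tgt h ≠ z)) 5 rfl rfl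
      ?_ ?_ ?_).mono ?_
    · intro z hz
      exact ⟨hI11 z (by simpa [hs₁] using hz), by simp⟩
    · intro done s'' x hI
      exact hI
    · intro done h post' hL s'' hag' hEs' hh hI
      simp only [wp_write, Expr.Fits, Expr.eval, Expr.cost, hh.r6, hh.a6, hh.hw, hh.hm, hh.tm,
        hh.tw, State.setCell_arr, true_and]
      refine ⟨by omega, by omega, ?_⟩
      intro z hz
      rw [if_pos trivial] at hz
      by_cases hzh : z = G.tgt h
      · rw [hzh, Function.update_self] at hz
        exact absurd rfl hz
      · rw [Function.update_of_ne hzh] at hz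
        refine ⟨(hI z hz).1, fun g hg => ?_⟩
        rcases List.mem_append.1 hg with hg | hg
        · exact (hI z hz).2 g hg
        · rw [List.mem_singleton.1 hg]
          exact fun h => hzh h.symm
    · rintro t s'' hag' ⟨ht, hI⟩
      have h12' : s''.arr 12 = Function.update (s'.arr 12) y 0 := by
        rw [hag'.arr 12 rfl]
        simp [hs₁]
      refine ⟨by simp only [Expr.cost]; omega, fun z hz => ?_, fun z hz => ?_⟩
      · rw [h12'] at hz
        by_cases hzy : z = y
        · rw [hzy, Function.update_self] at hz
          exact absurd rfl hz
        · rw [Function.update_of_ne hzy] at hz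
          simp [hI12 z hz, hzy]
      · refine ⟨(hI z hz).1.1, fun x hx => ?_⟩
        rcases List.mem_append.1 hx with hx | hx
        · exact (hI z hz).1.2 x hx
        · rw [List.mem_singleton.1 hx]
          exact (hI z hz).2
  · rintro t s' - ⟨ht, h12', h11'⟩
    refine ⟨by omega, funext fun z => ?_, funext fun z => ?_⟩
    · by_contra hz
      obtain ⟨⟨y, hy, h, hh, rfl⟩, h2⟩ := h11' z hz
      exact h2 y hy h hh rfl
    · by_contra hz
      exact (h12' z hz).2 (h12' z hz).1

/-- The result of the completion of the list `l`. -/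
structure Completed (G : IGraph) (l : List ℕ) (a b : ℕ) (C : Finset ℕ) (s : State) : Prop where
  tau : G.IsTau l.toFinset a b
  cl : G.IsCl a b l.toFinset C
  r21 : s.reg 21 = a
  r22 : s.reg 22 = b
  pre : ∃ ext, lst (s.arr 10) (s.reg 20) = l ++ ext
  nodup : (lst (s.arr 10) (s.reg 20)).Nodup
  eq : (lst (s.arr 10) (s.reg 20)).toFinset = C
  low : ∀ j < G.n, j < s.reg 26 ↔ ∀ z ∈ C, z ∉ l.toFinset → j < z
  low_le : s.reg 26 ≤ G.n
  a11 : s.arr 11 = fun _ => 0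
  a12 : s.arr 12 = fun _ => 0

theorem Completed.card {l : List ℕ} {a b : ℕ} {C : Finset ℕ} (h : Completed G l a b C s) :
    s.reg 20 = C.card := by
  rw [← h.eq, List.toFinset_card_of_nodup h.nodup, lst_length]

theorem wp_closure (hB : Big G σ m w) {D : ℕ} (hD : G.DegBound D) (hE : Env G σ s) {l : List ℕ}
    (hl : lst (s.arr 10) (s.reg 20) = l) (hnd : l.Nodup)
    (hj : ∀ u ∈ l, ∀ v ∈ l, u ≠ v → ∃ e < G.E, G.Joins e u v) (h2 : ∃ u ∈ l, ∃ v ∈ l, u ≠ v)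
    (h11 : s.arr 11 = fun _ => 0) (h12 : s.arr 12 = fun _ => 0) :
    WP m w closure s fun t s' => t ≤ 300 * D ∧ ∃ a b C, Completed G l a b C s' := by
  have hm := hB.m_ge
  have hw := hB.w_ge
  obtain ⟨a₀, b₀, ht₀⟩ := IsTau.exists_of_clique (G := G) (U := l.toFinset)
    (by simpa using hj) (by simpa using h2)
  have hln : ∀ y ∈ l, y < G.n := fun y hy => ht₀.lt (by simpa using hy)
  unfold closure
  rw [wp_seq]
  refine (wp_tauLoop hB hE hl hln hnd h12).mono ?_
  rintro t s₁ hag ⟨ht, hb, h12₁⟩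
  have htau := hb.isTau hj h2
  set a := s₁.reg 21 with ha
  set b := s₁.reg 22 with hb
  have h10₁ : lst (s₁.arr 10) (s₁.reg 20) = l := by
    rw [hag.arr 10 rfl, hag.reg 20 rfl, hl]
  have hE₁ : Env G σ s₁ := hE.agree hag rfl
  obtain ⟨C, hC⟩ := IsCl.exists_completion (G := G) (a := a) (b := b) htau.nonempty
  have htC := hC.tau htau
  have hlea := htau.left_le
  have hleb := htau.right_le
  have hne : l ≠ [] := by
    rintro rfl
    simp at h2
  rw [wp_seq]
  refine (wp_greedy hB hE₁ h10₁ hne hnd (fun z hz => htC.lt hz) (by omega) (by omega) rfl rfl hC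
    ((hag.arr 11 rfl).trans h11)).mono ?_
  rintro t₂ s₂ hag₂ ⟨ext, hext, hlow, hmem, hnd₂, hfin, hcnt, ht₂⟩
  have hE₂ : Env G σ s₂ := hE₁.agree hag₂ rfl
  have hmemC : ∀ x, x ∈ l ++ ext ↔ x ∈ C := fun x => by rw [← hfin, List.mem_toFinset]
  -- The completed list is a clique, so `D` bounds its degree sum and with it the cost of all three
  -- passes.
  have hsum : ((l ++ ext).map fun y => G.deg y + 1).sum ≤ D := by
    refine hD.list hnd₂ (fun u hu => htC.lt ((hmemC u).1 hu)) fun u hu v hv huv => ?_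
    obtain ⟨e, he, hje, -⟩ := htC.1 u ((hmemC u).1 hu) v ((hmemC v).1 hv) huv
    exact ⟨e, he, hje⟩
  have hsum' : 1 ≤ (l.map fun y => G.deg y + 1).sum ∧
      (l.map fun y => G.deg y + 1).sum ≤ ((l ++ ext).map fun y => G.deg y + 1).sum := by
    rw [List.map_append, List.sum_append]
    refine ⟨?_, by omega⟩
    obtain ⟨x, l', rfl⟩ := List.exists_cons_of_ne_nil hne
    simp only [List.map_cons, List.sum_cons]
    omega
  have h12₂ : s₂.arr 12 = fun z => if z ∈ l then 1 else 0 := (hag₂.arr 12 rfl).trans h12₁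
  refine (wp_cleanup hB hE₂ hext (fun y hy => htC.lt ((hmemC y).1 hy)) hnd₂ ?_ ?_).mono ?_
  · intro z hz
    rw [h12₂] at hz
    simp only [ne_eq, ite_eq_right_iff, one_ne_zero, imp_false, not_not] at hz
    simp [hz]
  · intro z hz
    rw [hcnt] at hz
    obtain ⟨x, hx, hadj⟩ := exists_of_count hz
    obtain ⟨h, hh, ht, -⟩ := adj_iff_half.1 hadj
    exact ⟨x, hx, h, hh, ht⟩
  · rintro t₃ s₃ hag₃ ⟨ht₃, h11₃, h12₃⟩
    have h10₃ : lst (s₃.arr 10) (s₃.reg 20) = l ++ ext := by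
      rw [hag₃.arr 10 rfl, hag₃.reg 20 rfl, hext]
    have h26₃ : s₃.reg 26 = s₂.reg 26 := hag₃.reg 26 rfl
    refine ⟨by omega, a, b, C, htau, hC, ?_, ?_, ⟨ext, h10₃⟩, by rwa [h10₃], by rwa [h10₃], ?_, ?_,
      h11₃, h12₃⟩
    · rw [hag₃.reg 21 rfl, hag₂.reg 21 rfl]
    · rw [hag₃.reg 22 rfl, hag₂.reg 22 rfl]
    -- The value `n` in register `26` means that nothing was added. For `j < n` the comparison with
    -- it succeeds, in agreement with the vacuous condition.
    · intro j hjn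
      rw [h26₃]
      have hdis := (List.nodup_append.1 hnd₂).2.2
      constructor
      · intro hlt z hz hzl
        have hz' := (hmemC z).2 hz
        rw [List.mem_toFinset] at hzl
        have := hlow z ((List.mem_append.1 hz').resolve_left hzl)
        omega
      · intro hall
        rcases hmem with h | h
        · omega
        · refine hall _ ((hmemC _).1 (by simp [h])) ?_
          rw [List.mem_toFinset]
          exact fun hl => hdis _ hl _ h rfl
    · rw [h26₃]
      rcases hmem with h | h
      · exact h.le
      · exact (htC.lt ((hmemC _).1 (by simp [h]))).le

end

end RAM

/-! ## Scans around a clique -/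

namespace RAM

open IGraph

/-- `v` is the least member of `S` above `c`, or `top` if there is none below `top`. -/
structure Next (S : ℕ → Prop) (c top v : ℕ) : Prop where
  le : v ≤ top
  mem : v = top ∨ (S v ∧ c < v)
  min : ∀ x, S x → c < x → x < top → v ≤ x

theorem Next.empty (c top : ℕ) : Next (fun _ => False) c top top :=
  ⟨le_rfl, Or.inl rfl, fun _ h => h.elim⟩

theorem Next.insert {S : ℕ → Prop} {c top v y : ℕ} (h : Next S c top v) :
    Next (fun x => S x ∨ x = y) c top (if c < y ∧ y < v then y else v) := by
  obtain ⟨h1, h2, h3⟩ := h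
  split_ifs with hy
  · refine ⟨by omega, Or.inr ⟨Or.inr rfl, hy.1⟩, ?_⟩
    rintro x (hx | rfl) hc ht
    · have := h3 x hx hc ht
      omega
    · exact le_rfl
  · refine ⟨h1, h2.imp_right fun h => ⟨Or.inl h.1, h.2⟩, ?_⟩
    rintro x (hx | rfl) hc ht
    · exact h3 x hx hc ht
    · omega

theorem Next.congr {S S' : ℕ → Prop} {c top v : ℕ} (h : Next S c top v) (hS : ∀ x, S x ↔ S' x) :
    Next S' c top v := by
  obtain rfl : S = S' := funext fun x => propext (hS x)
  exact h

def valBody (c : ℕ) (val : Expr) : Prog :=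
  .ite (.read 9 eTo) (.ite (.lt eTo (.reg 14)) (.assign 29 val ;;
    .ite (.lt (.reg c) (.reg 29))
      (.ite (.lt (.reg 29) (.reg 25)) (.assign 25 (.reg 29)) .skip) .skip) .skip) .skip

/-- The least value above register `c` of `val` on the half-edges from the vertex in register `14`
to smaller members of the current clique. -/
def valScan (c : ℕ) (val : Expr) : Prog :=
  .assign 25 (.add (.reg 2) (.const 1)) ;; forAdj (.reg 14) (valBody c val)

/-- The start and the end of the edge of the current half-edge, cut to the current interval. -/
abbrev eMax : Expr := .add (.reg 11) (.sub eSt (.reg 11))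
abbrev eMin : Expr := .sub (.reg 12) (.sub (.reg 12) eEn)

def nbrBody : Prog :=
  .ite (.read 9 eTo) .skip (.ite (.lt (.reg 14) eTo)
    (.ite (.lt eTo (.reg 25)) (.assign 25 eTo) .skip) .skip)

/-- The least neighbour of the current clique above register `14` that is not a member. -/
def nbrScan : Prog :=
  .assign 25 (.reg 0) ;; forList 8 10 (forAdj (.reg 24) nbrBody)

def genBody : Prog :=
  .ite (.read 9 eTo) (.ite (.lt eTo (.reg 14)) (.ite (.lt (.reg 15) eSt) .skip
    (.ite (.lt eEn (.reg 16)) .skip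
      (.write 10 (.reg 20) eTo ;; .assign 20 (.add (.reg 20) (.const 1))))) .skip) .skip

/-- Collect the members of the current clique that are smaller than the vertex in register `14`
and adjacent to it during the interval in registers `15` and `16`. -/
def genList : Prog :=
  .assign 20 (.const 0) ;; forAdj (.reg 14) genBody

/-- Collect the members of the current clique before the vertex in register `13`. -/
def preList : Prog :=
  .assign 20 (.const 0) ;; forList 8 10 (.ite (.lt (.reg 24) (.reg 13))
    (.write 10 (.reg 20) (.reg 24) ;; .assign 20 (.add (.reg 20) (.const 1))) .skip)

/-- Test whether the list in array `10` consists of members of the current clique. -/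
def subTest : Prog :=
  .assign 27 (.const 1) ;; forList 10 20 (.ite (.read 9 (.reg 24)) .skip (.assign 27 (.const 0)))

def unmark : Prog := forList 8 10 (.write 9 (.reg 24) (.const 0))

/-- Make the list in array `10` the current clique. -/
def load : Prog :=
  unmark ;; .assign 10 (.const 0) ;; .assign 11 (.reg 21) ;; .assign 12 (.reg 22) ;;
    forList 10 20 (.write 8 (.reg 10) (.reg 24) ;; .assign 10 (.add (.reg 10) (.const 1)) ;;
      .write 9 (.reg 24) (.const 1))

def outBody : Prog :=
  .ite (.read 9 eTo) (.ite (.lt (.reg 24) eTo) (.emit (.read 7 (.reg 6))) .skip) .skip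

/-- Write the edges of the current clique. -/
def output : Prog := forList 8 10 (forAdj (.reg 24) outBody) ;; .flush

/-- The current clique is `U`. -/
structure Cur (G : IGraph) (U : Finset ℕ) (a b : ℕ) (s : State) : Prop where
  nodup : (lst (s.arr 8) (s.reg 10)).Nodup
  eq : (lst (s.arr 8) (s.reg 10)).toFinset = U
  r11 : s.reg 11 = a
  r12 : s.reg 12 = b
  mark : s.arr 9 = fun z => if z ∈ U then 1 else 0

section

variable {G : IGraph} {σ m w : ℕ} {s : State}

theorem Cur.agree {U : Finset ℕ} {a b : ℕ} {p : Prog} {s' : State} (h : Cur G U a b s)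
    (ha : Agree p s s') (hp : (p.writesReg 10 || p.writesReg 11 || p.writesReg 12 || p.writesArr 8
      || p.writesArr 9) = false) : Cur G U a b s' := by
  simp only [Bool.or_eq_false_iff] at hp
  obtain ⟨⟨⟨⟨h1, h2⟩, h3⟩, h4⟩, h5⟩ := hp
  constructor
  · rw [ha.reg 10 h1, ha.arr 8 h4]; exact h.nodup
  · rw [ha.reg 10 h1, ha.arr 8 h4]; exact h.eq
  · rw [ha.reg 11 h2, h.r11]
  · rw [ha.reg 12 h3, h.r12]
  · rw [ha.arr 9 h5, h.mark]

theorem Cur.mem {U : Finset ℕ} {a b : ℕ} (h : Cur G U a b s) (x : ℕ) :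
    x ∈ lst (s.arr 8) (s.reg 10) ↔ x ∈ U := by
  rw [← h.eq, List.mem_toFinset]

theorem Cur.card {U : Finset ℕ} {a b : ℕ} (h : Cur G U a b s) : s.reg 10 = U.card := by
  rw [← h.eq, List.toFinset_card_of_nodup h.nodup, lst_length]

theorem Cur.setReg {U : Finset ℕ} {a b x v : ℕ} (h : Cur G U a b s) (h10 : x ≠ 10) (h11 : x ≠ 11)
    (h12 : x ≠ 12) : Cur G U a b (s.setReg x v) := by
  refine h.agree (p := .assign x (.const v)) ⟨fun y hy => ?_, fun _ _ => rfl, fun _ => rfl,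
    fun _ => rfl⟩ (by simp [Prog.writesReg, Prog.writesArr, h10.symm, h11.symm, h12.symm])
  simp only [Prog.writesReg, beq_eq_false_iff_ne] at hy
  simp [hy]

theorem card_le {U : Finset ℕ} (hU : ∀ u ∈ U, u < G.n) : U.card ≤ G.n := by
  rw [← Finset.card_range G.n]
  exact Finset.card_le_card fun x hx => by simpa using hU x hx

/-- The top value `T + 1` lies above all time stamps and signals that no value is left. The value
scanned is a parameter because starts and ends are treated alike. -/
theorem wp_valScan (hB : Big G σ m w) (hE : Env G σ s) {U : Finset ℕ} {a b j c cv : ℕ}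
    {val : Expr} {f : ℕ → ℕ} (hC : Cur G U a b s) (hj : s.reg 14 = j) (hjn : j < G.n)
    (hc : s.reg c = cv) (hc6 : c ≠ 6) (hc25 : c ≠ 25) (hc29 : c ≠ 29) (hcw : cv < w)
    (hcost : val.cost ≤ 10)
    (hval : ∀ h s', Half G m w j h s' → s'.reg 11 = a → s'.reg 12 = b →
      val.Fits m w s' ∧ val.eval s' = f h ∧ f h < w) :
    WP m w (valScan c val) s fun t s' => t ≤ 60 * (G.deg j + 1) ∧
      Next (fun x => ∃ h ∈ G.adjL j, G.tgt h ∈ U ∧ G.tgt h < j ∧ f h = x) cv (G.T + 1)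
        (s'.reg 25) := by
  have hm := hB.m_ge
  have hw := hB.w_ge
  unfold valScan
  rw [wp_seq, wp_assign]
  refine ⟨by simp only [Expr.Fits, Expr.eval, hE.r2]; omega, ?_⟩
  simp only [Expr.eval, hE.r2]
  refine (wp_adj hB (hE.setReg 25 _ (by omega)) (v := j) (by simp [hj]) hjn (fun done s' =>
    Next (fun x => ∃ h ∈ done, G.tgt h ∈ U ∧ G.tgt h < j ∧ f h = x) cv (G.T + 1) (s'.reg 25))
    50 rfl rfl ?_ ?_ ?_).mono ?_
  · simpa using Next.empty cv (G.T + 1)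
  · intro pre s' x hI
    simpa using hI
  · intro done h post hL s' hag hE' hh hI
    have hC' : Cur G U a b s' := (hC.setReg (by omega) (by omega) (by omega)).agree hag rfl
    have h14 : s'.reg 14 = j := (hag.reg 14 rfl).trans (by simp [hj])
    have hcc : s'.reg c = cv := by
      rw [hag.reg c (by simp [forAdj, valBody, Prog.writesReg, hc6, hc25, hc29])]
      simp [hc, hc25]
    obtain ⟨hv1, hv2, hv3⟩ := hval h s' hh hC'.r11 hC'.r12
    have hmk : s'.arr 9 (G.tgt h) = if G.tgt h ∈ U then 1 else 0 := by rw [hC'.mark]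
    have hle := hI.le
    have hr25 : s'.reg 25 < w := by omega
    have hjw : j < w := by omega
    have hw1 : 1 < w := by omega
    have hw0 : 0 < w := by omega
    have hnew : ∀ v, (v = if cv < f h ∧ f h < s'.reg 25 then f h else s'.reg 25) →
        G.tgt h ∈ U → G.tgt h < j →
        Next (fun x => ∃ g ∈ done ++ [h], G.tgt g ∈ U ∧ G.tgt g < j ∧ f g = x) cv (G.T + 1) v := by
      rintro v rfl h1 h2
      refine hI.insert.congr fun x => ?_
      simp only [List.mem_append, List.mem_singleton, or_and_right, exists_or, exists_eq_left,
        h1, h2, true_and]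
      exact or_congr_right eq_comm
    have hold : ¬ (G.tgt h ∈ U ∧ G.tgt h < j) →
        Next (fun x => ∃ g ∈ done ++ [h], G.tgt g ∈ U ∧ G.tgt g < j ∧ f g = x) cv (G.T + 1)
          (s'.reg 25) := by
      intro h1
      refine hI.congr fun x => ?_
      simp only [List.mem_append, List.mem_singleton, or_and_right, exists_or, exists_eq_left]
      refine (or_iff_left ?_).symm
      rintro ⟨h2, h3, -⟩
      exact h1 ⟨h2, h3⟩
    generalize (fun x => ∃ g ∈ done ++ [h], G.tgt g ∈ U ∧ G.tgt g < j ∧ f g = x) = S at hnew hold ⊢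
    unfold valBody
    by_cases hU : G.tgt h ∈ U
    · rw [if_pos hU] at hmk
      by_cases hlt : G.tgt h < j
      · simp [wp_seq, wp_ite, wp_assign, wp_skip, Expr.Fits, Expr.eval, Expr.cost, hh.r6, hh.a6,
          hh.hm, hh.hw, hh.tm, hh.tw, h14, hmk, hlt, hv1, hv2, hv3, hcc, hjw, hcw, hw1, hr25, hc29]
        refine ⟨fun h1 => ⟨fun h2 => ⟨by omega, hnew _ (by simp [h1, h2]) hU hlt⟩,
          fun h2 => ⟨by omega, hnew _ (by simp [not_lt.2 h2]) hU hlt⟩⟩,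
          fun h1 => ⟨by omega, hnew _ (by simp [not_lt.2 h1]) hU hlt⟩⟩
      · simp [wp_seq, wp_ite, wp_assign, wp_skip, Expr.Fits, Expr.eval, Expr.cost, hh.r6, hh.a6,
          hh.hm, hh.hw, hh.tm, hh.tw, h14, hmk, hlt, hjw, hw1]
        exact hold fun h => hlt h.2
    · rw [if_neg hU] at hmk
      simp [wp_seq, wp_ite, wp_assign, wp_skip, Expr.Fits, Expr.eval, Expr.cost, hh.r6, hh.a6,
        hh.hm, hh.hw, hh.tm, hh.tw, hmk, hw0]
      exact hold fun h => hU h.1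
  · rintro t s' - ⟨ht, hI⟩
    refine ⟨?_, hI⟩
    simp only [Expr.cost]
    omega

/-- With truncated subtraction, `a + (s - a)` is the maximum of `a` and `s`, and `b - (b - e)` is
the minimum of `b` and `e`. -/
theorem eMax_spec (hB : Big G σ m w) {a b j : ℕ} (haw : a ≤ G.T) (h : ℕ) (s' : State)
    (hh : Half G m w j h s') (h11 : s'.reg 11 = a) (_ : s'.reg 12 = b) :
    eMax.Fits m w s' ∧ eMax.eval s' = max a (G.st (eid h)) ∧ max a (G.st (eid h)) < w := by
  have := hB.w_ge
  have := hh.sw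
  simp only [Expr.Fits, Expr.eval, hh.r6, hh.a7, hh.a2, hh.hw, hh.hm, hh.em, hh.ew, h11, true_and,
    and_true]
  omega

theorem eMin_spec (hB : Big G σ m w) {a b j : ℕ} (hbw : b ≤ G.T) (h : ℕ) (s' : State)
    (hh : Half G m w j h s') (_ : s'.reg 11 = a) (h12 : s'.reg 12 = b) :
    eMin.Fits m w s' ∧ eMin.eval s' = min b (G.en (eid h)) ∧ min b (G.en (eid h)) < w := by
  have := hB.w_ge
  have := hh.nw
  simp only [Expr.Fits, Expr.eval, hh.r6, hh.a7, hh.a3, hh.hw, hh.hm, hh.em, hh.ew, h12, true_and,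
    and_true]
  omega

/-- The last generator of a child lies outside the current clique and has a neighbour in it. The
scan of the members' adjacency lists meets all such vertices without a pass over the whole vertex
set. -/
theorem wp_nbrScan (hB : Big G σ m w) (hE : Env G σ s) {D : ℕ} {U : Finset ℕ} {a b j : ℕ}
    (hC : Cur G U a b s) (hU : ∀ u ∈ U, u < G.n) (hD : ∑ u ∈ U, (G.deg u + 1) ≤ D)
    (hj : s.reg 14 = j) (hjn : j < G.n) :
    WP m w nbrScan s fun t s' => t ≤ 60 * D + 10 ∧
      Next (fun x => ∃ p ∈ U, ∃ h ∈ G.adjL p, G.tgt h = x ∧ x ∉ U) j G.n (s'.reg 25) := by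
  have hm := hB.m_ge
  have hw := hB.w_ge
  have hcard := card_le hU
  unfold nbrScan
  rw [wp_seq, wp_assign]
  refine ⟨by simp only [Expr.Fits, hE.r0]; omega, ?_⟩
  simp only [Expr.eval, hE.r0]
  have hC₁ : Cur G U a b (s.setReg 25 G.n) := hC.setReg (by omega) (by omega) (by omega)
  refine (wp_list hB (hE.setReg 25 _ (by omega)) (l := lst (s.arr 8) (s.reg 10)) (by simp)
    (fun y hy => hU y ((hC.mem y).1 hy)) (by simp [hC.card, hcard]) (fun pre s' =>
    Next (fun x => ∃ p ∈ pre, ∃ h ∈ G.adjL p, G.tgt h = x ∧ x ∉ U) j G.n (s'.reg 25))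
    45 (by decide) (by decide) rfl rfl rfl rfl ?_ ?_ ?_).mono ?_
  · simpa using Next.empty j G.n
  · intro pre s' x hI
    simpa using hI
  · intro pre y post hsplit s' hag hE' hy hyn hI
    have hC' : Cur G U a b s' := hC₁.agree hag rfl
    have h14 : s'.reg 14 = j := (hag.reg 14 rfl).trans (by simp [hj])
    refine (wp_adj hB hE' hy hyn (fun done s'' => Next (fun x =>
      (∃ p ∈ pre, ∃ h ∈ G.adjL p, G.tgt h = x ∧ x ∉ U) ∨ ∃ h ∈ done, G.tgt h = x ∧ x ∉ U) j G.n
      (s''.reg 25)) 35 rfl rfl ?_ ?_ ?_).mono ?_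
    · exact hI.congr fun x => by simp
    · intro done s'' x hI
      simpa using hI
    · intro done h post' hL s'' hag' hE'' hh hI'
      have hC'' : Cur G U a b s'' := hC'.agree hag' rfl
      have h14' : s''.reg 14 = j := (hag'.reg 14 rfl).trans h14
      have hmk : s''.arr 9 (G.tgt h) = if G.tgt h ∈ U then 1 else 0 := by rw [hC''.mark]
      have hle := hI'.le
      have hr25 : s''.reg 25 < w := by omega
      have hjw : j < w := by omega
      have hw1 : 1 < w := by omega
      have hw0 : 0 < w := by omega
      have hnew : ∀ v, (v = if j < G.tgt h ∧ G.tgt h < s''.reg 25 then G.tgt h else s''.reg 25) →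
          G.tgt h ∉ U → Next (fun x => (∃ p ∈ pre, ∃ h ∈ G.adjL p, G.tgt h = x ∧ x ∉ U) ∨
            ∃ g ∈ done ++ [h], G.tgt g = x ∧ x ∉ U) j G.n v := by
        rintro v rfl h1
        refine hI'.insert.congr fun x => ?_
        simp only [List.mem_append, List.mem_singleton, or_and_right, exists_or, exists_eq_left,
          or_assoc]
        refine or_congr_right (or_congr_right ⟨fun h => ⟨h.symm, h ▸ h1⟩, fun h => h.1.symm⟩)
      have hold : G.tgt h ∈ U → Next (fun x => (∃ p ∈ pre, ∃ h ∈ G.adjL p, G.tgt h = x ∧ x ∉ U) ∨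
            ∃ g ∈ done ++ [h], G.tgt g = x ∧ x ∉ U) j G.n (s''.reg 25) := by
        intro h1
        refine hI'.congr fun x => or_congr_right ?_
        simp only [List.mem_append, List.mem_singleton, or_and_right, exists_or, exists_eq_left]
        refine (or_iff_left ?_).symm
        rintro ⟨rfl, h2⟩
        exact h2 h1
      generalize (fun x => (∃ p ∈ pre, ∃ h ∈ G.adjL p, G.tgt h = x ∧ x ∉ U) ∨
        ∃ g ∈ done ++ [h], G.tgt g = x ∧ x ∉ U) = S at hnew hold ⊢
      unfold nbrBody
      by_cases hU' : G.tgt h ∈ U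
      · rw [if_pos hU'] at hmk
        simp [wp_ite, wp_skip, Expr.Fits, Expr.eval, Expr.cost, hh.r6, hh.a6,
          hh.hm, hh.hw, hh.tm, hh.tw, hmk, hw1]
        exact hold hU'
      · rw [if_neg hU'] at hmk
        simp [wp_ite, wp_assign, wp_skip, Expr.Fits, Expr.eval, Expr.cost, hh.r6, hh.a6,
          hh.hm, hh.hw, hh.tm, hh.tw, hmk, h14', hjw, hw1, hw0, hr25]
        exact ⟨fun h1 => ⟨fun h2 => hnew _ (by simp [h1, h2]) hU',
          fun h2 => hnew _ (by simp [not_lt.2 h2]) hU'⟩,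
          fun h1 => hnew _ (by simp [not_lt.2 h1]) hU'⟩
    · rintro t s'' - ⟨ht, hI'⟩
      refine ⟨by omega, hI'.congr fun x => ?_⟩
      simp only [List.mem_append, List.mem_singleton, or_and_right, exists_or, exists_eq_left]
  · rintro t s' - ⟨ht, hI⟩
    refine ⟨?_, hI.congr fun x => ?_⟩
    · rw [← List.sum_toFinset _ hC.nodup, hC.eq] at ht
      simp only [Expr.cost]
      omega
    · simp only [hC.mem]

end

end RAM

/-! ### Collecting generators, changing the current clique, output. -/

namespace RAM

open IGraph

section

variable {G : IGraph} {σ m w : ℕ} {s : State}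

/-- By `Par.mem_pre_iff` these are the earlier generators of the child with last generator `j` and
active time `[a', b']`, if there is such a child. -/
theorem wp_genList (hB : Big G σ m w) (hE : Env G σ s) {U : Finset ℕ} {a b j a' b' : ℕ}
    (hC : Cur G U a b s) (hj : s.reg 14 = j) (hjn : j < G.n) (h15 : s.reg 15 = a')
    (h16 : s.reg 16 = b') (haw : a' < w) (hbw : b' < w) :
    WP m w genList s fun t s' => t ≤ 70 * (G.deg j + 1) ∧
      (lst (s'.arr 10) (s'.reg 20)).Nodup ∧
      ∀ z, z ∈ lst (s'.arr 10) (s'.reg 20) ↔ z ∈ U ∧ z < j ∧ G.Adj a' b' z j := by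
  have hm := hB.m_ge
  have hw := hB.w_ge
  unfold genList
  rw [wp_seq, wp_assign]
  refine ⟨by simp only [Expr.Fits]; omega, ?_⟩
  simp only [Expr.eval]
  refine (wp_adj hB (hE.setReg 20 _ (by omega)) (v := j) (by simp [hj]) hjn (fun done s' =>
    (lst (s'.arr 10) (s'.reg 20)).Nodup ∧ ∀ z, z ∈ lst (s'.arr 10) (s'.reg 20) ↔
      z ∈ U ∧ z < j ∧ ∃ g ∈ done, G.tgt g = z ∧ Ok G a' b' g) 55 rfl rfl ?_ ?_ ?_).mono ?_
  · simp [lst]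
  · intro pre s' x hI
    simpa using hI
  · rintro done h post hL s' hag hE' hh ⟨hnd, hI⟩
    have hC' : Cur G U a b s' := (hC.setReg (by omega) (by omega) (by omega)).agree hag rfl
    have h14 : s'.reg 14 = j := (hag.reg 14 rfl).trans (by simp [hj])
    have h15' : s'.reg 15 = a' := (hag.reg 15 rfl).trans (by simp [h15])
    have h16' : s'.reg 16 = b' := (hag.reg 16 rfl).trans (by simp [h16])
    have hmk : s'.arr 9 (G.tgt h) = if G.tgt h ∈ U then 1 else 0 := by rw [hC'.mark]
    have hjw : j < w := by omega
    have hw1 : 1 < w := by omega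
    have hw0 : 0 < w := by omega
    set k := s'.reg 20 with hk
    set l := lst (s'.arr 10) k with hl
    have hkn : k ≤ G.n := by
      have := length_le (G := G) hnd fun u hu => by have := (hI u).1 hu; omega
      rwa [hl, lst_length] at this
    have hkm : k < m := by omega
    have hkw : k + 1 < w := by omega
    have hkw' : k < w := by omega
    have hold : ¬ (G.tgt h ∈ U ∧ G.tgt h < j ∧ Ok G a' b' h) → ∀ z, z ∈ l ↔
        z ∈ U ∧ z < j ∧ ∃ g ∈ done ++ [h], G.tgt g = z ∧ Ok G a' b' g := by
      intro hn z
      rw [hI z]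
      refine and_congr_right fun h1 => and_congr_right fun h2 => ?_
      simp only [List.mem_append, List.mem_singleton, or_and_right, exists_or, exists_eq_left]
      refine (or_iff_left ?_).symm
      rintro ⟨rfl, h3⟩
      exact hn ⟨h1, h2, h3⟩
    have hnew : G.tgt h ∈ U → G.tgt h < j → Ok G a' b' h → (l ++ [G.tgt h]).Nodup ∧
        ∀ z, z ∈ l ++ [G.tgt h] ↔
        z ∈ U ∧ z < j ∧ ∃ g ∈ done ++ [h], G.tgt g = z ∧ Ok G a' b' g := by
      intro h1 h2 h3
      constructor
      · rw [List.nodup_append]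
        refine ⟨hnd, by simp, ?_⟩
        intro x hx y hy
        rw [List.mem_singleton.1 hy]
        obtain ⟨-, -, g, hg, rfl, -⟩ := (hI x).1 hx
        exact tgt_notMem hL g hg
      · intro z
        rw [List.mem_append, hI z]
        simp only [List.mem_append, List.mem_singleton, or_and_right, exists_or, exists_eq_left]
        constructor
        · rintro (⟨h4, h5, h6⟩ | rfl)
          · exact ⟨h4, h5, Or.inl h6⟩
          · exact ⟨h1, h2, Or.inr ⟨rfl, h3⟩⟩
        · rintro ⟨h4, h5, h6 | ⟨rfl, -⟩⟩
          · exact Or.inl ⟨h4, h5, h6⟩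
          · exact Or.inr rfl
    have hgen : WP m w genBody s' fun t s'' => t ≤ 55 ∧
        lst (s''.arr 10) (s''.reg 20) = (if G.tgt h ∈ U ∧ G.tgt h < j ∧ G.st (eid h) ≤ a' ∧
          b' ≤ G.en (eid h) then l ++ [G.tgt h] else l) := by
      unfold genBody
      by_cases h1 : G.tgt h ∈ U
      · rw [if_pos h1] at hmk
        by_cases h2 : G.tgt h < j
        · by_cases h3 : a' < G.st (eid h)
          · simp [wp_ite, wp_skip, Expr.Fits, Expr.eval, Expr.cost, hh.r6, hh.a6,
              hh.a7, hh.a2, hh.hm, hh.hw, hh.em, hh.ew, hh.tm, hh.tw, hh.sw, hmk, h14, h15', hjw,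
              haw, hw1, h1, h2, h3, ← hk, ← hl, not_le.2 h3]
          · by_cases h4 : G.en (eid h) < b'
            · simp [wp_ite, wp_skip, Expr.Fits, Expr.eval, Expr.cost, hh.r6, hh.a6,
                hh.a7, hh.a2, hh.a3, hh.hm, hh.hw, hh.em, hh.ew, hh.tm, hh.tw, hh.sw, hh.nw, hmk,
                h14, h15', h16', hjw, haw, hbw, hw1, h1, h2, h3, h4, ← hk, ← hl, not_le.2 h4]
            · simp [wp_seq, wp_ite, wp_assign, wp_write, Expr.Fits, Expr.eval, Expr.cost,
                hh.r6, hh.a6, hh.a7, hh.a2, hh.a3, hh.hm, hh.hw, hh.em, hh.ew, hh.tm, hh.tw, hh.sw,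
                hh.nw, hmk, h14, h15', h16', hjw, haw, hbw, hw1, h1, h2, h3, h4, ← hk, hkm, hkw,
                hkw', not_lt.1 h3, not_lt.1 h4, lst_update, ← hl]
        · simp [wp_ite, wp_skip, Expr.Fits, Expr.eval, Expr.cost, hh.r6, hh.a6,
            hh.hm, hh.hw, hh.tm, hh.tw, hmk, h14, hjw, hw1, h1, h2, ← hk, ← hl]
      · rw [if_neg h1] at hmk
        simp [wp_ite, wp_skip, Expr.Fits, Expr.eval, Expr.cost, hh.r6, hh.a6,
          hh.hm, hh.hw, hh.tm, hh.tw, hmk, hw0, h1, ← hk, ← hl]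
    refine hgen.mono ?_
    rintro t s'' - ⟨ht, hl'⟩
    refine ⟨ht, ?_⟩
    rw [hl']
    split_ifs with hcond
    · exact hnew hcond.1 hcond.2.1 hcond.2.2
    · exact ⟨hnd, hold hcond⟩
  · rintro t s' - ⟨ht, hnd, hI⟩
    refine ⟨by simp only [Expr.cost]; omega, hnd, fun z => ?_⟩
    rw [hI z]
    refine and_congr_right fun _ => and_congr_right fun _ => ?_
    rw [show (∃ g ∈ G.adjL j, G.tgt g = z ∧ Ok G a' b' g) ↔ G.Adj a' b' j z from adj_iff_half.symm]
    exact ⟨Adj.symm, Adj.symm⟩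

theorem sum_deg {U : Finset ℕ} {l : List ℕ} (hl : l.Nodup) (hU : l.toFinset = U) :
    (l.map fun y => G.deg y + 1).sum = ∑ u ∈ U, (G.deg u + 1) := by
  rw [← hU, List.sum_toFinset _ hl]

theorem wp_preList (hB : Big G σ m w) (hE : Env G σ s) {D : ℕ} {U : Finset ℕ} {a b j : ℕ}
    (hC : Cur G U a b s) (hU : ∀ u ∈ U, u < G.n) (hD : ∑ u ∈ U, (G.deg u + 1) ≤ D)
    (hj : s.reg 13 = j) (hjn : j < G.n) :
    WP m w preList s fun t s' => t ≤ 40 * D + 10 ∧ (lst (s'.arr 10) (s'.reg 20)).Nodup ∧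
      (lst (s'.arr 10) (s'.reg 20)).toFinset = U.filter (· < j) := by
  have hm := hB.m_ge
  have hw := hB.w_ge
  have hcard := card_le hU
  unfold preList
  rw [wp_seq, wp_assign]
  refine ⟨by simp only [Expr.Fits]; omega, ?_⟩
  simp only [Expr.eval]
  refine (wp_list hB (hE.setReg 20 _ (by omega)) (l := lst (s.arr 8) (s.reg 10)) (by simp)
    (fun y hy => hU y ((hC.mem y).1 hy)) (by simp [hC.card, hcard]) (fun pre s' =>
    lst (s'.arr 10) (s'.reg 20) = pre.filter (· < j))
    25 (by decide) (by decide) rfl rfl rfl rfl ?_ ?_ ?_).mono ?_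
  · simp [lst]
  · intro pre s' x hI
    simpa using hI
  · intro pre y post hsplit s' hag hE' hy hyn hI
    have h13 : s'.reg 13 = j := (hag.reg 13 rfl).trans (by simp [hj])
    have hlen : s'.reg 20 < G.n := by
      have h1 : (pre.filter (· < j)).length ≤ pre.length := List.length_filter_le _ _
      rw [← hI, lst_length] at h1
      have h2 : (lst (s.arr 8) (s.reg 10)).length = pre.length + (post.length + 1) := by
        rw [hsplit]; simp
      rw [lst_length, hC.card] at h2
      omega
    rw [List.filter_append]
    by_cases hlt : y < j
    · simp [wp_seq, wp_ite, wp_assign, wp_write, Expr.Fits, Expr.eval, Expr.cost, hy, h13, hlt,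
        lst_update, hI]
      omega
    · simp [wp_ite, wp_skip, Expr.Fits, Expr.eval, Expr.cost, hy, h13, hlt, hI]
      omega
  · rintro t s' - ⟨ht, hI⟩
    rw [sum_deg hC.nodup hC.eq] at ht
    refine ⟨by simp only [Expr.cost]; omega, ?_, ?_⟩
    · rw [hI]
      exact hC.nodup.filter _
    · rw [hI]
      ext z
      simp [hC.mem]

/-- The test is applied to a list with as many members as the current clique, where inclusion means
equality. -/
theorem wp_subTest (hB : Big G σ m w) (hE : Env G σ s) {D : ℕ} {U V : Finset ℕ} {a b : ℕ}
    (hC : Cur G U a b s) (hnd : (lst (s.arr 10) (s.reg 20)).Nodup)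
    (hV : (lst (s.arr 10) (s.reg 20)).toFinset = V) (hVn : ∀ u ∈ V, u < G.n)
    (hD : ∑ u ∈ V, (G.deg u + 1) ≤ D) :
    WP m w subTest s fun t s' => t ≤ 40 * D + 10 ∧ (s'.reg 27 = 1 ↔ V ⊆ U) ∧ s'.reg 27 ≤ 1 := by
  have hm := hB.m_ge
  have hw := hB.w_ge
  have hmem : ∀ x, x ∈ lst (s.arr 10) (s.reg 20) ↔ x ∈ V := fun x => by
    rw [← hV, List.mem_toFinset]
  have hcard : s.reg 20 ≤ G.n := by
    have := card_le (G := G) hVn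
    rwa [← hV, List.toFinset_card_of_nodup hnd, lst_length] at this
  have hC₁ : Cur G U a b (s.setReg 27 1) := hC.setReg (by omega) (by omega) (by omega)
  unfold subTest
  rw [wp_seq, wp_assign]
  refine ⟨by simp only [Expr.Fits]; omega, ?_⟩
  simp only [Expr.eval]
  refine (wp_list hB (hE.setReg 27 _ (by omega)) (l := lst (s.arr 10) (s.reg 20)) (by simp)
    (fun y hy => hVn y ((hmem y).1 hy)) (by simpa using hcard) (fun pre s' =>
    (s'.reg 27 = 1 ↔ ∀ x ∈ pre, x ∈ U) ∧ s'.reg 27 ≤ 1)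
    20 (by decide) (by decide) rfl rfl rfl rfl ?_ ?_ ?_).mono ?_
  · simp
  · intro pre s' x hI
    simpa using hI
  · rintro pre y post hsplit s' hag hE' hy hyn ⟨hI1, hI2⟩
    have hC' : Cur G U a b s' := hC₁.agree hag rfl
    have hmk : s'.arr 9 y = if y ∈ U then 1 else 0 := by rw [hC'.mark]
    by_cases hyU : y ∈ U
    · rw [if_pos hyU] at hmk
      simp [wp_ite, wp_skip, Expr.Fits, Expr.eval, Expr.cost, hy, hmk, hI2]
      refine ⟨⟨by omega, by omega, by omega⟩, by omega, ?_⟩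
      rw [hI1]
      exact ⟨fun h x hx => hx.elim (h x) fun h => h ▸ hyU, fun h x hx => h x (Or.inl hx)⟩
    · rw [if_neg hyU] at hmk
      simp [wp_ite, wp_assign, Expr.Fits, Expr.eval, Expr.cost, hy, hmk]
      refine ⟨⟨by omega, by omega, by omega⟩, by omega, by omega, Or.inr hyU⟩
  · rintro t s' - ⟨ht, hI1, hI2⟩
    rw [sum_deg hnd hV] at ht
    refine ⟨by simp only [Expr.cost]; omega, ?_, hI2⟩
    rw [hI1]
    simp only [hmem]
    rfl

/-- The old marks are erased by running through the old clique, so the cost depends on the two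
cliques and not on the number of vertices. -/
theorem wp_load (hB : Big G σ m w) (hE : Env G σ s) {D a b a₀ b₀ : ℕ} {U V : Finset ℕ}
    (hC : Cur G U a₀ b₀ s) (hU : ∀ u ∈ U, u < G.n) (hDU : ∑ u ∈ U, (G.deg u + 1) ≤ D)
    (hnd : (lst (s.arr 10) (s.reg 20)).Nodup) (hV : (lst (s.arr 10) (s.reg 20)).toFinset = V)
    (hVn : ∀ u ∈ V, u < G.n) (hDV : ∑ u ∈ V, (G.deg u + 1) ≤ D)
    (h21 : s.reg 21 = a) (h22 : s.reg 22 = b) (haw : a < w) (hbw : b < w) :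
    WP m w load s fun t s' => t ≤ 80 * D + 30 ∧ Cur G V a b s' := by
  have hm := hB.m_ge
  have hw := hB.w_ge
  have hmem : ∀ x, x ∈ lst (s.arr 10) (s.reg 20) ↔ x ∈ V := fun x => by
    rw [← hV, List.mem_toFinset]
  have hcard : s.reg 20 ≤ G.n := by
    have := card_le (G := G) hVn
    rwa [← hV, List.toFinset_card_of_nodup hnd, lst_length] at this
  have hcardU := card_le hU
  unfold load
  rw [wp_seq]
  unfold unmark
  refine (wp_list hB hE (l := lst (s.arr 8) (s.reg 10)) rfl
    (fun y hy => hU y ((hC.mem y).1 hy)) (by simp [hC.card, hcardU]) (fun pre s' =>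
    ∀ z, s'.arr 9 z = if z ∈ U ∧ z ∉ pre then 1 else 0)
    20 (by decide) (by decide) rfl rfl rfl rfl ?_ ?_ ?_).mono ?_
  · intro z
    rw [hC.mark]
    simp
  · intro pre s' x hI
    exact ⟨hI, hI⟩
  · intro pre y post hsplit s' hag hE' hy hyn hI
    simp only [wp_write, Expr.Fits, Expr.eval, Expr.cost, hy]
    refine ⟨by omega, by omega, by omega, by omega, fun z => ?_⟩
    simp only [State.setCell_arr, if_true]
    by_cases hz : z = y
    · subst hz; simp
    · rw [Function.update_of_ne hz, hI z]
      simp [hz]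
  · rintro t₁ s₁ hag₁ ⟨ht₁, hI₁⟩
    rw [sum_deg hC.nodup hC.eq] at ht₁
    have h9 : s₁.arr 9 = fun _ => 0 := by
      ext z
      rw [hI₁ z, if_neg]
      rintro ⟨h1, h2⟩
      exact h2 ((hC.mem z).2 h1)
    have hE₁ : Env G σ s₁ := hE.agree hag₁ rfl
    have h10 : s₁.arr 10 = s.arr 10 := hag₁.arr 10 rfl
    have h20 : s₁.reg 20 = s.reg 20 := hag₁.reg 20 rfl
    have h21' : s₁.reg 21 = a := (hag₁.reg 21 rfl).trans h21
    have h22' : s₁.reg 22 = b := (hag₁.reg 22 rfl).trans h22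
    rw [wp_seq, wp_assign]
    refine ⟨by simp only [Expr.Fits]; omega, ?_⟩
    rw [wp_seq, wp_assign]
    refine ⟨by simp [Expr.Fits, h21']; omega, ?_⟩
    rw [wp_seq, wp_assign]
    refine ⟨by simp [Expr.Fits, h22']; omega, ?_⟩
    refine (wp_list hB (((hE₁.setReg 10 _ (by omega)).setReg 11 _ (by omega)).setReg 12 _ (by omega))
      (l := lst (s.arr 10) (s.reg 20)) (by simp [h10, h20])
      (fun y hy => hVn y ((hmem y).1 hy)) (by simp [h20, hcard]) (fun pre s' =>
      lst (s'.arr 8) (s'.reg 10) = pre ∧ s'.arr 9 = fun z => if z ∈ pre then 1 else 0)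
      20 (by decide) (by decide) rfl rfl rfl rfl ?_ ?_ ?_).mono ?_
    · simp [lst, h9, Expr.eval]
    · intro pre s' x hI
      simpa using hI
    · rintro pre y post hsplit s' hag hE' hy hyn ⟨hI1, hI2⟩
      have hlen : s'.reg 10 < G.n := by
        have h2 : (lst (s.arr 10) (s.reg 20)).length = pre.length + (post.length + 1) := by
          rw [hsplit]; simp
        rw [lst_length, ← hI1, lst_length] at h2
        omega
      simp only [wp_seq, wp_write, wp_assign, Expr.Fits, Expr.eval, Expr.cost, hy]
      refine ⟨by omega, by omega, by omega, ⟨by simp; omega, by omega, by simp; omega⟩,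
        by simp [hy]; omega, by simp [hy]; omega, by omega, by omega, ?_, ?_⟩
      · simp [lst_update, hI1]
      · simp only [State.setReg_arr, State.setCell_arr, State.setReg_reg, State.setCell_reg]
        ext z
        by_cases hz : z = y
        · subst hz; simp [hy]
        · simp [hy, hz, hI2]
    · rintro t₂ s₂ hag₂ ⟨ht₂, h8, h9₂⟩
      rw [sum_deg hnd hV] at ht₂
      refine ⟨by simp only [Expr.cost]; omega, by rwa [h8], by rwa [h8], ?_, ?_, ?_⟩
      · exact (hag₂.reg 11 rfl).trans (by simp [Expr.eval, h21'])
      · exact (hag₂.reg 12 rfl).trans (by simp [Expr.eval, h22'])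
      · rw [h9₂]
        simp only [hmem]

/-- `r` lists the edges with both ends in `U`. -/
def Lists (G : IGraph) (U : Finset ℕ) (r : List ℕ) : Prop :=
  r.Nodup ∧ ∀ e, e ∈ r ↔ e < G.E ∧ G.eu e ∈ U ∧ G.ev e ∈ U

/-- An edge is written when its smaller end is scanned, hence once; the invariant therefore
describes the written edges by the minimum of their ends. -/
theorem wp_output (hB : Big G σ m w) (hE : Env G σ s) {D a b : ℕ} {U : Finset ℕ}
    (hC : Cur G U a b s) (hU : ∀ u ∈ U, u < G.n) (hDU : ∑ u ∈ U, (G.deg u + 1) ≤ D)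
    (hcur : s.cur = []) :
    WP m w output s fun t s' => t ≤ 60 * D + 30 ∧ s'.cur = [] ∧
      ∃ r, s'.out = s.out ++ [r] ∧ Lists G U r := by
  have hm := hB.m_ge
  have hw := hB.w_ge
  have hcardU := card_le hU
  have hw0 : 0 < w := by omega
  have hw1 : 1 < w := by omega
  unfold output
  rw [wp_seq]
  refine (wp_list hB hE (l := lst (s.arr 8) (s.reg 10)) rfl
    (fun y hy => hU y ((hC.mem y).1 hy)) (by simp [hC.card, hcardU]) (fun pre s' =>
    s'.out = s.out ∧ s'.cur.Nodup ∧ ∀ e, e ∈ s'.cur ↔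
      (e < G.E ∧ G.eu e ∈ U ∧ G.ev e ∈ U) ∧ min (G.eu e) (G.ev e) ∈ pre)
    45 (by decide) (by decide) rfl rfl rfl rfl ?_ ?_ ?_).mono ?_
  · simp [hcur]
  · intro pre s' x hI
    exact ⟨hI, hI⟩
  · rintro pre y post hsplit s' hag hE' hy hyn ⟨hout, hnd, hI⟩
    have hC' : Cur G U a b s' := hC.agree hag rfl
    have hyU : y ∈ U := (hC.mem y).1 (by rw [hsplit]; simp)
    have hypre : y ∉ pre := by
      have := hC.nodup
      rw [hsplit, List.nodup_append] at this
      exact fun h => this.2.2 y h y (by simp) rfl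
    refine (wp_adj hB hE' hy hyn (fun done s'' => s''.out = s.out ∧ s''.cur.Nodup ∧
      ∀ e, e ∈ s''.cur ↔ ((e < G.E ∧ G.eu e ∈ U ∧ G.ev e ∈ U) ∧ min (G.eu e) (G.ev e) ∈ pre) ∨
        ∃ g ∈ done, (G.tgt g ∈ U ∧ y < G.tgt g) ∧ eid g = e) 35 rfl rfl ?_ ?_ ?_).mono ?_
    · exact ⟨hout, hnd, by simpa using hI⟩
    · intro done s'' x hI'
      exact hI'
    · rintro done h post' hL s'' hag' hE'' hh ⟨hout', hnd', hI'⟩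
      have hC'' : Cur G U a b s'' := hC'.agree hag' rfl
      have h24 : s''.reg 24 = y := (hag'.reg 24 rfl).trans hy
      have hmk : s''.arr 9 (G.tgt h) = if G.tgt h ∈ U then 1 else 0 := by rw [hC''.mark]
      have hyw : y < w := by omega
      have hjoin := mem_adjL hh.mem
      have hmin : y < G.tgt h → min (G.eu (eid h)) (G.ev (eid h)) = y := by
        intro hlt
        rcases hjoin.2.2.2 with ⟨h1, h2⟩ | ⟨h1, h2⟩ <;> omega
      have hold : ¬ (G.tgt h ∈ U ∧ y < G.tgt h) → ∀ e, e ∈ s''.cur ↔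
          ((e < G.E ∧ G.eu e ∈ U ∧ G.ev e ∈ U) ∧ min (G.eu e) (G.ev e) ∈ pre) ∨
          ∃ g ∈ done ++ [h], (G.tgt g ∈ U ∧ y < G.tgt g) ∧ eid g = e := by
        intro hn e
        rw [hI' e]
        refine or_congr_right ?_
        simp only [List.mem_append, List.mem_singleton, or_and_right, exists_or, exists_eq_left]
        refine (or_iff_left ?_).symm
        exact fun h => hn h.1
      have hnew : G.tgt h ∈ U ∧ y < G.tgt h → (s''.cur ++ [eid h]).Nodup ∧
          ∀ e, e ∈ s''.cur ++ [eid h] ↔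
          ((e < G.E ∧ G.eu e ∈ U ∧ G.ev e ∈ U) ∧ min (G.eu e) (G.ev e) ∈ pre) ∨
          ∃ g ∈ done ++ [h], (G.tgt g ∈ U ∧ y < G.tgt g) ∧ eid g = e := by
        intro hc
        constructor
        · rw [List.nodup_append]
          refine ⟨hnd', by simp, ?_⟩
          intro x hx z hz
          rw [List.mem_singleton.1 hz]
          rintro rfl
          rcases (hI' _).1 hx with ⟨-, h1⟩ | ⟨g, hg, -, h2⟩
          · rw [hmin hc.2] at h1
            exact hypre h1
          · refine tgt_notMem hL g hg ?_
            have hn := nodup_eid (G := G) G.E y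
            have : g = h := List.inj_on_of_nodup_map hn (show g ∈ G.adjL y by simp [hL, hg])
              hh.mem h2
            rw [this]
        · intro e
          rw [List.mem_append, hI' e, List.mem_singleton]
          simp only [List.mem_append, List.mem_singleton, or_and_right, exists_or, exists_eq_left,
            hc, true_and, or_assoc]
          exact or_congr_right (or_congr_right eq_comm)
      simp only [← and_assoc] at hold hnew
      have key : WP m w outBody s'' fun t s₃ => t ≤ 35 ∧ s₃.out = s''.out ∧
          s₃.cur = if G.tgt h ∈ U ∧ y < G.tgt h then s''.cur ++ [eid h] else s''.cur := by
        unfold outBody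
        by_cases h1 : G.tgt h ∈ U
        · rw [if_pos h1] at hmk
          by_cases h2 : y < G.tgt h
          · simp [wp_ite, wp_emit, Expr.Fits, Expr.eval, Expr.cost, hh.r6, hh.a6, hh.a7,
              hh.hm, hh.hw, hh.tm, hh.tw, hh.ew, hmk, h24, hyw, hw1, h1, h2]
          · simp [wp_ite, wp_skip, Expr.Fits, Expr.eval, Expr.cost, hh.r6, hh.a6,
              hh.hm, hh.hw, hh.tm, hh.tw, hmk, h24, hyw, hw1, h1, h2]
        · rw [if_neg h1] at hmk
          simp [wp_ite, wp_skip, Expr.Fits, Expr.eval, Expr.cost, hh.r6, hh.a6,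
            hh.hm, hh.hw, hh.tm, hh.tw, hmk, hw0, h1]
      refine key.mono ?_
      rintro t s₃ - ⟨ht, ho, hc⟩
      refine ⟨ht, ho.trans hout', ?_⟩
      rw [hc]
      simp only [← and_assoc]
      split_ifs with hcond
      · exact hnew hcond
      · exact ⟨hnd', hold hcond⟩
    · rintro t s'' - ⟨ht, hout', hnd', hI'⟩
      refine ⟨by omega, hout', hnd', fun e => ?_⟩
      rw [hI' e, List.mem_append, List.mem_singleton]
      constructor
      · rintro (⟨h1, h2⟩ | ⟨g, hg, ⟨h1, h2⟩, rfl⟩)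
        · exact ⟨h1, Or.inl h2⟩
        · obtain ⟨-, -, he, hj⟩ := mem_adjL hg
          rcases hj with ⟨h3, h4⟩ | ⟨h3, h4⟩
          · rw [h3, h4]
            exact ⟨⟨he, hyU, h1⟩, Or.inr (by omega)⟩
          · rw [h3, h4]
            exact ⟨⟨he, h1, hyU⟩, Or.inr (by omega)⟩
      · rintro ⟨h1, h2 | h2⟩
        · exact Or.inl ⟨h1, h2⟩
        · right
          have hne := G.ne e h1.1
          rcases le_total (G.eu e) (G.ev e) with hle | hle
          · rw [min_eq_left hle] at h2
            obtain ⟨g, hg, he, ht⟩ := exists_half h1.1 (Or.inl ⟨h2, rfl⟩)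
            exact ⟨g, hg, ⟨ht ▸ h1.2.2, by omega⟩, he⟩
          · rw [min_eq_right hle] at h2
            obtain ⟨g, hg, he, ht⟩ := exists_half h1.1 (Or.inr ⟨rfl, h2⟩)
            exact ⟨g, hg, ⟨ht ▸ h1.2.1, by omega⟩, he⟩
  · rintro t s' - ⟨ht, hout, hnd, hI⟩
    rw [sum_deg hC.nodup hC.eq] at ht
    rw [wp_flush]
    refine ⟨by omega, rfl, s'.cur, by rw [hout], hnd, fun e => ?_⟩
    rw [hI e]
    refine and_iff_left_of_imp fun h => ?_
    rw [hC.mem]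
    rcases min_choice (G.eu e) (G.ev e) with h' | h' <;> rw [h']
    · exact h.2.1
    · exact h.2.2

end

end RAM

/-! ## The search below a closed clique -/

namespace RAM

open IGraph

/-- Add the vertex in register `14` to the list of length `reg 29` in array `10`, complete it, and
test whether its active time is the interval in registers `15` and `16` and the completion adds
only larger vertices. -/
def extTest : Prog :=
  .assign 27 (.const 0) ;; .write 10 (.reg 29) (.reg 14) ;;
    .assign 20 (.add (.reg 29) (.const 1)) ;; closure ;;
    .ite (.eq (.reg 21) (.reg 15)) (.ite (.eq (.reg 22) (.reg 16))
      (.ite (.lt (.reg 14) (.reg 26)) (.assign 27 (.const 1)) .skip) .skip) .skip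

/-- Test whether the vertex in register `14` and the interval in registers `15` and `16` give a child
of the current clique; if so, put the child in array `10` and `1` in register `27`. -/
def childTest : Prog :=
  genList ;; .assign 27 (.const 0) ;;
  .ite (.lt (.const 1) (.reg 20))
    (.ite (.lt (.add (.reg 3) (.reg 15)) (.add (.reg 16) (.const 2)))
      (.ite (.lt (.reg 15) (.add (.reg 16) (.const 1)))
        (.assign 29 (.reg 20) ;; closure ;;
          .ite (.eq (.reg 20) (.reg 10)) (.ite (.eq (.reg 21) (.reg 11))
            (.ite (.eq (.reg 22) (.reg 12))
              (subTest ;; .ite (.reg 27) extTest .skip) .skip) .skip) .skip) .skip) .skip) .skip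

section

variable {G : IGraph} {σ m w : ℕ} {s : State}

theorem IsTau.degBound {D : ℕ} (hD : G.DegBound D) {U : Finset ℕ} {a b : ℕ} (h : G.IsTau U a b) :
    ∑ u ∈ U, (G.deg u + 1) ≤ D := by
  refine hD U (fun u hu => h.lt hu) fun u hu v hv huv => ?_
  obtain ⟨e, he, hj, -⟩ := h.1 u hu v hv huv
  exact ⟨e, he, hj⟩

theorem Env.setCell (h : Env G σ s) (a j v : ℕ) (ha : 8 ≤ a) : Env G σ (s.setCell a j v) := by
  constructor <;> simp only [State.setCell_arr, State.setCell_reg]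
  · exact h.r0
  · exact h.r1
  · exact h.r2
  · exact h.r3
  · rw [if_neg (by omega)]; exact h.a0
  · rw [if_neg (by omega)]; exact h.a1
  · rw [if_neg (by omega)]; exact h.a2
  · rw [if_neg (by omega)]; exact h.a3
  · rw [if_neg (by omega), if_neg (by omega)]; exact h.chain
  · rw [if_neg (by omega)]; exact h.a6
  · rw [if_neg (by omega)]; exact h.a7

theorem wp_extTest (hB : Big G σ m w) {D : ℕ} (hD : G.DegBound D) (hE : Env G σ s) {l : List ℕ}
    {j a b : ℕ} (h14 : s.reg 14 = j) (h15 : s.reg 15 = a) (h16 : s.reg 16 = b)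
    (h29 : s.reg 29 = l.length) (hl : lst (s.arr 10) l.length = l) (hnd : l.Nodup) (hjl : j ∉ l)
    (hjoin : ∀ u ∈ l, ∀ v ∈ l, u ≠ v → ∃ e < G.E, G.Joins e u v) (h2 : ∃ u ∈ l, ∃ v ∈ l, u ≠ v)
    (hadj : ∀ z ∈ l, ∃ e < G.E, G.Joins e z j) (hlen : l.length < G.n) (hjn : j < G.n)
    (haT : a ≤ G.T) (hbT : b ≤ G.T)
    (h11 : s.arr 11 = fun _ => 0) (h12 : s.arr 12 = fun _ => 0) :
    WP m w extTest s fun t s' => t ≤ 300 * D + 60 ∧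
      s'.arr 11 = (fun _ => 0) ∧ s'.arr 12 = (fun _ => 0) ∧
      ((s'.reg 27 = 0 ∧ ¬ ∃ C, G.IsTau (insert j l.toFinset) a b ∧
          G.IsCl a b (insert j l.toFinset) C ∧ ∀ z ∈ C, z ∉ insert j l.toFinset → j < z) ∨
        (s'.reg 27 = 1 ∧ ∃ C, (G.IsTau (insert j l.toFinset) a b ∧
          G.IsCl a b (insert j l.toFinset) C ∧ ∀ z ∈ C, z ∉ insert j l.toFinset → j < z) ∧
          (lst (s'.arr 10) (s'.reg 20)).Nodup ∧
          (lst (s'.arr 10) (s'.reg 20)).toFinset = C ∧ s'.reg 21 = a ∧ s'.reg 22 = b)) := by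
  have hm := hB.m_ge
  have hw := hB.w_ge
  have hins : (l ++ [j]).toFinset = insert j l.toFinset := by
    ext z
    simp only [List.toFinset_append, Finset.mem_union, List.mem_toFinset, List.mem_singleton,
      Finset.mem_insert]
    exact or_comm
  rw [← hins]
  unfold extTest
  rw [wp_seq, wp_assign]
  refine ⟨by simp only [Expr.Fits]; omega, ?_⟩
  rw [wp_seq, wp_write]
  refine ⟨by simp [Expr.Fits, h29]; omega, by simp [Expr.eval, h29]; omega,
    by simp [Expr.Fits, h14]; omega, ?_⟩
  rw [wp_seq, wp_assign]
  refine ⟨by simp [Expr.Fits, Expr.eval, h29]; omega, ?_⟩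
  rw [wp_seq]
  refine (wp_closure (l := l ++ [j]) hB hD
    (((hE.setReg 27 _ (by omega)).setCell 10 _ _ (by omega)).setReg 20 _ (by omega)) ?_ (List.nodup_append.2 ⟨hnd, by simp, fun z hz y hy => ?_⟩) ?_ ?_ ?_ ?_).mono ?_
  · simp [Expr.eval, h29, h14, lst_update, hl]
  · rw [List.mem_singleton.1 hy]
    exact fun h => hjl (h ▸ hz)
  · intro y hy z hz hyz
    simp only [List.mem_append, List.mem_singleton] at hy hz
    rcases hy with hy | rfl <;> rcases hz with hz | rfl
    · exact hjoin y hy z hz hyz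
    · exact hadj y hy
    · obtain ⟨e, he, hj⟩ := hadj z hz
      exact ⟨e, he, hj.symm⟩
    · exact absurd rfl hyz
  · obtain ⟨u, hu, v, hv, huv⟩ := h2
    exact ⟨u, by simp [hu], v, by simp [hv], huv⟩
  · simpa using h11
  · simpa using h12
  rintro t₅ s₅ hg₅ ⟨ht₅, a₅, b₅, C₅, hc₅⟩
  have h14₅ : s₅.reg 14 = j := (hg₅.reg 14 rfl).trans (by simpa using h14)
  have h15₅ : s₅.reg 15 = a := (hg₅.reg 15 rfl).trans (by simpa using h15)
  have h16₅ : s₅.reg 16 = b := (hg₅.reg 16 rfl).trans (by simpa using h16)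
  have h27₅ : s₅.reg 27 = 0 := (hg₅.reg 27 rfl).trans (by simp [Expr.eval])
  have ha5 := hc₅.tau.left_le
  have hb5 := hc₅.tau.right_le
  have hlow5 := hc₅.low_le
  have h21₅ := hc₅.r21
  have h22₅ := hc₅.r22
  have hlow := hc₅.low j hjn
  -- Active times and completions are unique, so only the computed ones can be a witness. Each
  -- failed comparison below refutes all of them.
  have huniq : ∀ C, (G.IsTau (l ++ [j]).toFinset a b ∧ G.IsCl a b (l ++ [j]).toFinset C ∧
      ∀ z ∈ C, z ∉ (l ++ [j]).toFinset → j < z) → a₅ = a ∧ b₅ = b ∧ j < s₅.reg 26 := by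
    rintro C ⟨h1, h2, h3⟩
    obtain ⟨rfl, rfl⟩ := hc₅.tau.unique h1
    obtain rfl := hc₅.cl.unique h2
    exact ⟨rfl, rfl, hlow.2 h3⟩
  rw [wp_ite]
  refine ⟨by simp [Expr.Fits]; omega, fun hk8 => ?_, fun hk8 => ?_⟩
  swap
  · rw [wp_skip]
    refine ⟨by simp only [Expr.cost]; omega, hc₅.a11, hc₅.a12, Or.inl ⟨h27₅, ?_⟩⟩
    rintro ⟨C, hC⟩
    simp [Expr.eval, h21₅, h15₅, (huniq C hC).1] at hk8
  rw [wp_ite]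
  refine ⟨by simp [Expr.Fits]; omega, fun hk9 => ?_, fun hk9 => ?_⟩
  swap
  · rw [wp_skip]
    refine ⟨by simp only [Expr.cost]; omega, hc₅.a11, hc₅.a12, Or.inl ⟨h27₅, ?_⟩⟩
    rintro ⟨C, hC⟩
    simp [Expr.eval, h22₅, h16₅, (huniq C hC).2.1] at hk9
  rw [wp_ite]
  refine ⟨by simp [Expr.Fits]; omega, fun hk10 => ?_, fun hk10 => ?_⟩
  swap
  · rw [wp_skip]
    refine ⟨by simp only [Expr.cost]; omega, hc₅.a11, hc₅.a12, Or.inl ⟨h27₅, ?_⟩⟩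
    rintro ⟨C, hC⟩
    simp [Expr.eval, h14₅, (huniq C hC).2.2] at hk10
  have haa : a₅ = a := by simpa [Expr.eval, h21₅, h15₅] using hk8
  have hbb : b₅ = b := by simpa [Expr.eval, h22₅, h16₅] using hk9
  subst haa hbb
  have hlt : j < s₅.reg 26 := by
    by_contra hlt
    simp [Expr.eval, h14₅, hlt] at hk10
  rw [wp_assign]
  exact ⟨by simp only [Expr.Fits]; omega, by simp only [Expr.cost]; omega, by simpa using hc₅.a11,
    by simpa using hc₅.a12, Or.inr ⟨by simp [Expr.eval], C₅, ⟨hc₅.tau, hc₅.cl, hlow.1 hlt⟩,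
    by simpa using hc₅.nodup, by simpa using hc₅.eq, by simpa using h21₅, by simpa using h22₅⟩⟩

/-- `c` is a child of `x` found at the vertex `j` and the interval `[a, b]`. -/
def ChildAt (G : IGraph) (σ : ℕ) (x : Nd) (j a b : ℕ) (c : Nd) : Prop :=
  G.Par σ x c ∧ c.j = j ∧ c.a = a ∧ c.b = b

/-- The conditions of `par_of_test` are checked one after the other. A child at `(j, a, b)` would
pass each of them, because the collected list is its `pre`; so the test is exact in both directions.
-/
theorem wp_childTest (hB : Big G σ m w) {D : ℕ} (hD : G.DegBound D) (hE : Env G σ s) {x : Nd}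
    (hx : G.IsNode σ x) (hC : Cur G x.U x.a x.b s) {j a b : ℕ} (h14 : s.reg 14 = j) (hjn : j < G.n)
    (hjx : j ∉ x.U) (h15 : s.reg 15 = a) (h16 : s.reg 16 = b) (haT : a ≤ G.T) (hbT : b ≤ G.T)
    (h11 : s.arr 11 = fun _ => 0) (h12 : s.arr 12 = fun _ => 0) :
    WP m w childTest s fun t s' => t ≤ 800 * D + 70 * (G.deg j + 1) + 200 ∧
      s'.arr 11 = (fun _ => 0) ∧ s'.arr 12 = (fun _ => 0) ∧
      ((s'.reg 27 = 0 ∧ ¬ ∃ c, ChildAt G σ x j a b c) ∨ (s'.reg 27 = 1 ∧ ∃ c,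
        ChildAt G σ x j a b c ∧ (lst (s'.arr 10) (s'.reg 20)).Nodup ∧
        (lst (s'.arr 10) (s'.reg 20)).toFinset = c.U ∧ s'.reg 21 = a ∧ s'.reg 22 = b)) := by
  have hm := hB.m_ge
  have hw := hB.w_ge
  have hxT := hx.closed.tau
  have hxn : ∀ u ∈ x.U, u < G.n := fun u hu => hx.lt hu
  have hxc := card_le hxn
  have hxD : ∑ u ∈ x.U, (G.deg u + 1) ≤ D := IsTau.degBound hD hxT
  have hxa := hxT.left_le
  have hxb := hxT.right_le
  unfold childTest
  rw [wp_seq]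
  refine (wp_genList hB hE hC h14 hjn h15 h16 (by omega) (by omega)).mono ?_
  rintro t₁ s₁ hg₁ ⟨ht₁, hnd, hmem⟩
  set l := lst (s₁.arr 10) (s₁.reg 20) with hl
  have hE₁ : Env G σ s₁ := hE.agree hg₁ rfl
  have hC₁ : Cur G x.U x.a x.b s₁ := hC.agree hg₁ rfl
  have hl20 : s₁.reg 20 = l.length := by simp [hl]
  have hlx : l.toFinset ⊆ x.U := fun z hz => ((hmem z).1 (by simpa using hz)).1
  have hlen : l.length < G.n := by
    have h1 : insert j l.toFinset ⊆ Finset.range G.n := by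
      intro z hz
      rcases Finset.mem_insert.1 hz with rfl | hz
      · simpa using hjn
      · simpa using hxn z (hlx hz)
    have h2 := Finset.card_le_card h1
    rw [Finset.card_insert_of_notMem (fun h => hjx (hlx h)), List.toFinset_card_of_nodup hnd,
      Finset.card_range] at h2
    omega
  have hpre : ∀ c, ChildAt G σ x j a b c → l.toFinset = c.pre := by
    rintro c ⟨hp, rfl, rfl, rfl⟩
    ext z
    rw [hp.mem_pre_iff, List.mem_toFinset, hmem]
  have h3₁ : s₁.reg 3 = σ := hE₁.r3
  have h14₁ : s₁.reg 14 = j := (hg₁.reg 14 rfl).trans h14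
  have h15₁ : s₁.reg 15 = a := (hg₁.reg 15 rfl).trans h15
  have h16₁ : s₁.reg 16 = b := (hg₁.reg 16 rfl).trans h16
  have h11₁ : s₁.arr 11 = fun _ => 0 := (hg₁.arr 11 rfl).trans h11
  have h12₁ : s₁.arr 12 = fun _ => 0 := (hg₁.arr 12 rfl).trans h12
  rw [wp_seq, wp_assign]
  refine ⟨by simp only [Expr.Fits]; omega, ?_⟩
  rw [wp_ite]
  refine ⟨by simp [Expr.Fits]; omega, fun hk => ?_, fun hk => ?_⟩
  swap
  · rw [wp_skip]
    refine ⟨by simp [Expr.cost]; omega, by simpa using h11₁, by simpa using h12₁, Or.inl ⟨rfl, ?_⟩⟩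
    rintro ⟨c, hc⟩
    obtain ⟨u, hu, v, hv, huv⟩ := hc.1.tau.exists_ne
    rw [← hpre c hc] at hu hv
    have : 1 < l.toFinset.card := Finset.one_lt_card.2 ⟨u, hu, v, hv, huv⟩
    rw [List.toFinset_card_of_nodup hnd, ← hl20] at this
    simp [Expr.eval, this] at hk
  have hk' : 1 < l.length := by simpa [Expr.eval, hl20] using hk
  rw [wp_ite]
  refine ⟨by simp [Expr.Fits, Expr.eval, h3₁, h15₁, h16₁]; omega, fun hk2 => ?_, fun hk2 => ?_⟩
  swap
  · rw [wp_skip]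
    refine ⟨by simp [Expr.cost]; omega, by simpa using h11₁, by simpa using h12₁, Or.inl ⟨rfl, ?_⟩⟩
    rintro ⟨c, hc, rfl, rfl, rfl⟩
    have := hc.right.closed.long
    simp [Expr.eval, h3₁, h15₁, h16₁] at hk2
    omega
  -- The nonstrict inequality is tested as `σ + a < b + 2`. The test `a ≤ b` that follows is needed
  -- for `σ = 0`, where the empty interval with `a = b + 1` would pass.
  have hlong : σ + a ≤ b + 1 := by
    simp [Expr.eval, h3₁, h15₁, h16₁] at hk2
    omega
  rw [wp_ite]
  refine ⟨by simp [Expr.Fits, Expr.eval, h15₁, h16₁]; omega, fun hk3 => ?_, fun hk3 => ?_⟩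
  swap
  · rw [wp_skip]
    refine ⟨by simp [Expr.cost]; omega, by simpa using h11₁, by simpa using h12₁, Or.inl ⟨rfl, ?_⟩⟩
    rintro ⟨c, hc, rfl, rfl, rfl⟩
    have := hc.right.closed.le
    simp [Expr.eval, h15₁, h16₁] at hk3
    omega
  have hab : a ≤ b := by
    simp [Expr.eval, h15₁, h16₁] at hk3
    omega
  rw [wp_seq, wp_assign]
  refine ⟨by simp [Expr.Fits, hl20]; omega, ?_⟩
  rw [wp_seq]
  obtain ⟨u, hu, v, hv, huv⟩ : ∃ u ∈ l, ∃ v ∈ l, u ≠ v := by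
    have : 1 < l.toFinset.card := by rwa [List.toFinset_card_of_nodup hnd]
    simpa using Finset.one_lt_card.1 this
  have hjoin : ∀ u ∈ l, ∀ v ∈ l, u ≠ v → ∃ e < G.E, G.Joins e u v := by
    intro u hu v hv huv
    obtain ⟨e, he, hj, -⟩ := hxT.1 u ((hmem u).1 hu).1 v ((hmem v).1 hv).1 huv
    exact ⟨e, he, hj⟩
  refine (wp_closure (l := l) hB hD ((hE₁.setReg 27 _ (by omega)).setReg 29 _ (by omega))
    (by simp [hl]) hnd hjoin ⟨u, hu, v, hv, huv⟩ (by simpa using h11₁)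
    (by simpa using h12₁)).mono ?_
  rintro t₂ s₂ hg₂ ⟨ht₂, a₂, b₂, C₂, hc₂⟩
  have hE₂ : Env G σ s₂ := ((hE₁.setReg 27 _ (by omega)).setReg 29 _ (by omega)).agree hg₂ rfl
  have hC₂ : Cur G x.U x.a x.b s₂ := ((hC₁.setReg (by omega) (by omega) (by omega)).setReg
    (by omega) (by omega) (by omega)).agree hg₂ rfl
  have h14₂ : s₂.reg 14 = j := (hg₂.reg 14 rfl).trans (by simpa using h14₁)
  have h15₂ : s₂.reg 15 = a := (hg₂.reg 15 rfl).trans (by simpa using h15₁)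
  have h16₂ : s₂.reg 16 = b := (hg₂.reg 16 rfl).trans (by simpa using h16₁)
  have h27₂ : s₂.reg 27 = 0 := (hg₂.reg 27 rfl).trans (by simp [Expr.eval])
  have h29₂ : s₂.reg 29 = l.length := (hg₂.reg 29 rfl).trans (by simp [Expr.eval, hl20])
  have h20₂ := hc₂.card
  have h21₂ := hc₂.r21
  have h22₂ := hc₂.r22
  have h10₂ := hC₂.card
  have hr11 := hC₂.r11
  have hr12 := hC₂.r12
  have hCt : G.IsTau C₂ a₂ b₂ := hc₂.cl.tau hc₂.tau
  have hCn : ∀ u ∈ C₂, u < G.n := fun u hu => hCt.lt hu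
  have hCc := card_le hCn
  have ha2 := hCt.left_le
  have hb2 := hCt.right_le
  have huniq : ∀ c, ChildAt G σ x j a b c → a₂ = x.a ∧ b₂ = x.b ∧ C₂ = x.U := by
    intro c hc
    have h1 := hc₂.tau
    have h2 := hc₂.cl
    rw [hpre c hc] at h1 h2
    obtain ⟨rfl, rfl⟩ := h1.unique hc.1.tau
    exact ⟨rfl, rfl, h2.unique hc.1.cl⟩
  have hfail : ∀ (t : ℕ), (¬ ∃ c, ChildAt G σ x j a b c) → t ≤ 740 * D + 70 * (G.deg j + 1) + 200 →
      t ≤ 800 * D + 70 * (G.deg j + 1) + 200 ∧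
      s₂.arr 11 = (fun _ => 0) ∧ s₂.arr 12 = (fun _ => 0) ∧
      ((s₂.reg 27 = 0 ∧ ¬ ∃ c, ChildAt G σ x j a b c) ∨ (s₂.reg 27 = 1 ∧ ∃ c,
        ChildAt G σ x j a b c ∧ (lst (s₂.arr 10) (s₂.reg 20)).Nodup ∧
        (lst (s₂.arr 10) (s₂.reg 20)).toFinset = c.U ∧ s₂.reg 21 = a ∧ s₂.reg 22 = b)) :=
    fun t h ht => ⟨by omega, hc₂.a11, hc₂.a12, Or.inl ⟨h27₂, h⟩⟩
  rw [wp_ite]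
  refine ⟨by simp [Expr.Fits]; omega, fun hk4 => ?_, fun hk4 => ?_⟩
  swap
  · rw [wp_skip]
    refine hfail _ ?_ (by simp [Expr.cost]; omega)
    rintro ⟨c, hc⟩
    simp [Expr.eval, h20₂, h10₂, (huniq c hc).2.2] at hk4
  rw [wp_ite]
  refine ⟨by simp [Expr.Fits]; omega, fun hk5 => ?_, fun hk5 => ?_⟩
  swap
  · rw [wp_skip]
    refine hfail _ ?_ (by simp [Expr.cost]; omega)
    rintro ⟨c, hc⟩
    simp [Expr.eval, h21₂, hr11, (huniq c hc).1] at hk5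
  rw [wp_ite]
  refine ⟨by simp [Expr.Fits]; omega, fun hk6 => ?_, fun hk6 => ?_⟩
  swap
  · rw [wp_skip]
    refine hfail _ ?_ (by simp [Expr.cost]; omega)
    rintro ⟨c, hc⟩
    simp [Expr.eval, h22₂, hr12, (huniq c hc).2.1] at hk6
  rw [wp_seq]
  refine (wp_subTest hB hE₂ hC₂ hc₂.nodup hc₂.eq hCn (IsTau.degBound hD hCt)).mono ?_
  rintro t₃ s₃ hg₃ ⟨ht₃, hsub, h27₃⟩
  have hE₃ : Env G σ s₃ := hE₂.agree hg₃ rfl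
  have h14₃ : s₃.reg 14 = j := (hg₃.reg 14 rfl).trans h14₂
  have h15₃ : s₃.reg 15 = a := (hg₃.reg 15 rfl).trans h15₂
  have h16₃ : s₃.reg 16 = b := (hg₃.reg 16 rfl).trans h16₂
  have h29₃ : s₃.reg 29 = l.length := (hg₃.reg 29 rfl).trans h29₂
  have h10₃ : s₃.arr 10 = s₂.arr 10 := hg₃.arr 10 rfl
  have h11₃ : s₃.arr 11 = fun _ => 0 := (hg₃.arr 11 rfl).trans hc₂.a11
  have h12₃ : s₃.arr 12 = fun _ => 0 := (hg₃.arr 12 rfl).trans hc₂.a12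
  rw [wp_ite]
  refine ⟨by simp [Expr.Fits]; omega, fun hk7 => ?_, fun hk7 => ?_⟩
  swap
  · rw [wp_skip]
    have hk7 : s₃.reg 27 = 0 := hk7
    refine ⟨by simp [Expr.cost]; omega, h11₃, h12₃, Or.inl ⟨hk7, ?_⟩⟩
    rintro ⟨c, hc⟩
    have := hsub.2 (huniq c hc).2.2.subset
    omega
  have hk7 : s₃.reg 27 ≠ 0 := hk7
  -- The completion is contained in the current clique and has the same number of members.
  have hCx : C₂ = x.U := by
    refine Finset.eq_of_subset_of_card_le (hsub.1 (by omega)) ?_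
    simp [Expr.eval, h20₂, h10₂] at hk4
    exact hk4.ge
  have hax : a₂ = x.a := by
    simpa [Expr.eval, h21₂, hr11] using hk5
  have hbx : b₂ = x.b := by
    simpa [Expr.eval, h22₂, hr12] using hk6
  subst hCx hax hbx
  have hjl : j ∉ l := fun h => hjx (hlx (by simpa using h))
  -- The completion only appends, so `l` is still the beginning of array `10` and `j` can be put
  -- directly behind it.
  have hpf : lst (s₃.arr 10) l.length = l := by
    obtain ⟨ext, hext⟩ := hc₂.pre
    have h1 : l.length ≤ s₂.reg 20 := by
      have := congrArg List.length hext
      simp at this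
      omega
    have h2 := congrArg (List.take l.length) hext
    rwa [lst, ← List.map_take, List.take_range, min_eq_left h1, List.take_left' rfl, ← h10₃] at h2
  refine (wp_extTest hB hD hE₃ h14₃ h15₃ h16₃ h29₃ hpf hnd hjl hjoin ⟨u, hu, v, hv, huv⟩
    (fun z hz => ?_) hlen hjn haT hbT h11₃ h12₃).mono ?_
  · obtain ⟨e, he, hj, -⟩ := ((hmem z).1 hz).2.2
    exact ⟨e, he, hj⟩
  rintro t₅ s₅ - ⟨ht₅, h11₅, h12₅, h⟩
  refine ⟨by simp only [Expr.cost]; omega, h11₅, h12₅, h.imp ?_ ?_⟩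
  · rintro ⟨h27, h⟩
    refine ⟨h27, ?_⟩
    rintro ⟨c, hc⟩
    have hgen := hc.1.right.gen
    have hf := filter_le_eq hgen.1
    have hp := hpre c hc
    obtain ⟨-, rfl, rfl, rfl⟩ := hc
    -- A child is itself a witness: its generators are `c.j` and `c.pre`, and by definition of the
    -- prefix all further members exceed `c.j`.
    refine h ⟨c.U, ?_⟩
    rw [Gen, hf, ← hp] at hgen
    refine ⟨hgen.2.1, hgen.2.2, fun z hz hzl => ?_⟩
    by_contra hle
    refine hzl ?_
    rw [hp, ← hf, Finset.mem_filter]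
    exact ⟨hz, by omega⟩
  · rintro ⟨h27, C, ⟨h1, h2, h3⟩, h4⟩
    exact ⟨h27, ⟨C, a, b, j⟩, ⟨par_of_test hx hjx (fun y hy => ((hmem y).1 (by simpa using hy)).2.1)
      hc₂.tau hc₂.cl h1 h2 h3 hab hlong, rfl, rfl, rfl⟩, h4⟩

end

end RAM

/-! ## The steps of the search -/

namespace IGraph

variable (G : IGraph)

/-- The number of neighbours of `z` in `U`. -/
def cross (U : Finset ℕ) (z : ℕ) : ℕ := (G.adjL z).countP fun h => G.tgt h ∈ U

/-- The possible last generators after `j`, each weighted with the number of its edges to `U`, which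
bounds the number of its candidate starts and also of its candidate ends. -/
def potJ (U : Finset ℕ) (j : ℕ) : ℕ :=
  ∑ z ∈ Finset.range G.n, if z ∉ U ∧ j < z then G.cross U z else 0

/-- Half-edges are counted instead of distinct values; an upper bound is all that is needed. -/
def potA (x : Nd) (j a : ℕ) : ℕ :=
  (G.adjL j).countP fun h => G.tgt h ∈ x.U ∧ a < max x.a (G.st (eid h))

def potB (x : Nd) (j b : ℕ) : ℕ :=
  (G.adjL j).countP fun h => G.tgt h ∈ x.U ∧ b < min x.b (G.en (eid h))

/-- A bound for the number of steps of the search for the children of `x` after `(j, a, b)`, where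
`d` bounds the degrees. -/
def pot (d : ℕ) (x : Nd) (j a b : ℕ) : ℕ :=
  (d + 2) * G.potJ x.U j + (d + 1) * G.potA x j a + G.potB x j b

/-- The triple of `c` comes after `(j, a, b)` in the lexicographic order. -/
def After (j a b : ℕ) (c : Nd) : Prop :=
  j < c.j ∨ (j = c.j ∧ (a < c.a ∨ (a = c.a ∧ b < c.b)))

variable {G}

theorem countP_succ_le {L : List ℕ} {p q : ℕ → Bool} (h : ∀ x ∈ L, q x → p x)
    (h' : ∃ x ∈ L, p x ∧ ¬ q x) : L.countP q + 1 ≤ L.countP p := by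
  obtain ⟨x, hx, hp, hq⟩ := h'
  induction L with
  | nil => simp at hx
  | cons y L ih =>
    rw [List.countP_cons, List.countP_cons]
    have hm : L.countP q ≤ L.countP p :=
      List.countP_mono_left fun z hz => h z (List.mem_cons_of_mem _ hz)
    rcases List.mem_cons.1 hx with rfl | hx
    · simp only [hp, hq]
      simpa using hm
    · have := ih (fun z hz => h z (List.mem_cons_of_mem _ hz)) hx
      have hy := h y (by simp)
      by_cases hqy : q y <;> by_cases hpy : p y <;> simp_all

theorem exists_half_symm {v h : ℕ} (hh : h ∈ G.adjL v) : ∃ g ∈ G.adjL (G.tgt h), G.tgt g = v := by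
  obtain ⟨-, -, he, hj⟩ := mem_adjL hh
  obtain ⟨g, hg, -, ht⟩ := exists_half he hj.symm
  exact ⟨g, hg, ht⟩

/-- Double counting of the edges between `U` and all vertices. -/
theorem sum_cross_le (U : Finset ℕ) :
    ∑ z ∈ Finset.range G.n, G.cross U z ≤ ∑ u ∈ U, G.deg u := by
  classical
  have h1 : ∀ z, G.cross U z ≤ (U.filter fun u => ∃ h ∈ G.adjL z, G.tgt h = u).card := by
    intro z
    rw [cross, List.countP_eq_length_filter, ← List.length_map (f := G.tgt),
      ← List.toFinset_card_of_nodup]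
    · refine Finset.card_le_card fun u hu => ?_
      simp only [List.mem_toFinset, List.mem_map, List.mem_filter, decide_eq_true_eq] at hu
      obtain ⟨h, ⟨hh, hU⟩, rfl⟩ := hu
      exact Finset.mem_filter.2 ⟨hU, h, hh, rfl⟩
    · refine List.Nodup.map_on ?_ ((nodup_adjL z).filter _)
      intro g hg h hh
      exact tgt_inj (List.mem_of_mem_filter hg) (List.mem_of_mem_filter hh)
  have h2 : ∀ u, ((Finset.range G.n).filter fun z => ∃ h ∈ G.adjL z, G.tgt h = u).card ≤
      G.deg u := by
    intro u
    rw [deg, ← List.length_map (f := G.tgt)]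
    refine le_trans (Finset.card_le_card fun z hz => ?_) (List.toFinset_card_le _)
    obtain ⟨-, h, hh, rfl⟩ := Finset.mem_filter.1 hz
    obtain ⟨g, hg, rfl⟩ := exists_half_symm hh
    simp only [List.mem_toFinset, List.mem_map]
    exact ⟨g, hg, rfl⟩
  calc _ ≤ ∑ z ∈ Finset.range G.n, (U.filter fun u => ∃ h ∈ G.adjL z, G.tgt h = u).card :=
        Finset.sum_le_sum fun z _ => h1 z
    _ = ∑ u ∈ U, ((Finset.range G.n).filter fun z => ∃ h ∈ G.adjL z, G.tgt h = u).card :=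
        Finset.sum_card_bipartiteAbove_eq_sum_card_bipartiteBelow
          (fun z u => ∃ h ∈ G.adjL z, G.tgt h = u)
    _ ≤ _ := Finset.sum_le_sum fun u _ => h2 u

theorem potJ_le (U : Finset ℕ) (j : ℕ) : G.potJ U j ≤ ∑ u ∈ U, (G.deg u + 1) := by
  refine le_trans (Finset.sum_le_sum fun z _ => ?_) ((sum_cross_le (G := G) U).trans
    (Finset.sum_le_sum fun u _ => Nat.le_succ _))
  split_ifs <;> simp

/-- No cut start or end lies beyond `T`, so at the pointer `(j, T, T)` only the later vertices
contribute. -/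
theorem pot_start {d : ℕ} {x : Nd} (ht : G.IsTau x.U x.a x.b) (j : ℕ) :
    G.pot d x j G.T G.T ≤ (d + 2) * ∑ u ∈ x.U, (G.deg u + 1) := by
  have hA : G.potA x j G.T = 0 := by
    rw [potA, List.countP_eq_zero]
    intro h hh
    obtain ⟨-, -, he, -⟩ := mem_adjL hh
    have h1 := G.st_le _ he
    have h2 := G.en_le _ he
    have h3 := ht.left_le
    simp
    omega
  have hB : G.potB x j G.T = 0 := by
    rw [potB, List.countP_eq_zero]
    intro h hh
    have h3 := ht.right_le
    simp
    omega
  rw [pot, hA, hB]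
  have := Nat.mul_le_mul_left (d + 2) (potJ_le (G := G) x.U j)
  omega

/-- The half-edge `h` that attains `v` is counted before the move but not after it. -/
theorem pot_lt_right {d : ℕ} {x : Nd} {j a b v h : ℕ} (hh : h ∈ G.adjL j) (hU : G.tgt h ∈ x.U)
    (hv : min x.b (G.en (eid h)) = v) (hb : b < v) : G.pot d x j a v < G.pot d x j a b := by
  have : G.potB x j v + 1 ≤ G.potB x j b := by
    refine countP_succ_le ?_ ⟨h, hh, ?_, ?_⟩
    · simp only [decide_eq_true_eq]
      exact fun g _ hg => ⟨hg.1, by omega⟩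
    · simp only [decide_eq_true_eq]
      exact ⟨hU, by omega⟩
    · simp only [decide_eq_true_eq]
      omega
  rw [pot, pot]
  omega

/-- A new start resets the end, and the end potential can grow back to at most `deg j ≤ d`. The
weight `d + 1` of the start potential outweighs this. -/
theorem pot_lt_left {d : ℕ} {x : Nd} {j a b c v h : ℕ} (hd : G.deg j ≤ d) (hh : h ∈ G.adjL j)
    (hU : G.tgt h ∈ x.U) (hv : max x.a (G.st (eid h)) = v) (ha : a < v) :
    G.pot d x j v c < G.pot d x j a b := by
  have : G.potA x j v + 1 ≤ G.potA x j a := by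
    refine countP_succ_le ?_ ⟨h, hh, ?_, ?_⟩
    · simp only [decide_eq_true_eq]
      exact fun g _ hg => ⟨hg.1, by omega⟩
    · simp only [decide_eq_true_eq]
      exact ⟨hU, by omega⟩
    · simp only [decide_eq_true_eq]
      omega
  have h2 : G.potB x j c ≤ G.deg j := List.countP_le_length
  have h3 := Nat.mul_le_mul_left (d + 1) this
  rw [Nat.mul_add] at h3
  rw [pot, pot]
  omega

/-- The move to `v` releases `cross U v` with weight `d + 2`. The start potential takes back at most
`cross U v` with weight `d + 1`, and the end potential is zero since the new end is `T`. As `v` has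
a neighbour in `x.U`, the difference is positive. -/
theorem pot_lt_next {d : ℕ} {x : Nd} {j a b v p h : ℕ} (hb : x.b ≤ G.T) (hp : p ∈ x.U)
    (hh : h ∈ G.adjL p) (ht : G.tgt h = v) (hv : v ∉ x.U) (hj : j < v) :
    G.pot d x v 0 G.T < G.pot d x j a b := by
  have hB : G.potB x v G.T = 0 := by
    rw [potB, List.countP_eq_zero]
    intro h hh
    simp
    omega
  have hA : G.potA x v 0 ≤ G.cross x.U v := by
    refine List.countP_mono_left ?_
    simp only [decide_eq_true_eq]
    exact fun g _ hg => hg.1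
  have hpos : 0 < G.cross x.U v := by
    obtain ⟨g, hg, hgt⟩ := exists_half_symm hh
    rw [ht] at hg
    exact List.countP_pos_iff.2 ⟨g, hg, by simpa [hgt] using hp⟩
  have hvn : v < G.n := ht ▸ tgt_lt hh
  have hJ : G.potJ x.U v + G.cross x.U v ≤ G.potJ x.U j := by
    rw [potJ, potJ, ← Finset.sum_erase_add _ _ (Finset.mem_range.2 hvn),
      ← Finset.sum_erase_add (Finset.range G.n) _ (Finset.mem_range.2 hvn)]
    simp only [lt_irrefl, and_false, if_false, add_zero, hv, hj, not_false_eq_true, and_self,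
      if_true]
    refine Nat.add_le_add_right (Finset.sum_le_sum fun z _ => ?_) _
    by_cases h1 : z ∉ x.U ∧ v < z
    · rw [if_pos h1, if_pos ⟨h1.1, by omega⟩]
    · rw [if_neg h1]
      exact Nat.zero_le _
  rw [pot, pot, hB]
  have h1 := Nat.mul_le_mul_left (d + 2) hJ
  have h2 := Nat.mul_le_mul_left (d + 1) hA
  have h3 : (d + 2) * G.cross x.U v = (d + 1) * G.cross x.U v + G.cross x.U v := by ring
  rw [Nat.mul_add] at h1
  omega

/-! ### The order of the children -/

variable {σ : ℕ} {x c : Nd} {j a b v : ℕ}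

theorem Par.right_half (h : G.Par σ x c) :
    ∃ g ∈ G.adjL c.j, G.tgt g ∈ x.U ∧ G.tgt g < c.j ∧ min x.b (G.en (eid g)) = c.b := by
  obtain ⟨e, he, p, hp, hlt, hj, hv⟩ := h.right_candidate
  obtain ⟨g, hg, rfl, rfl⟩ := exists_half he hj
  exact ⟨g, hg, hp, hlt, hv⟩

theorem Par.left_half (h : G.Par σ x c) :
    ∃ g ∈ G.adjL c.j, G.tgt g ∈ x.U ∧ G.tgt g < c.j ∧ max x.a (G.st (eid g)) = c.a := by
  obtain ⟨e, he, p, hp, hlt, hj, hv⟩ := h.left_candidate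
  obtain ⟨g, hg, rfl, rfl⟩ := exists_half he hj
  exact ⟨g, hg, hp, hlt, hv⟩

end IGraph

/-! ### The moves of the search: advance, descend, backtrack. -/

namespace RAM

open IGraph

/-- Go to the child in array `10` and write it. -/
def descend : Prog :=
  .write 13 (.reg 14) (.add (.reg 13) (.const 1)) ;; .assign 13 (.reg 14) ;; load ;; output ;;
    .assign 15 (.reg 2) ;; .assign 16 (.reg 2)

/-- Return to the parent, or stop at a root. -/
def backtrack : Prog :=
  .ite (.read 13 (.reg 13))
    (.assign 14 (.reg 13) ;; .assign 15 (.reg 11) ;; .assign 16 (.reg 12) ;; preList ;; closure ;;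
      load ;; .assign 13 (.sub (.read 13 (.reg 13)) (.const 1)))
    (.assign 28 (.const 0))

/-- Advance the pointer in registers `14`, `15` and `16`. -/
def step : Prog :=
  valScan 16 eMin ;; .ite (.lt (.reg 25) (.add (.reg 2) (.const 1)))
    (.assign 16 (.reg 25) ;; childTest ;; .ite (.reg 27) descend .skip)
    (valScan 15 eMax ;; .ite (.lt (.reg 25) (.add (.reg 2) (.const 1)))
      (.assign 15 (.reg 25) ;; .assign 16 (.const 0))
      (nbrScan ;; .ite (.lt (.reg 25) (.reg 0))
        (.assign 14 (.reg 25) ;; .assign 15 (.const 0) ;; .assign 16 (.reg 2)) backtrack))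

/-- The current clique is `U`, and the work space is clean. -/
structure Base (G : IGraph) (σ : ℕ) (U : Finset ℕ) (a b : ℕ) (s : State) : Prop where
  env : Env G σ s
  clique : Cur G U a b s
  a11 : s.arr 11 = fun _ => 0
  a12 : s.arr 12 = fun _ => 0
  cur : s.cur = []

/-- The search is at the closed clique `x`. -/
structure At (G : IGraph) (σ : ℕ) (x : Nd) (s : State) : Prop where
  base : Base G σ x.U x.a x.b s
  r13 : s.reg 13 = x.j
  r28 : s.reg 28 = 1

/-- The pointer of the search at `x` is `(j, a, b)`. -/
structure Ptr (G : IGraph) (x : Nd) (j a b : ℕ) (s : State) : Prop where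
  r14 : s.reg 14 = j
  r15 : s.reg 15 = a
  r16 : s.reg 16 = b
  j_lt : j < G.n
  a_le : a ≤ G.T
  b_le : b ≤ G.T
  out : j ∉ x.U ∨ (a = G.T ∧ b = G.T)

section

variable {G : IGraph} {σ m w : ℕ} {s : State}

theorem Base.agree {U : Finset ℕ} {a b : ℕ} {p : Prog} {s' : State} (h : Base G σ U a b s)
    (ha : Agree p s s') (hp : (!p.static || p.emits || p.writesReg 10 || p.writesReg 11 ||
      p.writesReg 12 || p.writesArr 8 || p.writesArr 9 || p.writesArr 11 || p.writesArr 12)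
      = false) : Base G σ U a b s' := by
  simp only [Bool.or_eq_false_iff, Bool.not_eq_false'] at hp
  obtain ⟨⟨⟨⟨⟨⟨⟨⟨h0, h1⟩, h2⟩, h3⟩, h4⟩, h5⟩, h6⟩, h7⟩, h8⟩ := hp
  refine ⟨h.env.agree ha h0, h.clique.agree ha ?_, ?_, ?_, ?_⟩
  · simp only [h2, h3, h4, h5, h6, Bool.or_self]
  · rw [ha.arr 11 h7, h.a11]
  · rw [ha.arr 12 h8, h.a12]
  · rw [ha.cur h1, h.cur]

theorem Base.setReg {U : Finset ℕ} {a b : ℕ} (h : Base G σ U a b s) (x v : ℕ)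
    (hx : 13 ≤ x) : Base G σ U a b (s.setReg x v) :=
  ⟨h.env.setReg x v (by omega), h.clique.setReg (by omega) (by omega) (by omega),
    by simpa using h.a11, by simpa using h.a12, by simpa using h.cur⟩

theorem DegBound.deg_lt {D : ℕ} (hD : G.DegBound D) {j : ℕ} (hj : j < G.n) : G.deg j + 1 ≤ D := by
  have := hD {j} (by simpa using hj) (by simp)
  simpa using this

/-- Array `13` takes the place of a stack. Its cell at the last generator of `c` receives the last
generator of the parent plus one, while `0` marks a root. Last generators increase along a path, so
no entry of an ancestor is overwritten. -/
theorem wp_descend (hB : Big G σ m w) {D : ℕ} (hD : G.DegBound D) {x c : Nd} (hx : G.Par σ x c)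
    (hE : Env G σ s) (hC : Cur G x.U x.a x.b s) (h13 : s.reg 13 = x.j) (h14 : s.reg 14 = c.j)
    (h28 : s.reg 28 = 1) (h11 : s.arr 11 = fun _ => 0) (h12 : s.arr 12 = fun _ => 0)
    (hcur : s.cur = []) (hnd : (lst (s.arr 10) (s.reg 20)).Nodup)
    (hc : (lst (s.arr 10) (s.reg 20)).toFinset = c.U) (h21 : s.reg 21 = c.a)
    (h22 : s.reg 22 = c.b) :
    WP m w descend s fun t s' => t ≤ 140 * D + 80 ∧ At G σ c s' ∧ Ptr G c c.j G.T G.T s' ∧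
      s'.arr 13 = Function.update (s.arr 13) c.j (x.j + 1) ∧
      ∃ r, s'.out = s.out ++ [r] ∧ Lists G c.U r := by
  have hm := hB.m_ge
  have hw := hB.w_ge
  have hjx := hx.left.j_lt
  have hjc := hx.right.j_lt
  have hxt := hx.left.closed.tau
  have hct := hx.right.closed.tau
  have ha := hct.left_le
  have hb := hct.right_le
  unfold descend
  rw [wp_seq, wp_write]
  refine ⟨by simp only [Expr.Fits]; omega, by simp only [Expr.eval]; omega,
    by simp only [Expr.Fits, Expr.eval]; omega, ?_⟩
  rw [wp_seq, wp_assign]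
  refine ⟨by simp [Expr.Fits]; omega, ?_⟩
  simp only [Expr.eval, State.setCell_reg, h13, h14]
  have hE₁ : Env G σ ((s.setCell 13 c.j (x.j + 1)).setReg 13 c.j) :=
    (hE.setCell 13 _ _ (by omega)).setReg 13 _ (by omega)
  have hC₁ : Cur G x.U x.a x.b ((s.setCell 13 c.j (x.j + 1)).setReg 13 c.j) := by
    refine Cur.setReg ⟨?_, ?_, ?_, ?_, ?_⟩ (by omega) (by omega) (by omega)
    · simpa using hC.nodup
    · simpa using hC.eq
    · simpa using hC.r11
    · simpa using hC.r12
    · simpa using hC.mark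
  rw [wp_seq]
  refine (wp_load hB hE₁ hC₁ (fun u hu => hxt.lt hu) (IsTau.degBound hD hxt) (by simpa using hnd)
    (by simpa using hc) (fun u hu => hct.lt hu) (IsTau.degBound hD hct) (by simpa using h21)
    (by simpa using h22) (by omega) (by omega)).mono ?_
  rintro t₂ s₂ hg₂ ⟨ht₂, hC₂⟩
  have hE₂ : Env G σ s₂ := hE₁.agree hg₂ rfl
  rw [wp_seq]
  refine (wp_output hB hE₂ hC₂ (fun u hu => hct.lt hu) (IsTau.degBound hD hct)
    ((hg₂.cur rfl).trans (by simpa using hcur))).mono ?_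
  rintro t₃ s₃ hg₃ ⟨ht₃, hcur₃, r, hr, hL⟩
  have hE₃ : Env G σ s₃ := hE₂.agree hg₃ rfl
  rw [wp_seq, wp_assign]
  refine ⟨by simp [Expr.Fits, hE₃.r2]; omega, ?_⟩
  rw [wp_assign]
  refine ⟨by simp [Expr.Fits, hE₃.r2]; omega, ?_⟩
  refine ⟨by simp only [Expr.cost]; omega, ⟨⟨(hE₃.setReg 15 _ (by omega)).setReg 16 _ (by omega),
    ((hC₂.agree hg₃ rfl).setReg (by omega) (by omega) (by omega)).setReg (by omega) (by omega)
      (by omega), ?_, ?_, by simpa using hcur₃⟩, ?_, ?_⟩,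
    ⟨?_, by simp [Expr.eval, hE₃.r2], by simp [Expr.eval, hE₃.r2], hjc, le_rfl, le_rfl,
      Or.inr ⟨rfl, rfl⟩⟩, ?_, r, ?_, hL⟩
  · simpa [hg₃.arr 11 rfl, hg₂.arr 11 rfl] using h11
  · simpa [hg₃.arr 12 rfl, hg₂.arr 12 rfl] using h12
  · simp [hg₃.reg 13 rfl, hg₂.reg 13 rfl]
  · simpa [hg₃.reg 28 rfl, hg₂.reg 28 rfl] using h28
  · simpa [hg₃.reg 14 rfl, hg₂.reg 14 rfl] using h14
  · simp [hg₃.arr 13 rfl, hg₂.arr 13 rfl]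
  · simp [hr, hg₂.out rfl]

/-- The search has left `x`: it stopped or is at the parent of `x`. -/
def Left (G : IGraph) (σ : ℕ) (x : Nd) (k : ℕ) (s : State) : Prop :=
  (k = 0 ∧ Base G σ x.U x.a x.b s ∧ s.reg 28 = 0) ∨
    ∃ p, G.Par σ p x ∧ k = p.j + 1 ∧ At G σ p s ∧ Ptr G p x.j x.a x.b s

/-- The parent is recomputed as the completion of the members before `x.j`, and only its last
generator is read from memory. The pointer becomes the triple of `x`, so that the search at the
parent continues behind this child. -/
theorem wp_backtrack (hB : Big G σ m w) {D : ℕ} (hD : G.DegBound D) {x : Nd} (hx : G.IsNode σ x)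
    (hA : At G σ x s) (hs : s.arr 13 x.j = 0 ∨ ∃ p, G.Par σ p x ∧ s.arr 13 x.j = p.j + 1) :
    WP m w backtrack s fun t s' => t ≤ 420 * D + 80 ∧ s'.out = s.out ∧ s'.arr 13 = s.arr 13 ∧
      Left G σ x (s.arr 13 x.j) s' := by
  have hm := hB.m_ge
  have hw := hB.w_ge
  have hjx := hx.j_lt
  have hxt := hx.closed.tau
  have ha := hxt.left_le
  have hb := hxt.right_le
  have h13 := hA.r13
  have hC := hA.base.clique
  have hr11 := hC.r11
  have hr12 := hC.r12
  have hfit : s.arr 13 x.j < w := by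
    rcases hs with h | ⟨p, hp, h⟩
    · omega
    · have := hp.left.j_lt
      omega
  unfold backtrack
  rw [wp_ite]
  refine ⟨by simp only [Expr.Fits, Expr.eval, h13]; omega, fun hk => ?_, fun hk => ?_⟩
  swap
  · simp only [Expr.eval, h13] at hk
    rw [wp_assign]
    exact ⟨by simp only [Expr.Fits]; omega, by simp only [Expr.cost]; omega, rfl, rfl,
      Or.inl ⟨hk, hA.base.setReg _ _ (by omega), by simp [Expr.eval]⟩⟩
  · simp only [Expr.eval, h13] at hk
    obtain ⟨p, hp, hpj⟩ := hs.resolve_left hk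
    have hpt := hp.left.closed.tau
    have hpa := hpt.left_le
    have hpb := hpt.right_le
    have hpn := hp.left.j_lt
    rw [wp_seq, wp_assign]
    refine ⟨by simp only [Expr.Fits]; omega, ?_⟩
    rw [wp_seq, wp_assign]
    refine ⟨by simp [Expr.Fits]; omega, ?_⟩
    rw [wp_seq, wp_assign]
    refine ⟨by simp [Expr.Fits]; omega, ?_⟩
    simp only [Expr.eval, State.setReg_reg, Nat.reduceEqDiff, if_false, h13, hr11, hr12]
    have hB₁ := ((hA.base.setReg 14 x.j (by omega)).setReg 15 x.a (by omega)).setReg 16 x.b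
      (by omega)
    rw [wp_seq]
    refine (wp_preList hB hB₁.env hB₁.clique (fun u hu => hxt.lt hu) (IsTau.degBound hD hxt)
      (by simpa using h13) hjx).mono ?_
    rintro t₂ s₂ hg₂ ⟨ht₂, hnd, hl⟩
    have hE₂ : Env G σ s₂ := hB₁.env.agree hg₂ rfl
    have hC₂ : Cur G x.U x.a x.b s₂ := hB₁.clique.agree hg₂ rfl
    have hmem : ∀ z, z ∈ lst (s₂.arr 10) (s₂.reg 20) ↔ z ∈ x.pre := fun z => by
      rw [← List.mem_toFinset, hl]; rfl
    rw [wp_seq]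
    refine (wp_closure hB hD hE₂ rfl hnd ?_ ?_ ((hg₂.arr 11 rfl).trans hB₁.a11)
      ((hg₂.arr 12 rfl).trans hB₁.a12)).mono ?_
    · intro u hu v hv huv
      obtain ⟨e, he, hj, -⟩ := hp.tau.1 u ((hmem u).1 hu) v ((hmem v).1 hv) huv
      exact ⟨e, he, hj⟩
    · obtain ⟨u, hu, v, hv, huv⟩ := hp.tau.exists_ne
      exact ⟨u, (hmem u).2 hu, v, (hmem v).2 hv, huv⟩
    rintro t₃ s₃ hg₃ ⟨ht₃, a, b, C, hc⟩
    have hE₃ : Env G σ s₃ := hE₂.agree hg₃ rfl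
    have h1 := hc.tau
    have h2 := hc.cl
    rw [hl] at h1 h2
    obtain ⟨rfl, rfl⟩ := h1.unique hp.tau
    obtain rfl := h2.unique hp.cl
    rw [wp_seq]
    refine (wp_load hB hE₃ (hC₂.agree hg₃ rfl) (fun u hu => hxt.lt hu) (IsTau.degBound hD hxt)
      hc.nodup hc.eq (fun u hu => hpt.lt hu) (IsTau.degBound hD hpt) hc.r21 hc.r22 (by omega)
      (by omega)).mono ?_
    rintro t₄ s₄ hg₄ ⟨ht₄, hC₄⟩
    have hE₄ : Env G σ s₄ := hE₃.agree hg₄ rfl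
    have h13₄ : s₄.arr 13 = s.arr 13 := by
      simp [hg₄.arr 13 rfl, hg₃.arr 13 rfl, hg₂.arr 13 rfl]
    have hr13 : s₄.reg 13 = x.j := by
      simpa [hg₄.reg 13 rfl, hg₃.reg 13 rfl, hg₂.reg 13 rfl] using h13
    rw [wp_assign]
    refine ⟨by simp only [Expr.Fits, Expr.eval, hr13, h13₄]; omega,
      by simp only [Expr.cost]; omega, ?_, by simpa using h13₄, Or.inr ⟨p, hp, hpj,
      ⟨⟨hE₄.setReg 13 _ (by omega), hC₄.setReg (by omega) (by omega) (by omega), ?_, ?_, ?_⟩, ?_, ?_⟩,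
      ⟨?_, ?_, ?_, hjx, ha, hb, Or.inl hp.j_notMem⟩⟩⟩
    · simp [hg₄.out rfl, hg₃.out rfl, hg₂.out rfl]
    · simpa [hg₄.arr 11 rfl] using hc.a11
    · simpa [hg₄.arr 12 rfl] using hc.a12
    · simpa [hg₄.cur rfl, hg₃.cur rfl, hg₂.cur rfl] using hA.base.cur
    · simp [Expr.eval, hr13, h13₄, hpj]
    · simpa [hg₄.reg 28 rfl, hg₃.reg 28 rfl, hg₂.reg 28 rfl] using hA.r28
    · simp [hg₄.reg 14 rfl, hg₃.reg 14 rfl, hg₂.reg 14 rfl]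
    · simp [hg₄.reg 15 rfl, hg₃.reg 15 rfl, hg₂.reg 15 rfl]
    · simp [hg₄.reg 16 rfl, hg₃.reg 16 rfl, hg₂.reg 16 rfl]

end

end RAM

/-! ### Correctness and cost of the search. -/

namespace RAM

open IGraph

section

variable {G : IGraph} {σ m w : ℕ} {s : State}

/-- The possible results of a step of the search at `x` from the pointer `(j, a, b)`. -/
inductive Stepped (G : IGraph) (σ d : ℕ) (x : Nd) (j a b : ℕ) (s s' : State) : Prop where
  | advance (j' a' b' : ℕ) (hA : At G σ x s') (hP : Ptr G x j' a' b' s')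
      (hpot : G.pot d x j' a' b' < G.pot d x j a b) (hout : s'.out = s.out)
      (h13 : s'.arr 13 = s.arr 13)
      (hafter : ∀ c, G.Par σ x c → (After j a b c ↔ After j' a' b' c)) :
      Stepped G σ d x j a b s s'
  | child (c : Nd) (r : List ℕ) (hc : G.Par σ x c) (hA : At G σ c s') (hP : Ptr G c c.j G.T G.T s')
      (hpot : G.pot d x c.j c.a c.b < G.pot d x j a b) (hr : Lists G c.U r)
      (hout : s'.out = s.out ++ [r])
      (h13 : s'.arr 13 = Function.update (s.arr 13) c.j (x.j + 1))
      (hafter : ∀ c', G.Par σ x c' → (After j a b c' ↔ c' = c ∨ After c.j c.a c.b c')) :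
      Stepped G σ d x j a b s s'
  | leave (hL : Left G σ x (s.arr 13 x.j) s') (hout : s'.out = s.out) (h13 : s'.arr 13 = s.arr 13)
      (hafter : ∀ c, G.Par σ x c → ¬ After j a b c) : Stepped G σ d x j a b s s'

/-- The pointer moves to the next end, failing that to the next start with the end reset to `0`,
failing that to the next vertex with start `0` and end `T`; if there is none, `x` is left. The
triples of all children consist of scanned values, so no child is passed over. -/
theorem wp_step (hB : Big G σ m w) {D d : ℕ} (hD : G.DegBound D) (hd : ∀ v < G.n, G.deg v ≤ d)
    {x : Nd} (hx : G.IsNode σ x) (hA : At G σ x s) {j a b : ℕ} (hP : Ptr G x j a b s)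
    (hs : s.arr 13 x.j = 0 ∨ ∃ p, G.Par σ p x ∧ s.arr 13 x.j = p.j + 1) :
    WP m w step s fun t s' => t ≤ 1200 * D + 500 ∧ Stepped G σ d x j a b s s' := by
  have hm := hB.m_ge
  have hw := hB.w_ge
  have hxt := hx.closed.tau
  have hxa := hxt.left_le
  have hxb := hxt.right_le
  have hjn := hP.j_lt
  have haT := hP.a_le
  have hbT := hP.b_le
  have hjD := DegBound.deg_lt hD hjn
  unfold step
  rw [wp_seq]
  refine (wp_valScan hB hA.base.env (f := fun h => min x.b (G.en (eid h))) hA.base.clique hP.r14 hjn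
    hP.r16 (by decide) (by decide) (by decide) (by omega) (by decide) (eMin_spec hB hxb)).mono ?_
  rintro t₁ s₁ hg₁ ⟨ht₁, hn₁⟩
  have hB₁ : Base G σ x.U x.a x.b s₁ := hA.base.agree hg₁ rfl
  have hle₁ := hn₁.le
  have h14₁ : s₁.reg 14 = j := (hg₁.reg 14 rfl).trans hP.r14
  have h15₁ : s₁.reg 15 = a := (hg₁.reg 15 rfl).trans hP.r15
  have h13₁ : s₁.reg 13 = x.j := (hg₁.reg 13 rfl).trans hA.r13
  have h28₁ : s₁.reg 28 = 1 := (hg₁.reg 28 rfl).trans hA.r28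
  have hs13₁ : s₁.arr 13 = s.arr 13 := hg₁.arr 13 rfl
  have ho₁ : s₁.out = s.out := hg₁.out rfl
  rw [wp_ite]
  refine ⟨by simp only [Expr.Fits, Expr.eval, hB₁.env.r2]; omega, fun hk => ?_, fun hk => ?_⟩
  · obtain ⟨v, hv⟩ : ∃ v, s₁.reg 25 = v := ⟨_, rfl⟩
    rw [hv] at hn₁ hle₁
    have hvT : v < G.T + 1 := by
      by_contra h
      simp [Expr.eval, hB₁.env.r2, hv, h] at hk
    obtain ⟨⟨h, hh, hU, hlt, hval⟩, hbv⟩ := hn₁.mem.resolve_left (by omega)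
    -- The initial pointer `(x.j, T, T)` is the only kind with its vertex in `x`. From there the
    -- scan for ends finds nothing, since no end exceeds `T`.
    have hjx : j ∉ x.U := by
      rcases hP.out with h | h
      · exact h
      · omega
    rw [wp_seq, wp_assign]
    refine ⟨by simp only [Expr.Fits]; omega, ?_⟩
    simp only [Expr.eval, hv]
    have hB₂ := hB₁.setReg 16 v (by omega)
    rw [wp_seq]
    refine (wp_childTest hB hD hB₂.env hx hB₂.clique (j := j) (a := a) (b := v) (by simpa using h14₁)
      hjn hjx (by simpa using h15₁) (by simp) haT (by omega) hB₂.a11 hB₂.a12).mono ?_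
    rintro t₃ s₃ hg₃ ⟨ht₃, h11₃, h12₃, hres⟩
    have hE₃ : Env G σ s₃ := hB₂.env.agree hg₃ rfl
    have hC₃ : Cur G x.U x.a x.b s₃ := hB₂.clique.agree hg₃ rfl
    have h13₃ : s₃.reg 13 = x.j := (hg₃.reg 13 rfl).trans (by simpa using h13₁)
    have h14₃ : s₃.reg 14 = j := (hg₃.reg 14 rfl).trans (by simpa using h14₁)
    have h15₃ : s₃.reg 15 = a := (hg₃.reg 15 rfl).trans (by simpa using h15₁)
    have h16₃ : s₃.reg 16 = v := (hg₃.reg 16 rfl).trans (by simp)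
    have h28₃ : s₃.reg 28 = 1 := (hg₃.reg 28 rfl).trans (by simpa using h28₁)
    have hs13₃ : s₃.arr 13 = s.arr 13 := (hg₃.arr 13 rfl).trans (by simpa using hs13₁)
    have ho₃ : s₃.out = s.out := (hg₃.out rfl).trans (by simpa using ho₁)
    have hcur₃ : s₃.cur = [] := (hg₃.cur rfl).trans hB₂.cur
    have hpot : G.pot d x j a v < G.pot d x j a b := pot_lt_right hh hU hval hbv
    have hafter : ∀ c, G.Par σ x c → (After j a b c ↔ ChildAt G σ x j a v c ∨ After j a v c) := by
      intro c hc
      have hcT := hc.right.closed.tau.right_le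
      have hmin : c.j = j → b < c.b → v ≤ c.b := fun hj hb => by
        subst hj
        exact hn₁.min _ hc.right_half hb (by omega)
      simp only [After, ChildAt, hc, true_and]
      constructor
      · rintro (h | ⟨rfl, h | ⟨rfl, h⟩⟩)
        · exact Or.inr (Or.inl h)
        · exact Or.inr (Or.inr ⟨rfl, Or.inl h⟩)
        · rcases (hmin rfl h).eq_or_lt with h' | h'
          · exact Or.inl ⟨rfl, rfl, h'.symm⟩
          · exact Or.inr (Or.inr ⟨rfl, Or.inr ⟨rfl, h'⟩⟩)
      · rintro (⟨rfl, rfl, rfl⟩ | h | ⟨rfl, h | ⟨rfl, h⟩⟩)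
        · exact Or.inr ⟨rfl, Or.inr ⟨rfl, hbv⟩⟩
        · exact Or.inl h
        · exact Or.inr ⟨rfl, Or.inl h⟩
        · exact Or.inr ⟨rfl, Or.inr ⟨rfl, by omega⟩⟩
    rw [wp_ite]
    rcases hres with ⟨h27, hno⟩ | ⟨h27, c, hc, hnd, hl, h21, h22⟩
    · refine ⟨by simp only [Expr.Fits]; omega, fun h => absurd h27 h, fun _ => ?_⟩
      rw [wp_skip]
      refine ⟨by simp only [Expr.cost]; omega, .advance j a v ⟨⟨hE₃, hC₃, h11₃, h12₃, hcur₃⟩, h13₃,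
        h28₃⟩ ⟨h14₃, h15₃, h16₃, hjn, haT, by omega, Or.inl hjx⟩ hpot ho₃ hs13₃ fun c hc => ?_⟩
      rw [hafter c hc, or_iff_right]
      exact fun h => hno ⟨c, h⟩
    · refine ⟨by simp only [Expr.Fits]; omega, fun _ => ?_, fun h => ?_⟩
      swap
      · have h : s₃.reg 27 = 0 := h
        omega
      obtain ⟨hp, hcj, hca, hcb⟩ := hc
      refine (wp_descend hB hD hp hE₃ hC₃ h13₃ (h14₃.trans hcj.symm) h28₃ h11₃ h12₃ hcur₃ hnd hl
        (h21.trans hca.symm) (h22.trans hcb.symm)).mono ?_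
      rintro t₄ s₄ - ⟨ht₄, hA₄, hP₄, h13₄, r, hr, hL⟩
      refine ⟨by simp only [Expr.cost]; omega, .child c r hp hA₄ hP₄ (by rwa [hcj, hca, hcb]) hL
        (by rw [hr, ho₃]) (by rw [h13₄, hs13₃]) fun c' hc' => ?_⟩
      rw [hafter c' hc', hcj, hca, hcb]
      refine or_congr_left ⟨fun h => h.1.eq_of hp (h.2.1.trans hcj.symm) (h.2.2.1.trans hca.symm)
        (h.2.2.2.trans hcb.symm), ?_⟩
      rintro rfl
      exact ⟨hp, hcj, hca, hcb⟩
  have hv₁ : s₁.reg 25 = G.T + 1 := by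
    by_contra h
    have : s₁.reg 25 < G.T + 1 := by omega
    simp [Expr.eval, hB₁.env.r2, this] at hk
  -- The scan for ends does not involve `a`, so this holds for all children with last generator `j`,
  -- whatever their start.
  have hnoB : ∀ c, G.Par σ x c → c.j = j → c.b ≤ b := by
    rintro c hc rfl
    have hcT := hc.right.closed.tau.right_le
    by_contra h
    have := hn₁.min _ hc.right_half (by omega) (by omega)
    omega
  rw [wp_seq]
  refine (wp_valScan hB hB₁.env (f := fun h => max x.a (G.st (eid h))) hB₁.clique h14₁ hjn
    h15₁ (by decide) (by decide) (by decide) (by omega) (by decide) (eMax_spec hB hxa)).mono ?_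
  rintro t₂ s₂ hg₂ ⟨ht₂, hn₂⟩
  have hB₂ : Base G σ x.U x.a x.b s₂ := hB₁.agree hg₂ rfl
  have hle₂ := hn₂.le
  have h14₂ : s₂.reg 14 = j := (hg₂.reg 14 rfl).trans h14₁
  have h13₂ : s₂.reg 13 = x.j := (hg₂.reg 13 rfl).trans h13₁
  have h28₂ : s₂.reg 28 = 1 := (hg₂.reg 28 rfl).trans h28₁
  have hs13₂ : s₂.arr 13 = s.arr 13 := (hg₂.arr 13 rfl).trans hs13₁
  have ho₂ : s₂.out = s.out := (hg₂.out rfl).trans ho₁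
  rw [wp_ite]
  refine ⟨by simp only [Expr.Fits, Expr.eval, hB₂.env.r2]; omega, fun hk2 => ?_, fun hk2 => ?_⟩
  · obtain ⟨v, hv⟩ : ∃ v, s₂.reg 25 = v := ⟨_, rfl⟩
    rw [hv] at hn₂ hle₂
    have hvT : v < G.T + 1 := by
      by_contra h
      simp [Expr.eval, hB₂.env.r2, hv, h] at hk2
    obtain ⟨⟨h, hh, hU, hlt, hval⟩, hav⟩ := hn₂.mem.resolve_left (by omega)
    have hjx : j ∉ x.U := by
      rcases hP.out with h | h
      · exact h
      · omega
    rw [wp_seq, wp_assign]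
    refine ⟨by simp only [Expr.Fits]; omega, ?_⟩
    rw [wp_assign]
    refine ⟨by simp only [Expr.Fits]; omega, ?_⟩
    simp only [Expr.eval, hv]
    refine ⟨by simp only [Expr.cost]; omega, .advance j v 0 ⟨(hB₂.setReg _ _ (by omega)).setReg _ _
      (by omega), by simpa using h13₂, by simpa using h28₂⟩ ⟨by simpa using h14₂, by simp, by simp,
      hjn, by omega, by omega, Or.inl hjx⟩ (pot_lt_left (hd j hjn) hh hU hval hav)
      (by simpa using ho₂) (by simpa using hs13₂) fun c hc => ?_⟩
    have hcT := hc.right.closed.tau.left_le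
    -- Active times end at `1` or later, so no child at the new start is lost when the end is reset
    -- to `0`.
    have hc1 := hc.right.closed.tau.one_le_right
    have hmin : c.j = j → a < c.a → v ≤ c.a := fun hj ha => by
      subst hj
      exact hn₂.min _ hc.left_half ha (by omega)
    have hnb := hnoB c hc
    simp only [After]
    constructor
    · rintro (h | ⟨rfl, h | ⟨rfl, h⟩⟩)
      · exact Or.inl h
      · have := hmin rfl h
        exact Or.inr ⟨rfl, by omega⟩
      · have := hnb rfl
        omega
    · rintro (h | ⟨rfl, h | ⟨rfl, h⟩⟩)
      · exact Or.inl h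
      · exact Or.inr ⟨rfl, Or.inl (by omega)⟩
      · exact Or.inr ⟨rfl, Or.inl (by omega)⟩
  have hv₂ : s₂.reg 25 = G.T + 1 := by
    by_contra h
    have : s₂.reg 25 < G.T + 1 := by omega
    simp [Expr.eval, hB₂.env.r2, this] at hk2
  have hnoA : ∀ c, G.Par σ x c → c.j = j → c.a ≤ a := by
    rintro c hc rfl
    have hcT := hc.right.closed.tau.left_le
    by_contra h
    have := hn₂.min _ hc.left_half (by omega) (by omega)
    omega
  rw [wp_seq]
  refine (wp_nbrScan hB hB₂.env hB₂.clique (fun u hu => hxt.lt hu) (IsTau.degBound hD hxt) h14₂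
    hjn).mono ?_
  rintro t₃ s₃ hg₃ ⟨ht₃, hn₃⟩
  have hB₃ : Base G σ x.U x.a x.b s₃ := hB₂.agree hg₃ rfl
  have hle₃ := hn₃.le
  have h13₃ : s₃.reg 13 = x.j := (hg₃.reg 13 rfl).trans h13₂
  have h28₃ : s₃.reg 28 = 1 := (hg₃.reg 28 rfl).trans h28₂
  have hs13₃ : s₃.arr 13 = s.arr 13 := (hg₃.arr 13 rfl).trans hs13₂
  have ho₃ : s₃.out = s.out := (hg₃.out rfl).trans ho₂
  have hnbr : ∀ c, G.Par σ x c → ∃ p ∈ x.U, ∃ h ∈ G.adjL p, G.tgt h = c.j ∧ c.j ∉ x.U := by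
    intro c hc
    obtain ⟨e, he, p, hp, -, hj, -⟩ := hc.left_candidate
    obtain ⟨h, hh, -, ht⟩ := exists_half he hj.symm
    exact ⟨p, hp, h, hh, ht, hc.j_notMem⟩
  have hkey : ∀ c, G.Par σ x c → (After j a b c ↔ j < c.j) := by
    intro c hc
    refine ⟨?_, Or.inl⟩
    rintro (h | ⟨hj, h | ⟨-, h⟩⟩)
    · exact h
    · have := hnoA c hc hj.symm
      omega
    · have := hnoB c hc hj.symm
      omega
  rw [wp_ite]
  refine ⟨by simp only [Expr.Fits, hB₃.env.r0]; omega, fun hk3 => ?_, fun hk3 => ?_⟩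
  · obtain ⟨v, hv⟩ : ∃ v, s₃.reg 25 = v := ⟨_, rfl⟩
    rw [hv] at hn₃ hle₃
    have hvn : v < G.n := by
      by_contra h
      simp [Expr.eval, hB₃.env.r0, hv, h] at hk3
    obtain ⟨⟨p, hp, h, hh, ht, hvx⟩, hjv⟩ := hn₃.mem.resolve_left (by omega)
    rw [wp_seq, wp_assign]
    refine ⟨by simp only [Expr.Fits]; omega, ?_⟩
    rw [wp_seq, wp_assign]
    refine ⟨by simp only [Expr.Fits]; omega, ?_⟩
    rw [wp_assign]
    refine ⟨by simp [Expr.Fits, hB₃.env.r2]; omega, ?_⟩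
    refine ⟨by simp only [Expr.cost]; omega, .advance v 0 G.T ⟨((hB₃.setReg _ _ (by omega)).setReg
      _ _ (by omega)).setReg _ _ (by omega), by simpa using h13₃, by simpa using h28₃⟩
      ⟨by simpa [Expr.eval] using hv, by simp [Expr.eval], by simp [Expr.eval, hB₃.env.r2],
      hvn, by omega, by omega, Or.inl hvx⟩ (pot_lt_next hxb hp hh ht hvx hjv)
      (by simpa using ho₃) (by simpa using hs13₃) fun c hc => ?_⟩
    rw [hkey c hc]
    -- Active times start at `1` or later, so every child with last generator `v` comes after `(v,
    -- 0, T)`.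
    have hc1 := hc.right.closed.tau.one_le
    have hcn := hc.right.j_lt
    constructor
    · intro h
      have := hn₃.min _ (hnbr c hc) h hcn
      rcases this.eq_or_lt with h' | h'
      · exact Or.inr ⟨h', Or.inl (by omega)⟩
      · exact Or.inl h'
    · rintro (h | ⟨h, -⟩) <;> omega
  · have hv₃ : s₃.reg 25 = G.n := by
      by_contra h
      have : s₃.reg 25 < G.n := by omega
      simp [Expr.eval, hB₃.env.r0, this] at hk3
    refine (wp_backtrack hB hD hx ⟨hB₃, h13₃, h28₃⟩ (by rwa [hs13₃])).mono ?_
    rintro t₄ s₄ - ⟨ht₄, ho₄, h13₄, hL⟩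
    refine ⟨by simp only [Expr.cost]; omega, .leave (by rwa [hs13₃] at hL) (ho₄.trans ho₃)
      (h13₄.trans hs13₃) fun c hc => ?_⟩
    rw [hkey c hc]
    intro h
    have hcn := hc.right.j_lt
    have := hn₃.min _ (hnbr c hc) h hcn
    omega

/-- The nodes below the children of `x` after `(j, a, b)`. -/
def Below (G : IGraph) (σ : ℕ) (x : Nd) (j a b : ℕ) (y : Nd) : Prop :=
  ∃ c, G.Par σ x c ∧ After j a b c ∧ G.Desc σ c y

theorem After.irrefl (c : Nd) : ¬ After c.j c.a c.b c := by
  simp [After]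

/-- Children have larger last generators, so all of them come after the initial pointer. -/
theorem below_start (c y : Nd) :
    Below G σ c c.j G.T G.T y ↔ G.Desc σ c y ∧ y ≠ c := by
  constructor
  · rintro ⟨c', hc', -, hd⟩
    refine ⟨Relation.ReflTransGen.head hc' hd, ?_⟩
    rintro rfl
    have := hc'.lt
    rcases hd.le with h | h
    · rw [h] at this
      omega
    · omega
  · rintro ⟨hd, hne⟩
    rcases Relation.ReflTransGen.cases_head hd with h | ⟨c', hc', hd'⟩
    · exact absurd h.symm hne
    · exact ⟨c', hc', Or.inl hc'.lt, hd'⟩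

/-- The search below a node. -/
theorem wp_search (hB : Big G σ m w) {D d : ℕ} (hD : G.DegBound D) (hd : ∀ v < G.n, G.deg v ≤ d) :
    ∀ (N : ℕ) (x : Nd), G.n ≤ N + x.j → G.IsNode σ x → ∀ (k : ℕ) (s : State) (j a b : ℕ)
    (Q : ℕ → State → Prop), G.pot d x j a b ≤ k → At G σ x s → Ptr G x j a b s →
    (s.arr 13 x.j = 0 ∨ ∃ p, G.Par σ p x ∧ s.arr 13 x.j = p.j + 1) →
    (∀ (L : List Nd) (rs : List (List ℕ)) (t : ℕ) (s' : State), L.Nodup →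
      (∀ y, y ∈ L ↔ Below G σ x j a b y) → List.Forall₂ (fun r y => Lists G y.U r) rs L →
      s'.out = s.out ++ rs → (∀ i ≤ x.j, s'.arr 13 i = s.arr 13 i) →
      t ≤ (1200 * D + 502) * (k + 1) + L.length * ((1200 * D + 502) * ((d + 2) * D + 1)) →
      Left G σ x (s.arr 13 x.j) s' →
      WP m w (.while (.reg 28) step) s' fun t' s'' => Q (t + t') s'') →
    WP m w (.while (.reg 28) step) s Q := by
  have hw := hB.w_ge
  -- A single loop serves all levels of the recursion. The claim is therefore put in continuation
  -- form: it suffices that the loop, resumed when `x` has just been left, reaches `Q`. The outer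
  -- induction is on the room `N` above the last generator `x.j`, the inner one on the bound `k` for
  -- the potential. A step costs at most `1200 * D + 502` with the loop test; `k + 1` steps are
  -- charged to `x` itself and `(d + 2) * D + 1` to every clique found below.
  intro N
  induction N with
  | zero =>
    intro x hN hx
    have := hx.j_lt
    omega
  | succ N ihN =>
    intro x hN hx k
    induction k with
    | zero =>
      intro s j a b Q hk hA hP hs hQ
      have h28 := hA.r28
      refine wp_while_true (by simp only [Expr.Fits]; omega) (by simp [Expr.eval, h28]) ?_
      refine (wp_step hB hD hd hx hA hP hs).mono ?_
      rintro t s' - ⟨ht, hst⟩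
      cases hst with
      | advance j' a' b' hA' hP' hpot => omega
      | child c r hc hA' hP' hpot => omega
      | leave hL hout h13 hafter =>
        refine hQ [] [] _ s' List.nodup_nil (fun y => ?_) .nil (by simp [hout])
          (fun i _ => by rw [h13]) ?_ hL
        · simp only [List.not_mem_nil, false_iff]
          rintro ⟨c, hc, hc', -⟩
          exact hafter c hc hc'
        · simp only [Expr.cost]
          omega
    | succ k ihk =>
      intro s j a b Q hk hA hP hs hQ
      have h28 := hA.r28
      refine wp_while_true (by simp only [Expr.Fits]; omega) (by simp [Expr.eval, h28]) ?_
      refine (wp_step hB hD hd hx hA hP hs).mono ?_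
      rintro t s' - ⟨ht, hst⟩
      have hmul : (1200 * D + 502) * (k + 1 + 1) = (1200 * D + 502) * (k + 1) + (1200 * D + 502) := by
        ring
      cases hst with
      | advance j' a' b' hA' hP' hpot hout h13 hafter =>
        refine ihk s' j' a' b' _ (by omega) hA' hP' (by rwa [h13]) ?_
        intro L rs t' s'' hnd hmem hrs hout' h13' ht' hL
        refine (hQ L rs (2 + t + t') s'' hnd (fun y => ?_) hrs (by rw [hout', hout])
          (fun i hi => by rw [h13' i hi, h13]) (by omega) (by rwa [h13] at hL)).mono ?_
        · rw [hmem]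
          exact exists_congr fun c => and_congr_right fun hc => and_congr_left fun _ =>
            (hafter c hc).symm
        · intro t'' s₃ _ h
          convert h using 1
          simp only [Expr.cost]
          omega
      | leave hL hout h13 hafter =>
        refine hQ [] [] _ s' List.nodup_nil (fun y => ?_) .nil (by simp [hout])
          (fun i _ => by rw [h13]) ?_ hL
        · simp only [List.not_mem_nil, false_iff]
          rintro ⟨c, hc, hc', -⟩
          exact hafter c hc hc'
        · simp only [Expr.cost]
          omega
      | child c r hc hA' hP' hpot hr hout h13 hafter =>
        have hlt := hc.lt
        have hcs : s'.arr 13 c.j = x.j + 1 := by simp [h13]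
        -- First the whole subtree of the child is searched. Its cell in array `13` is not `0`, so
        -- leaving it means a return to `x`, where the inner induction takes over behind the triple
        -- of `c`.
        refine ihN c (by omega) hc.right ((d + 2) * D) s' c.j G.T G.T _ ?_ hA' hP'
          (Or.inr ⟨x, hc, hcs⟩) ?_
        · refine (pot_start hc.right.closed.tau c.j).trans ?_
          exact Nat.mul_le_mul_left _ (IsTau.degBound hD hc.right.closed.tau)
        intro L₁ rs₁ t₁ s₁ hnd₁ hmem₁ hrs₁ hout₁ h13₁ ht₁ hL₁
        rw [hcs] at hL₁
        rcases hL₁ with ⟨h0, -⟩ | ⟨p, hp, -, hA₁, hP₁⟩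
        · omega
        obtain rfl := hp.unique hc
        -- The search below `c` respects the cells up to `c.j`, and the descent itself wrote only
        -- the cell `c.j`, which is beyond `p.j`.
        have hx13 : ∀ i ≤ p.j, s₁.arr 13 i = s.arr 13 i := by
          intro i hi
          rw [h13₁ i (by omega), h13, Function.update_of_ne (by omega)]
        refine ihk s₁ c.j c.a c.b _ (by omega) hA₁ hP₁ (by rwa [hx13 _ le_rfl]) ?_
        intro L₂ rs₂ t₂ s₂ hnd₂ hmem₂ hrs₂ hout₂ h13₂ ht₂ hL₂
        have hb₁ : ∀ y, y ∈ L₁ ↔ G.Desc σ c y ∧ y ≠ c := fun y => by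
          rw [hmem₁, below_start]
        -- A later find that is also below `c` would come from `c` itself, which is not after its
        -- own triple. This gives output without repetition.
        have hdisj : ∀ y ∈ L₂, ¬ G.Desc σ c y := by
          intro y hy hcy
          obtain ⟨c', hc', haf, hd'⟩ := (hmem₂ y).1 hy
          obtain rfl := hcy.eq_of_siblings hc hc' hd'
          exact After.irrefl _ haf
        refine (hQ (c :: (L₁ ++ L₂)) (r :: (rs₁ ++ rs₂)) (2 + t + (t₁ + t₂)) s₂ ?_ (fun y => ?_)
          (.cons hr (List.rel_append hrs₁ hrs₂)) ?_ ?_ ?_ ?_).mono ?_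
        · rw [List.nodup_cons, List.nodup_append, List.mem_append]
          refine ⟨?_, hnd₁, hnd₂, ?_⟩
          · rintro (h | h)
            · exact ((hb₁ c).1 h).2 rfl
            · exact hdisj c h Relation.ReflTransGen.refl
          · rintro y hy z hz rfl
            exact hdisj y hz ((hb₁ y).1 hy).1
        · rw [List.mem_cons, List.mem_append, hb₁, hmem₂]
          constructor
          · rintro (rfl | ⟨h, -⟩ | ⟨c', hc', haf, h⟩)
            · exact ⟨y, hc, (hafter y hc).2 (Or.inl rfl), Relation.ReflTransGen.refl⟩
            · exact ⟨c, hc, (hafter c hc).2 (Or.inl rfl), h⟩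
            · exact ⟨c', hc', (hafter c' hc').2 (Or.inr haf), h⟩
          · rintro ⟨c', hc', haf, h⟩
            rcases (hafter c' hc').1 haf with rfl | haf'
            · by_cases hy : y = c'
              · exact Or.inl hy
              · exact Or.inr (Or.inl ⟨h, hy⟩)
            · exact Or.inr (Or.inr ⟨c', hc', haf', h⟩)
        · rw [hout₂, hout₁, hout]
          simp
        · intro i hi
          rw [h13₂ i hi, hx13 i hi]
        · simp only [List.length_cons, List.length_append]
          have h1 : (L₁.length + L₂.length + 1) * ((1200 * D + 502) * ((d + 2) * D + 1)) =
            L₁.length * ((1200 * D + 502) * ((d + 2) * D + 1)) +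
            L₂.length * ((1200 * D + 502) * ((d + 2) * D + 1)) +
            (1200 * D + 502) * ((d + 2) * D + 1) := by ring
          omega
        · rwa [hx13 _ le_rfl] at hL₂
        · intro t'' s₃ _ h
          convert h using 1
          simp only [Expr.cost]
          omega

end

end RAM

/-! ## The program -/

namespace RAM

open IGraph

/-- Both half-edges of an edge are pushed to the front of the lists of their origins. An edge active
from `1` to `T` is noted because it prevents the empty clique from being closed. -/
def buildBody : Prog :=
  .write 6 (.add (.add (.reg 4) (.reg 4)) (.const 1)) (.read 1 (.reg 4)) ;;
  .write 7 (.add (.add (.reg 4) (.reg 4)) (.const 1)) (.reg 4) ;;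
  .write 5 (.add (.add (.reg 4) (.reg 4)) (.const 1)) (.read 4 (.read 0 (.reg 4))) ;;
  .write 4 (.read 0 (.reg 4)) (.add (.add (.reg 4) (.reg 4)) (.const 1)) ;;
  .write 6 (.add (.add (.reg 4) (.reg 4)) (.const 2)) (.read 0 (.reg 4)) ;;
  .write 7 (.add (.add (.reg 4) (.reg 4)) (.const 2)) (.reg 4) ;;
  .write 5 (.add (.add (.reg 4) (.reg 4)) (.const 2)) (.read 4 (.read 1 (.reg 4))) ;;
  .write 4 (.read 1 (.reg 4)) (.add (.add (.reg 4) (.reg 4)) (.const 2)) ;;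
  .ite (.lt (.read 2 (.reg 4)) (.const 2))
    (.ite (.lt (.read 3 (.reg 4)) (.reg 2)) .skip (.assign 5 (.const 1))) .skip ;;
  .assign 4 (.add (.reg 4) (.const 1))

/-- Build the adjacency lists, and put `1` in register `5` if an edge is always active. -/
def build : Prog := .while (.lt (.reg 4) (.reg 1)) buildBody

/-- Write the empty clique if it is closed and long. -/
def emptyClique : Prog :=
  .ite (.reg 5) .skip (.ite (.reg 2) (.ite (.lt (.reg 2) (.reg 3)) .skip .flush) .skip)

/-- Search from the edge in register `4`. -/
def rootBody : Prog :=
  .ite (.lt (.add (.reg 3) (.read 2 (.reg 4))) (.add (.read 3 (.reg 4)) (.const 2)))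
    (.write 10 (.const 0) (.read 0 (.reg 4)) ;; .write 10 (.const 1) (.read 1 (.reg 4)) ;;
      .assign 20 (.const 2) ;; closure ;;
      .assign 14 (.add (.read 0 (.reg 4)) (.sub (.read 1 (.reg 4)) (.read 0 (.reg 4)))) ;;
      .ite (.lt (.reg 14) (.reg 26))
        (.write 13 (.reg 14) (.const 0) ;; .assign 13 (.reg 14) ;; load ;; output ;;
          .assign 15 (.reg 2) ;; .assign 16 (.reg 2) ;; .assign 28 (.const 1) ;;
          .while (.reg 28) step) .skip) .skip

def main : Prog :=
  build ;; emptyClique ;; .assign 4 (.const 0) ;;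
    .while (.lt (.reg 4) (.reg 1)) (rootBody ;; .assign 4 (.add (.reg 4) (.const 1)))

/-- The machine holds the input. -/
structure Init (G : IGraph) (σ : ℕ) (s : State) : Prop where
  r0 : s.reg 0 = G.n
  r1 : s.reg 1 = G.E
  r2 : s.reg 2 = G.T
  r3 : s.reg 3 = σ
  r : ∀ x, 4 ≤ x → s.reg x = 0
  a0 : ∀ e < G.E, s.arr 0 e = G.eu e
  a1 : ∀ e < G.E, s.arr 1 e = G.ev e
  a2 : ∀ e < G.E, s.arr 2 e = G.st e
  a3 : ∀ e < G.E, s.arr 3 e = G.en e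
  a : ∀ x, 4 ≤ x → s.arr x = fun _ => 0
  out : s.out = []
  cur : s.cur = []

/-- The edges active for at least `σ` time stamps. -/
def longEdges (G : IGraph) (σ i : ℕ) : Finset ℕ :=
  (Finset.range i).filter fun e => σ + G.st e ≤ G.en e + 1

theorem Chain.congr {f g : ℕ → ℕ} {x : ℕ} {L : List ℕ} (h : Chain f x L)
    (hfg : ∀ y ∈ L, f y = g y) : Chain g x L := by
  induction L generalizing x with
  | nil => exact h
  | cons y L ih =>
    obtain ⟨h1, h2, h3⟩ := h
    refine ⟨h1, h2, ?_⟩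
    rw [← hfg y (by simp)]
    exact ih h3 fun z hz => hfg z (List.mem_cons_of_mem _ hz)

section

variable {G : IGraph} {σ m w : ℕ} {s : State}

theorem chain_halves_succ {f g : ℕ → ℕ} {i : ℕ}
    (hc : ∀ v < G.n, Chain f (g v) (G.halves i v)) (z : ℕ) (hz : z < G.n) :
    Chain (Function.update (Function.update f (i + i + 1) (g (G.eu i))) (i + i + 2) (g (G.ev i)))
      (Function.update (Function.update g (G.eu i) (i + i + 1)) (G.ev i) (i + i + 2) z)
      (G.halves (i + 1) z) := by
  have hold : ∀ v < G.n, Chain (Function.update (Function.update f (i + i + 1) (g (G.eu i)))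
      (i + i + 2) (g (G.ev i))) (g v) (G.halves i v) := by
    intro v hv
    refine (hc v hv).congr fun y hy => ?_
    have := (halves_eid_lt hy).1
    rw [Function.update_of_ne (by omega), Function.update_of_ne (by omega)]
  rw [halves]
  split_ifs with h1 h2
  · subst h1
    refine ⟨by simp, by omega, ?_⟩
    rw [Function.update_self]
    exact hold _ hz
  · subst h2
    refine ⟨by rw [Function.update_of_ne h1, Function.update_self], by omega, ?_⟩
    rw [Function.update_of_ne (by omega), Function.update_self]
    exact hold _ hz
  · rw [Function.update_of_ne h1, Function.update_of_ne h2]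
    exact hold _ hz

/-- The adjacency lists of the first `i` edges are in memory. -/
structure Built (G : IGraph) (i : ℕ) (s : State) : Prop where
  r4 : s.reg 4 = i
  chain : ∀ v < G.n, Chain (s.arr 5) (s.arr 4 v) (G.halves i v)
  head : ∀ v < G.n, s.arr 4 v ≤ 2 * i
  a6 : ∀ h, 1 ≤ h → h ≤ 2 * i → s.arr 6 h = G.tgt h
  a7 : ∀ h, 1 ≤ h → h ≤ 2 * i → s.arr 7 h = eid h
  full : s.reg 5 = 0 ↔ ¬ ∃ e < i, G.st e < 2 ∧ G.T ≤ G.en e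
  r5 : s.reg 5 ≤ 1

theorem wp_buildBody (hB : Big G σ m w) (h2 : s.reg 2 = G.T) (ha0 : ∀ e < G.E, s.arr 0 e = G.eu e)
    (ha1 : ∀ e < G.E, s.arr 1 e = G.ev e) (ha2 : ∀ e < G.E, s.arr 2 e = G.st e)
    (ha3 : ∀ e < G.E, s.arr 3 e = G.en e) {i : ℕ} (hi : i < G.E) (hI : Built G i s) :
    WP m w buildBody s fun t s' => t ≤ 110 ∧ Built G (i + 1) s' := by
  have hm := hB.m_ge
  have hw := hB.w_ge
  have h4 := hI.r4
  have h5 := hI.r5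
  have hu := G.eu_lt i hi
  have hv := G.ev_lt i hi
  have hne := G.ne i hi
  have hse := G.st_le i hi
  have heT := G.en_le i hi
  have hhu := hI.head _ hu
  have hhv := hI.head _ hv
  have key : WP m w buildBody s fun t s' => t ≤ 110 ∧ s'.reg 4 = i + 1 ∧
      s'.reg 5 = (if G.st i < 2 ∧ G.T ≤ G.en i then 1 else s.reg 5) ∧
      s'.arr 4 = Function.update (Function.update (s.arr 4) (G.eu i) (i + i + 1)) (G.ev i)
        (i + i + 2) ∧
      s'.arr 5 = Function.update (Function.update (s.arr 5) (i + i + 1) (s.arr 4 (G.eu i)))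
        (i + i + 2) (s.arr 4 (G.ev i)) ∧
      s'.arr 6 = Function.update (Function.update (s.arr 6) (i + i + 1) (G.ev i)) (i + i + 2)
        (G.eu i) ∧
      s'.arr 7 = Function.update (Function.update (s.arr 7) (i + i + 1) i) (i + i + 2) i := by
    unfold buildBody
    by_cases hs2 : G.st i < 2
    · by_cases he : G.en i < G.T
      · simp [wp_seq, wp_ite, wp_assign, wp_skip, wp_write, Expr.Fits, Expr.eval, Expr.cost, h4, h2,
          ha0 i hi, ha1 i hi, ha2 i hi, ha3 i hi, hne.symm, hs2, he, not_le.2 he]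
        omega
      · simp [wp_seq, wp_ite, wp_assign, wp_skip, wp_write, Expr.Fits, Expr.eval, Expr.cost, h4, h2,
          ha0 i hi, ha1 i hi, ha2 i hi, ha3 i hi, hne.symm, hs2, he, not_lt.1 he]
        omega
    · simp [wp_seq, wp_ite, wp_assign, wp_skip, wp_write, Expr.Fits, Expr.eval, Expr.cost, h4, h2,
        ha0 i hi, ha1 i hi, ha2 i hi, ha3 i hi, hne.symm, hs2]
      omega
  refine key.mono ?_
  rintro t s' - ⟨ht, k4, k5, e4, e5, e6, e7⟩
  refine ⟨ht, k4, ?_, ?_, ?_, ?_, ?_, ?_⟩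
  · rw [e4, e5]
    exact chain_halves_succ hI.chain
  · intro v hv
    have := hI.head v hv
    rw [e4, Function.update_apply, Function.update_apply]
    split_ifs <;> omega
  · intro h h1 h2
    rw [e6]
    by_cases hh : h = i + i + 2
    · rw [hh, Function.update_self, tgt_even]
    · rw [Function.update_of_ne hh]
      by_cases hh' : h = i + i + 1
      · rw [hh', Function.update_self, tgt_odd]
      · rw [Function.update_of_ne hh', hI.a6 h h1 (by omega)]
  · intro h h1 h2
    rw [e7]
    by_cases hh : h = i + i + 2
    · rw [hh, Function.update_self, eid_even]
    · rw [Function.update_of_ne hh]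
      by_cases hh' : h = i + i + 1
      · rw [hh', Function.update_self, eid_odd]
      · rw [Function.update_of_ne hh', hI.a7 h h1 (by omega)]
  · rw [k5]
    split_ifs with hc
    · simp only [false_iff, not_not]
      exact ⟨i, by omega, hc⟩
    · rw [hI.full, not_iff_not]
      constructor
      · rintro ⟨e, he, h⟩
        exact ⟨e, by omega, h⟩
      · rintro ⟨e, he, h⟩
        rcases Nat.lt_succ_iff_lt_or_eq.1 he with he | rfl
        · exact ⟨e, he, h⟩
        · exact absurd h hc
  · rw [k5]
    split_ifs <;> omega

theorem wp_build (hB : Big G σ m w) (hI : Init G σ s) :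
    WP m w build s fun t s' => t ≤ 114 * G.E + 4 ∧ Built G G.E s' ∧ Env G σ s' := by
  have hm := hB.m_ge
  have hw := hB.w_ge
  unfold build
  refine (wp_while (N := G.E) (fun i t s' => Built G i s' ∧ t ≤ 114 * i) ?_ ?_ ?_).mono ?_
  · refine ⟨⟨hI.r 4 (by omega), fun v _ => ?_, fun v _ => ?_, fun h h1 h2 => by omega,
      fun h h1 h2 => by omega, ?_, ?_⟩, by omega⟩
    · simp [hI.a 4, halves, Chain]
    · simp [hI.a 4]
    · simp [hI.r 5]
    · simp [hI.r 5]
  · rintro i hi t s' ⟨hb, ht⟩ hag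
    have h1 : s'.reg 1 = G.E := (hag.reg 1 rfl).trans hI.r1
    have h4 := hb.r4
    refine ⟨by simp only [Expr.Fits]; omega, by simp [Expr.eval, h1, h4, hi], ?_⟩
    refine (wp_buildBody hB ((hag.reg 2 rfl).trans hI.r2) (by rw [hag.arr 0 rfl]; exact hI.a0)
      (by rw [hag.arr 1 rfl]; exact hI.a1) (by rw [hag.arr 2 rfl]; exact hI.a2)
      (by rw [hag.arr 3 rfl]; exact hI.a3) hi hb).mono ?_
    rintro t' s'' - ⟨ht', hb'⟩
    exact ⟨hb', by simp only [Expr.cost]; omega⟩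
  · rintro t s' ⟨hb, ht⟩ hag
    have h1 : s'.reg 1 = G.E := (hag.reg 1 rfl).trans hI.r1
    have h4 := hb.r4
    exact ⟨by simp only [Expr.Fits]; omega, by simp [Expr.eval, h1, h4]⟩
  · rintro t s' hag ⟨t₀, rfl, hb, ht⟩
    refine ⟨by simp only [Expr.cost]; omega, hb, ?_, ?_, ?_, ?_, ?_, ?_, ?_, ?_, hb.chain, hb.a6,
      hb.a7⟩
    · exact (hag.reg 0 rfl).trans hI.r0
    · exact (hag.reg 1 rfl).trans hI.r1
    · exact (hag.reg 2 rfl).trans hI.r2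
    · exact (hag.reg 3 rfl).trans hI.r3
    · rw [hag.arr 0 rfl]; exact hI.a0
    · rw [hag.arr 1 rfl]; exact hI.a1
    · rw [hag.arr 2 rfl]; exact hI.a2
    · rw [hag.arr 3 rfl]; exact hI.a3

/-- The empty clique is closed, and its active time has length at least `σ`. -/
def EmptyLong (G : IGraph) (σ : ℕ) : Prop :=
  1 ≤ G.T ∧ σ ≤ G.T ∧ ¬ ∃ e < G.E, G.st e < 2 ∧ G.T ≤ G.en e

open Classical in
theorem wp_emptyClique (hB : Big G σ m w) (hE : Env G σ s) (hI : Built G G.E s)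
    (hout : s.out = []) (hcur : s.cur = []) :
    WP m w emptyClique s fun t s' => t ≤ 10 ∧ s'.cur = [] ∧
      s'.out = if EmptyLong G σ then [[]] else [] := by
  have hm := hB.m_ge
  have hw := hB.w_ge
  have h5 := hI.r5
  have hf := hI.full
  have hw0 : 0 < w := by omega
  have hw1 : 1 < w := by omega
  have h5w : s.reg 5 < w := by omega
  have hTw : G.T < w := by omega
  have hsw : σ < w := by omega
  unfold emptyClique EmptyLong
  by_cases h : ∃ e < G.E, G.st e < 2 ∧ G.T ≤ G.en e
  · have h5' : s.reg 5 = 1 := by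
      have : s.reg 5 ≠ 0 := fun h0 => hf.1 h0 h
      omega
    simp only [wp_ite, wp_skip, Expr.Fits, Expr.eval, Expr.cost, h5', h]
    simp [hw1, hout, hcur]
  · have h5' : s.reg 5 = 0 := hf.2 h
    by_cases h1 : G.T = 0
    · simp only [wp_ite, wp_skip, Expr.Fits, Expr.eval, Expr.cost, h5', hE.r2, hE.r3, h1]
      simp [hw0, hout, hcur]
    · by_cases h2 : G.T < σ
      · simp only [wp_ite, wp_skip, Expr.Fits, Expr.eval, Expr.cost, h5', h, hE.r2, hE.r3, h1, h2]
        simp [hw0, hw1, hTw, hsw, hout, hcur, not_le.2 h2]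
      · simp only [wp_ite, wp_skip, wp_flush, Expr.Fits, Expr.eval, Expr.cost, h5', h, hE.r2, hE.r3,
          h1, h2]
        simp [hw0, hw1, hTw, hsw, hout, hcur, not_lt.1 h2, Nat.one_le_iff_ne_zero, h1]

/-- The nodes below the root of edge `e`. -/
def Under (G : IGraph) (σ e : ℕ) (y : Nd) : Prop := ∃ x, G.IsRoot σ e x ∧ G.Desc σ x y

theorem wp_rootBody (hB : Big G σ m w) {D d : ℕ} (hD : G.DegBound D)
    (hd : ∀ v < G.n, G.deg v ≤ d) {e : ℕ} (he : e < G.E) (h4 : s.reg 4 = e) {U : Finset ℕ}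
    {a b : ℕ} (hS : Base G σ U a b s) (hU : ∀ u ∈ U, u < G.n)
    (hDU : ∑ u ∈ U, (G.deg u + 1) ≤ D) :
    WP m w rootBody s fun t s' => ∃ L rs, L.Nodup ∧ (∀ y, y ∈ L ↔ Under G σ e y) ∧
      List.Forall₂ (fun r y => Lists G y.U r) rs L ∧ s'.out = s.out ++ rs ∧
      t ≤ 20 + (if σ + G.st e ≤ G.en e + 1 then 300 * D + 40 else 0) +
        L.length * ((1200 * D + 502) * ((d + 2) * D + 2)) ∧
      ∃ U a b, Base G σ U a b s' ∧ (∀ u ∈ U, u < G.n) ∧ ∑ u ∈ U, (G.deg u + 1) ≤ D := by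
  have hm := hB.m_ge
  have hw := hB.w_ge
  have hu := G.eu_lt e he
  have hv := G.ev_lt e he
  have hne := G.ne e he
  have hse := G.st_le e he
  have heT := G.en_le e he
  have hE := hS.env
  have a0 := hE.a0 e he
  have a1 := hE.a1 e he
  have a2 := hE.a2 e he
  have a3 := hE.a3 e he
  unfold rootBody
  rw [wp_ite]
  refine ⟨by simp only [Expr.Fits, Expr.eval, h4, hE.r3, a2, a3]; omega, fun hk => ?_,
    fun hk => ?_⟩
  swap
  · rw [wp_skip]
    have hlong : ¬ σ + G.st e ≤ G.en e + 1 := by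
      intro h
      have : σ + G.st e < G.en e + 2 := by omega
      simp [Expr.eval, h4, hE.r3, a2, a3, this] at hk
    refine ⟨[], [], List.nodup_nil, fun y => ?_, .nil, by simp, by simp only [Expr.cost]; omega, U, a,
      b, hS, hU, hDU⟩
    simp only [List.not_mem_nil, false_iff]
    rintro ⟨x, hx, -⟩
    have h1 := hx.eq_cl
    have h2 := hx.node.closed.long
    rw [h1.1, h1.2.1] at h2
    exact hlong h2
  have hlong : σ + G.st e ≤ G.en e + 1 := by
    by_contra h
    have : ¬ σ + G.st e < G.en e + 2 := by omega
    simp [Expr.eval, h4, hE.r3, a2, a3, this] at hk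
  rw [if_pos hlong]
  rw [wp_seq, wp_write]
  refine ⟨by simp only [Expr.Fits]; omega, by simp only [Expr.eval]; omega,
    by simp only [Expr.Fits, Expr.eval, h4, a0]; omega, ?_⟩
  rw [wp_seq, wp_write]
  refine ⟨by simp only [Expr.Fits]; omega, by simp only [Expr.eval]; omega,
    by simp [Expr.Fits, Expr.eval, h4, a1]; omega, ?_⟩
  rw [wp_seq, wp_assign]
  refine ⟨by simp only [Expr.Fits]; omega, ?_⟩
  simp only [Expr.eval, h4, a0, State.setCell_reg, State.setCell_arr, Nat.reduceEqDiff, if_false, a1]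
  have hS₁ : Base G σ U a b (((s.setCell 10 0 (G.eu e)).setCell 10 1 (G.ev e)).setReg 20 2) := by
    refine Base.setReg ⟨(hE.setCell 10 _ _ (by omega)).setCell 10 _ _ (by omega),
      ⟨?_, ?_, ?_, ?_, ?_⟩, ?_, ?_, ?_⟩ 20 2 (by omega)
    · simpa using hS.clique.nodup
    · simpa using hS.clique.eq
    · simpa using hS.clique.r11
    · simpa using hS.clique.r12
    · simpa using hS.clique.mark
    · simpa using hS.a11
    · simpa using hS.a12
    · simpa using hS.cur
  rw [wp_seq]
  refine (wp_closure (l := [G.eu e, G.ev e]) hB hD hS₁.env (by simp [lst, List.range_succ])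
    (by simp [hne]) ?_ ⟨G.eu e, by simp, G.ev e, by simp, hne⟩ hS₁.a11 hS₁.a12).mono ?_
  · intro x hx y hy hxy
    refine ⟨e, he, ?_⟩
    simp only [List.mem_cons, List.not_mem_nil, or_false] at hx hy
    rcases hx with rfl | rfl <;> rcases hy with rfl | rfl
    · exact absurd rfl hxy
    · exact Or.inl ⟨rfl, rfl⟩
    · exact Or.inr ⟨rfl, rfl⟩
    · exact absurd rfl hxy
  rintro t₂ s₂ hg₂ ⟨ht₂, a', b', C, hc⟩
  have hpair : [G.eu e, G.ev e].toFinset = {G.eu e, G.ev e} := by simp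
  have hE₂ : Env G σ s₂ := hS₁.env.agree hg₂ rfl
  have hC₂ : Cur G U a b s₂ := hS₁.clique.agree hg₂ rfl
  have hcl := hc.cl
  have htau := hc.tau
  have hlow := hc.low (max (G.eu e) (G.ev e)) (by omega)
  have hlle := hc.low_le
  rw [hpair] at hcl htau hlow
  obtain ⟨rfl, rfl⟩ := htau.unique (isTau_pair he)
  have hCt := hcl.tau htau
  have h4₂ : s₂.reg 4 = e := (hg₂.reg 4 rfl).trans (by simpa using h4)
  have ho₂ : s₂.out = s.out := hg₂.out rfl
  have hcur₂ : s₂.cur = [] := (hg₂.cur rfl).trans hS₁.cur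
  rw [wp_seq, wp_assign]
  refine ⟨by simp only [Expr.Fits, Expr.eval, h4₂, hE₂.a0 e he, hE₂.a1 e he]; omega, ?_⟩
  simp only [Expr.eval, h4₂, hE₂.a0 e he, hE₂.a1 e he]
  rw [show G.eu e + (G.ev e - G.eu e) = max (G.eu e) (G.ev e) by omega]
  rw [wp_ite]
  refine ⟨by simp [Expr.Fits]; omega, fun hk2 => ?_, fun hk2 => ?_⟩
  swap
  · rw [wp_skip]
    refine ⟨[], [], List.nodup_nil, fun y => ?_, .nil, by simpa using ho₂,
      by simp only [Expr.cost]; omega, U, a, b, Base.setReg ⟨hE₂, hC₂, hc.a11, hc.a12, hcur₂⟩ _ _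
        (by omega), hU, hDU⟩
    simp only [List.not_mem_nil, false_iff]
    rintro ⟨x, hx, -⟩
    obtain ⟨-, -, hj, hx'⟩ := hx.eq_cl
    obtain rfl := hx'.unique hcl
    have : max (G.eu e) (G.ev e) < s₂.reg 26 := by
      refine hlow.2 fun z hz hzn => ?_
      by_contra hle
      refine hzn ?_
      rw [← hx.eq, Finset.mem_filter]
      exact ⟨hz, by omega⟩
    have h1 := lt_of_le_of_lt (le_max_left _ _) this
    have h2 := lt_of_le_of_lt (le_max_right _ _) this
    simp [Expr.eval, h1, h2] at hk2
  have hlt : max (G.eu e) (G.ev e) < s₂.reg 26 := by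
    by_contra h
    simp only [Expr.eval, State.setReg_reg, if_true, Nat.reduceEqDiff, if_false, h, ne_eq,
      not_true_eq_false] at hk2
  have hx := isRoot_of_test he hcl (hlow.1 hlt) hlong
  set x : Nd := ⟨C, G.st e, G.en e, max (G.eu e) (G.ev e)⟩ with hxdef
  rw [wp_seq, wp_write]
  refine ⟨by simp [Expr.Fits]; omega, by simp [Expr.eval]; omega,
    by simp only [Expr.Fits]; omega, ?_⟩
  rw [wp_seq, wp_assign]
  refine ⟨by simp [Expr.Fits]; omega, ?_⟩
  simp only [Expr.eval, State.setReg_reg, State.setCell_reg, if_true]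
  have hE₃ : Env G σ (((s₂.setReg 14 (max (G.eu e) (G.ev e))).setCell 13
      (max (G.eu e) (G.ev e)) 0).setReg 13 (max (G.eu e) (G.ev e))) :=
    ((hE₂.setReg 14 _ (by omega)).setCell 13 _ _ (by omega)).setReg 13 _ (by omega)
  have hC₃ : Cur G U a b (((s₂.setReg 14 (max (G.eu e) (G.ev e))).setCell 13
      (max (G.eu e) (G.ev e)) 0).setReg 13 (max (G.eu e) (G.ev e))) := by
    refine Cur.setReg ⟨?_, ?_, ?_, ?_, ?_⟩ (by omega) (by omega) (by omega)
    · simpa using hC₂.nodup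
    · simpa using hC₂.eq
    · simpa using hC₂.r11
    · simpa using hC₂.r12
    · simpa using hC₂.mark
  rw [wp_seq]
  refine (wp_load hB hE₃ hC₃ hU hDU (by simpa using hc.nodup) (by simpa using hc.eq)
    (fun u hu => hCt.lt hu) (IsTau.degBound hD hCt) (by simpa using hc.r21)
    (by simpa using hc.r22) (by omega) (by omega)).mono ?_
  rintro t₄ s₄ hg₄ ⟨ht₄, hC₄⟩
  have hE₄ : Env G σ s₄ := hE₃.agree hg₄ rfl
  have h11₄ : s₄.arr 11 = fun _ => 0 := by simpa [hg₄.arr 11 rfl] using hc.a11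
  have h12₄ : s₄.arr 12 = fun _ => 0 := by simpa [hg₄.arr 12 rfl] using hc.a12
  have h13₄ : s₄.reg 13 = x.j := by simp [hg₄.reg 13 rfl, hxdef]
  have h14₄ : s₄.reg 14 = x.j := by simp [hg₄.reg 14 rfl, hxdef]
  have hs13₄ : s₄.arr 13 x.j = 0 := by simp [hg₄.arr 13 rfl, hxdef]
  have ho₄ : s₄.out = s.out := by simp [hg₄.out rfl, ho₂]
  rw [wp_seq]
  refine (wp_output hB hE₄ hC₄ (fun u hu => hCt.lt hu) (IsTau.degBound hD hCt)
    (by simpa [hg₄.cur rfl] using hcur₂)).mono ?_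
  rintro t₅ s₅ hg₅ ⟨ht₅, hcur₅, r, hr, hL⟩
  have hB₅ : Base G σ x.U x.a x.b s₅ := ⟨hE₄.agree hg₅ rfl, hC₄.agree hg₅ rfl,
    (hg₅.arr 11 rfl).trans h11₄, (hg₅.arr 12 rfl).trans h12₄, hcur₅⟩
  rw [wp_seq, wp_assign]
  refine ⟨by simp [Expr.Fits, hB₅.env.r2]; omega, ?_⟩
  rw [wp_seq, wp_assign]
  refine ⟨by simp [Expr.Fits, hB₅.env.r2]; omega, ?_⟩
  rw [wp_seq, wp_assign]
  refine ⟨by simp only [Expr.Fits]; omega, ?_⟩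
  simp only [Expr.eval, State.setReg_reg, Nat.reduceEqDiff, if_false, hB₅.env.r2]
  have hs13₅ : s₅.arr 13 x.j = 0 := by rw [hg₅.arr 13 rfl, hs13₄]
  refine wp_search hB hD hd G.n x (by omega) hx.node ((d + 2) * D) _ x.j G.T G.T _ ?_
    ⟨((hB₅.setReg _ _ (by omega)).setReg _ _ (by omega)).setReg _ _ (by omega), ?_, by simp⟩
    ⟨?_, by simp, by simp, hx.node.j_lt, le_rfl, le_rfl, Or.inr ⟨rfl, rfl⟩⟩
    (Or.inl (by simpa using hs13₅)) ?_
  · exact (pot_start hx.node.closed.tau x.j).trans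
      (Nat.mul_le_mul_left _ (IsTau.degBound hD hx.node.closed.tau))
  · simpa [hg₅.reg 13 rfl] using h13₄
  · simpa [hg₅.reg 14 rfl] using h14₄
  intro L rs t₆ s₆ hnd hmem hrs hout h13₆ ht₆ hleft
  rcases hleft with ⟨-, hB₆, h28⟩ | ⟨p, hp, -⟩
  swap
  · exact absurd hp hx.not_par
  refine wp_while_false (by simp only [Expr.Fits]; omega) h28 ?_
  refine ⟨x :: L, r :: rs, ?_, fun y => ?_, .cons hL hrs, ?_, ?_, x.U, x.a, x.b, hB₆,
    fun u hu => hCt.lt hu, IsTau.degBound hD hCt⟩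
  · rw [List.nodup_cons, hmem, below_start]
    exact ⟨fun h => h.2 rfl, hnd⟩
  · rw [List.mem_cons, hmem, below_start]
    constructor
    · rintro (h | h)
      · exact ⟨x, hx, h ▸ Relation.ReflTransGen.refl⟩
      · exact ⟨x, hx, h.1⟩
    · rintro ⟨z, hz, hzy⟩
      rw [hz.unique_right hx] at hzy
      by_cases hy : y = x
      · exact Or.inl hy
      · exact Or.inr ⟨hzy, hy⟩
  · simp [hout, hr, ho₄]
  -- One further unit of `1200 * D + 502` pays for loading and writing the root, whence `(d + 2) * D
  -- + 2` instead of `(d + 2) * D + 1`.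
  · simp only [Expr.cost, List.length_cons]
    have h1 : 0 ≤ L.length * D := Nat.zero_le _
    linarith

theorem mem_longEdges {i e : ℕ} : e ∈ longEdges G σ i ↔ e < i ∧ σ + G.st e ≤ G.en e + 1 := by
  simp [longEdges]

theorem card_longEdges_succ (i : ℕ) : (longEdges G σ (i + 1)).card =
    (longEdges G σ i).card + if σ + G.st i ≤ G.en i + 1 then 1 else 0 := by
  rw [longEdges, longEdges, Finset.range_add_one, Finset.filter_insert]
  split_ifs with h
  · rw [Finset.card_insert_of_notMem (by simp)]
  · rfl

/-- Every clique has exactly one root above it. The finds of different edges are thus disjoint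
(`Desc.eq_of_roots`), and together they are all cliques (`IsNode.exists_root`). -/
theorem wp_roots (hB : Big G σ m w) {D d : ℕ} (hD : G.DegBound D) (hd : ∀ v < G.n, G.deg v ≤ d)
    (h4 : s.reg 4 = 0) {a b : ℕ} (hS : Base G σ ∅ a b s) :
    WP m w (.while (.lt (.reg 4) (.reg 1)) (rootBody ;; .assign 4 (.add (.reg 4) (.const 1)))) s
      fun t s' => ∃ L rs, L.Nodup ∧ (∀ y, y ∈ L ↔ G.IsNode σ y) ∧
        List.Forall₂ (fun r y => Lists G y.U r) rs L ∧ s'.out = s.out ++ rs ∧ s'.cur = [] ∧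
        t ≤ 30 * G.E + 4 + (longEdges G σ G.E).card * (300 * D + 40) +
          L.length * ((1200 * D + 502) * ((d + 2) * D + 2)) := by
  have hm := hB.m_ge
  have hw := hB.w_ge
  refine (wp_while (N := G.E) (fun i t s' => s'.reg 4 = i ∧ ∃ L rs, L.Nodup ∧
    (∀ y, y ∈ L ↔ ∃ e < i, Under G σ e y) ∧ List.Forall₂ (fun r y => Lists G y.U r) rs L ∧
    s'.out = s.out ++ rs ∧ t ≤ 30 * i + (longEdges G σ i).card * (300 * D + 40) +
      L.length * ((1200 * D + 502) * ((d + 2) * D + 2)) ∧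
    ∃ U a b, Base G σ U a b s' ∧ (∀ u ∈ U, u < G.n) ∧ ∑ u ∈ U, (G.deg u + 1) ≤ D)
    ?_ ?_ ?_).mono ?_
  · exact ⟨h4, [], [], List.nodup_nil, by simp, .nil, by simp, by omega, ∅, a, b, hS, by simp,
      by simp⟩
  · rintro i hi t s' ⟨h4', L, rs, hnd, hmem, hrs, hout, ht, U, a', b', hS', hU, hDU⟩ -
    have h1 := hS'.env.r1
    refine ⟨by simp only [Expr.Fits]; omega, by simp [Expr.eval, h1, h4', hi], ?_⟩
    rw [wp_seq]
    refine (wp_rootBody hB hD hd hi h4' hS' hU hDU).mono ?_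
    rintro t' s'' hag ⟨L', rs', hnd', hmem', hrs', hout', ht', U', a'', b'', hS'', hU', hDU'⟩
    have h4'' : s''.reg 4 = i := (hag.reg 4 rfl).trans h4'
    rw [wp_assign]
    refine ⟨by simp only [Expr.Fits, Expr.eval]; omega, by simp [Expr.eval, h4''], L ++ L',
      rs ++ rs', ?_, fun y => ?_, List.rel_append hrs hrs', by simp [hout', hout], ?_, U', a'',
      b'', ⟨?_, ?_, ?_, ?_, ?_⟩, hU', hDU'⟩
    · rw [List.nodup_append]
      refine ⟨hnd, hnd', ?_⟩
      rintro y hy z hz rfl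
      obtain ⟨e, he, x, hx, hxy⟩ := (hmem y).1 hy
      obtain ⟨x', hx', hxy'⟩ := (hmem' y).1 hz
      have := hxy.eq_of_roots hx hx' hxy'
      omega
    · rw [List.mem_append, hmem, hmem']
      constructor
      · rintro (⟨e, he, h⟩ | h)
        · exact ⟨e, by omega, h⟩
        · exact ⟨i, by omega, h⟩
      · rintro ⟨e, he, h⟩
        rcases Nat.lt_succ_iff_lt_or_eq.1 he with he | rfl
        · exact Or.inl ⟨e, he, h⟩
        · exact Or.inr h
    · rw [card_longEdges_succ, List.length_append]
      simp only [Expr.cost]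
      split_ifs at ht' ⊢ <;> linarith
    · exact hS''.env.setReg _ _ (by omega)
    · exact hS''.clique.setReg (by omega) (by omega) (by omega)
    · simpa using hS''.a11
    · simpa using hS''.a12
    · simpa using hS''.cur
  · rintro t s' ⟨h4', L, rs, -, -, -, -, -, U, a', b', hS', -⟩ -
    have h1 := hS'.env.r1
    exact ⟨by simp only [Expr.Fits]; omega, by simp [Expr.eval, h1, h4']⟩
  · rintro t s' - ⟨t₀, rfl, -, L, rs, hnd, hmem, hrs, hout, ht, U, a', b', hS', -⟩
    refine ⟨L, rs, hnd, fun y => ?_, hrs, hout, hS'.cur, by simp only [Expr.cost]; omega⟩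
    rw [hmem]
    constructor
    · rintro ⟨e, -, x, hx, hxy⟩
      exact hxy.isNode hx.node
    · intro hy
      obtain ⟨e, x, hx, hxy⟩ := hy.exists_root
      exact ⟨e, hx.lt, x, hx, hxy⟩

open Classical in
theorem wp_main (hB : Big G σ m w) {D d : ℕ} (hD : G.DegBound D) (hd : ∀ v < G.n, G.deg v ≤ d)
    (hI : Init G σ s) :
    WP m w main s fun t s' => ∃ L rs, L.Nodup ∧ (∀ y, y ∈ L ↔ G.IsNode σ y) ∧
        List.Forall₂ (fun r y => Lists G y.U r) rs L ∧
        s'.out = (if EmptyLong G σ then [[]] else []) ++ rs ∧ s'.cur = [] ∧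
        t ≤ 144 * G.E + 20 + (longEdges G σ G.E).card * (300 * D + 40) +
          L.length * ((1200 * D + 502) * ((d + 2) * D + 2)) := by
  have hm := hB.m_ge
  have hw := hB.w_ge
  unfold main
  rw [wp_seq]
  refine (wp_build hB hI).mono ?_
  rintro t₁ s₁ hg₁ ⟨ht₁, hb₁, hE₁⟩
  rw [wp_seq]
  refine (wp_emptyClique hB hE₁ hb₁ ((hg₁.out rfl).trans hI.out) ((hg₁.cur rfl).trans hI.cur)).mono ?_
  rintro t₂ s₂ hg₂ ⟨ht₂, hcur₂, hout₂⟩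
  have hE₂ : Env G σ s₂ := hE₁.agree hg₂ rfl
  rw [wp_seq, wp_assign]
  refine ⟨by simp only [Expr.Fits]; omega, ?_⟩
  have ha : ∀ x, 8 ≤ x → s₂.arr x = fun _ => 0 := by
    intro x hx
    rw [hg₂.arr x (by simp [emptyClique, Prog.writesArr]), hg₁.arr x (by
      simp [build, buildBody, Prog.writesArr]
      omega), hI.a x (by omega)]
  have h10 : s₂.reg 10 = 0 := by
    rw [hg₂.reg 10 rfl, hg₁.reg 10 rfl, hI.r 10 (by omega)]
  refine (wp_roots hB hD hd (s := s₂.setReg 4 0) (by simp) (a := s₂.reg 11) (b := s₂.reg 12)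
    ⟨hE₂.setReg 4 0 (by omega), ⟨?_, ?_, by simp, by simp, ?_⟩, ?_, ?_, ?_⟩).mono ?_
  · simp [h10, lst]
  · simp [h10, lst]
  · simp [ha 9 (by omega)]
  · simp [ha 11 (by omega)]
  · simp [ha 12 (by omega)]
  · simpa using hcur₂
  · rintro t₃ s₃ - ⟨L, rs, h1, h2, h3, h4, h5, h6⟩
    refine ⟨L, rs, h1, h2, h3, ?_, h5, by simp only [Expr.cost]; omega⟩
    rw [h4, State.setReg_out, hout₂]

end

end RAM

/-! ## The graph of a graph sequence -/

namespace GraphSeq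

open IGraph

variable {n : ℕ} {S : GraphSeq n} {es : List (Fin n × Fin n)}

theorem input_of_get {σ e : ℕ} {p : Fin n × Fin n} (h : es[e]? = some p) :
    (S.inputState es σ).arr 0 e = p.1 ∧ (S.inputState es σ).arr 1 e = p.2 ∧
      (S.inputState es σ).arr 2 e = sInf (S.tau s(p.1, p.2) : Set ℕ) ∧
      (S.inputState es σ).arr 3 e = (S.tau s(p.1, p.2)).sup id := by
  simp [inputState, h]

/-- The interval assumption enters here: the first and the last active time stamp determine `τ(e)`.
The threshold `0` is a placeholder, as the arrays do not depend on it. -/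
theorem get_edge (hI : S.IntervalAssumption) (hes : S.IsEdgeList es) {e : ℕ} (he : e < es.length) :
    ∃ p : Fin n × Fin n, es[e]? = some p ∧ s(p.1, p.2) ∈ S.graph.edgeSet ∧
      (S.inputState es 0).arr 0 e = p.1 ∧ (S.inputState es 0).arr 1 e = p.2 ∧
      S.tau s(p.1, p.2) =
        Finset.Icc ((S.inputState es 0).arr 2 e) ((S.inputState es 0).arr 3 e) ∧
      1 ≤ (S.inputState es 0).arr 2 e ∧
      (S.inputState es 0).arr 2 e ≤ (S.inputState es 0).arr 3 e ∧
      (S.inputState es 0).arr 3 e ≤ S.tmax := by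
  have hget : es[e]? = some es[e] := List.getElem?_eq_getElem he
  obtain ⟨h0, h1, h2, h3⟩ := input_of_get (S := S) (σ := 0) hget
  have hmem : s(es[e].1, es[e].2) ∈ S.graph.edgeSet :=
    (hes.2 _).1 (List.mem_map.2 ⟨es[e], List.getElem_mem he, rfl⟩)
  obtain ⟨t, l, htl⟩ := hI _ hmem
  have hsub := S.tau_subset _ hmem
  rw [htl, Finset.coe_Icc, csInf_Icc (by omega)] at h2
  have hsup : (Finset.Icc t (t + l)).sup id = t + l :=
    le_antisymm (Finset.sup_le fun x hx => (Finset.mem_Icc.1 hx).2)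
      (Finset.le_sup (f := id) (Finset.mem_Icc.2 ⟨by omega, le_rfl⟩))
  rw [htl, hsup] at h3
  rw [htl] at hsub
  have ht := Finset.mem_Icc.1 (hsub (Finset.mem_Icc.2 ⟨le_rfl, Nat.le_add_right t l⟩))
  have hl := Finset.mem_Icc.1 (hsub (Finset.mem_Icc.2 ⟨Nat.le_add_right t l, le_rfl⟩))
  exact ⟨es[e], hget, hmem, h0, h1, by rw [h2, h3, htl], by omega, by omega, by omega⟩

theorem index_unique (hes : S.IsEdgeList es) {e f : ℕ} {p q : Fin n × Fin n}
    (he : es[e]? = some p) (hf : es[f]? = some q) (h : s(p.1, p.2) = s(q.1, q.2)) : e = f := by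
  obtain ⟨he', rfl⟩ := List.getElem?_eq_some_iff.1 he
  obtain ⟨hf', rfl⟩ := List.getElem?_eq_some_iff.1 hf
  have := hes.1.getElem_inj_iff (i := e) (j := f) (hi := by simpa using he')
    (hj := by simpa using hf')
  simpa [h] using this

/-- The graph of a graph sequence, with the edges numbered as in the input. -/
noncomputable def toIGraph (hI : S.IntervalAssumption) (hes : S.IsEdgeList es) : IGraph where
  n := n
  E := es.length
  T := S.tmax
  eu := (S.inputState es 0).arr 0
  ev := (S.inputState es 0).arr 1
  st := (S.inputState es 0).arr 2
  en := (S.inputState es 0).arr 3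
  eu_lt e he := by
    obtain ⟨p, -, -, h, -⟩ := get_edge hI hes he
    exact h ▸ p.1.2
  ev_lt e he := by
    obtain ⟨p, -, -, -, h, -⟩ := get_edge hI hes he
    exact h ▸ p.2.2
  ne e he := by
    obtain ⟨p, -, hp, h0, h1, -⟩ := get_edge hI hes he
    rw [h0, h1]
    intro h
    exact S.graph.ne_of_adj ((SimpleGraph.mem_edgeSet _).1 hp) (Fin.ext h)
  st_pos e he := by
    obtain ⟨p, -, -, -, -, -, h, -⟩ := get_edge hI hes he
    exact h
  st_le e he := by
    obtain ⟨p, -, -, -, -, -, -, h, -⟩ := get_edge hI hes he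
    exact h
  en_le e he := by
    obtain ⟨p, -, -, -, -, -, -, -, h⟩ := get_edge hI hes he
    exact h
  simple e he f hf h := by
    obtain ⟨p, hp, -, h0, h1, -⟩ := get_edge hI hes he
    obtain ⟨q, hq, -, h2, h3, -⟩ := get_edge hI hes hf
    rw [h0, h1, h2, h3] at h
    refine index_unique hes hp hq ?_
    rw [Sym2.eq_iff]
    exact h.imp (fun h => ⟨Fin.ext h.1, Fin.ext h.2⟩) fun h => ⟨Fin.ext h.1, Fin.ext h.2⟩

theorem init_inputState (hI : S.IntervalAssumption) (hes : S.IsEdgeList es) (σ : ℕ) :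
    RAM.Init (toIGraph hI hes) σ (S.inputState es σ) := by
  refine ⟨rfl, rfl, rfl, rfl, fun x hx => ?_, fun _ _ => rfl, fun _ _ => rfl, fun _ _ => rfl,
    fun _ _ => rfl, fun x hx => ?_, rfl, rfl⟩
  · match x, hx with
    | x + 4, _ => rfl
  · match x, hx with
    | x + 4, _ => rfl

open Classical in
/-- The edges with both ends in `U`. -/
noncomputable def edgesIn (S : GraphSeq n) (U : Finset ℕ) : Finset (Sym2 (Fin n)) :=
  {e | e ∈ S.graph.edgeSet ∧ ∀ v ∈ e, (v : ℕ) ∈ U}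

theorem mem_edgesIn {U : Finset ℕ} {x y : Fin n} :
    s(x, y) ∈ S.edgesIn U ↔ S.graph.Adj x y ∧ (x : ℕ) ∈ U ∧ (y : ℕ) ∈ U := by
  simp [edgesIn]

open Classical in
/-- The endpoints of the members of `K`. -/
noncomputable def ends (K : Finset (Sym2 (Fin n))) : Finset ℕ :=
  (Finset.univ.filter fun v : Fin n => ∃ e ∈ K, v ∈ e).image Fin.val

theorem mem_ends {K : Finset (Sym2 (Fin n))} {u : ℕ} :
    u ∈ ends K ↔ ∃ v : Fin n, (v : ℕ) = u ∧ ∃ e ∈ K, v ∈ e := by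
  simp only [ends, Finset.mem_image, Finset.mem_filter, Finset.mem_univ, true_and]
  exact exists_congr fun v => and_comm

variable (hI : S.IntervalAssumption) (hes : S.IsEdgeList es)

theorem exists_index {x y : Fin n} (h : S.graph.Adj x y) :
    ∃ e < (toIGraph hI hes).E, (toIGraph hI hes).Joins e x y := by
  have hm := (hes.2 s(x, y)).2 h
  obtain ⟨p, hp, hpe⟩ := List.mem_map.1 hm
  obtain ⟨e, he, rfl⟩ := List.mem_iff_getElem.1 hp
  refine ⟨e, he, ?_⟩
  obtain ⟨h0, h1, -⟩ := input_of_get (S := S) (σ := 0) (List.getElem?_eq_getElem he)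
  rw [Sym2.eq_iff] at hpe
  refine hpe.imp (fun h => ⟨?_, ?_⟩) fun h => ⟨?_, ?_⟩
  · exact h0.trans (congrArg _ h.1)
  · exact h1.trans (congrArg _ h.2)
  · exact h0.trans (congrArg _ h.1)
  · exact h1.trans (congrArg _ h.2)

theorem edge_of_joins {e : ℕ} {x y : Fin n} (he : e < (toIGraph hI hes).E)
    (h : (toIGraph hI hes).Joins e x y) : S.graph.Adj x y ∧
      S.tau s(x, y) = Finset.Icc ((toIGraph hI hes).st e) ((toIGraph hI hes).en e) := by
  obtain ⟨p, hp, hmem, h0, h1, ht, -⟩ := get_edge hI hes he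
  have key : s(p.1, p.2) = s(x, y) := by
    rw [Sym2.eq_iff]
    exact h.imp (fun h => ⟨Fin.ext (h0.symm.trans h.1), Fin.ext (h1.symm.trans h.2)⟩)
      fun h => ⟨Fin.ext (h0.symm.trans h.1), Fin.ext (h1.symm.trans h.2)⟩
  rw [key] at hmem ht
  exact ⟨hmem, ht⟩

theorem adj_of_clique {K : Finset (Sym2 (Fin n))} (hK : S.IsClique K) {u v : ℕ} (hu : u ∈ ends K)
    (hv : v ∈ ends K) (huv : u ≠ v) : ∃ x y : Fin n, (x : ℕ) = u ∧ (y : ℕ) = v ∧ s(x, y) ∈ K := by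
  obtain ⟨x, rfl, hx⟩ := mem_ends.1 hu
  obtain ⟨y, rfl, hy⟩ := mem_ends.1 hv
  exact ⟨x, y, rfl, rfl, hK.2 x y hx hy fun h => huv (congrArg _ h)⟩

/-- A clique contains every edge between its endpoints, so nothing is lost by passing to vertex
sets. -/
theorem edgesIn_ends {K : Finset (Sym2 (Fin n))} (hK : S.IsClique K) : S.edgesIn (ends K) = K := by
  ext e
  induction e with
  | _ x y =>
    rw [mem_edgesIn]
    constructor
    · rintro ⟨hadj, hx, hy⟩
      obtain ⟨x', hx', hex⟩ := mem_ends.1 hx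
      obtain ⟨y', hy', hey⟩ := mem_ends.1 hy
      obtain rfl := Fin.ext hx'
      obtain rfl := Fin.ext hy'
      exact hK.2 _ _ hex hey hadj.ne
    · intro h
      exact ⟨hK.1 _ h, mem_ends.2 ⟨x, rfl, _, h, by simp⟩, mem_ends.2 ⟨y, rfl, _, h, by simp⟩⟩

theorem exists_isTau {K : Finset (Sym2 (Fin n))} (hK : S.IsClique K) (hne : K ≠ ∅) :
    ∃ a b, (toIGraph hI hes).IsTau (ends K) a b := by
  refine IsTau.exists_of_clique ?_ ?_
  · intro u hu v hv huv
    obtain ⟨x, y, rfl, rfl, h⟩ := adj_of_clique hK hu hv huv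
    exact exists_index hI hes (hK.1 _ h)
  · obtain ⟨e, he⟩ := Finset.nonempty_iff_ne_empty.2 hne
    induction e with
    | _ x y =>
      exact ⟨x, mem_ends.2 ⟨x, rfl, _, he, by simp⟩, y, mem_ends.2 ⟨y, rfl, _, he, by simp⟩,
        fun h => (hK.1 _ he : S.graph.Adj x y).ne (Fin.ext h)⟩

variable {hI hes} {U : Finset ℕ} {a b : ℕ}

theorem adj_fin (h : (toIGraph hI hes).IsTau U a b) {u v : ℕ} (hu : u ∈ U) (hv : v ∈ U)
    (huv : u ≠ v) : ∃ x y : Fin n, (x : ℕ) = u ∧ (y : ℕ) = v ∧ S.graph.Adj x y := by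
  obtain ⟨e, he, hj, -⟩ := h.1 u hu v hv huv
  have hun : u < n := h.lt hu
  have hvn : v < n := h.lt hv
  exact ⟨⟨u, hun⟩, ⟨v, hvn⟩, rfl, rfl, (edge_of_joins hI hes he hj).1⟩

/-- A set with an active time has at least two vertices, so each vertex lies on an edge inside the
set. -/
theorem ends_edgesIn (h : (toIGraph hI hes).IsTau U a b) : ends (S.edgesIn U) = U := by
  ext u
  rw [mem_ends]
  constructor
  · rintro ⟨v, rfl, e, he, hv⟩
    simp only [edgesIn, Finset.mem_filter] at he
    exact he.2.2 v hv
  · intro hu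
    obtain ⟨v, hv, hne⟩ : ∃ v ∈ U, u ≠ v := by
      obtain ⟨p, hp, q, hq, hpq⟩ := h.exists_ne
      by_cases hup : u = p
      · exact ⟨q, hq, hup ▸ hpq⟩
      · exact ⟨p, hp, hup⟩
    obtain ⟨x, y, rfl, rfl, hadj⟩ := adj_fin h hu hv hne
    exact ⟨x, rfl, s(x, y), mem_edgesIn.2 ⟨hadj, hu, hv⟩, by simp⟩

theorem isClique_edgesIn (h : (toIGraph hI hes).IsTau U a b) : S.IsClique (S.edgesIn U) := by
  constructor
  · intro e he
    simp only [edgesIn, Finset.mem_filter] at he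
    exact he.2.1
  · intro u v hu hv huv
    have hu' : (u : ℕ) ∈ ends (S.edgesIn U) := mem_ends.2 ⟨u, rfl, hu⟩
    have hv' : (v : ℕ) ∈ ends (S.edgesIn U) := mem_ends.2 ⟨v, rfl, hv⟩
    rw [ends_edgesIn h] at hu' hv'
    obtain ⟨x, y, hx, hy, hadj⟩ := adj_fin h hu' hv' fun h => huv (Fin.ext h)
    obtain rfl := Fin.ext hx
    obtain rfl := Fin.ext hy
    exact mem_edgesIn.2 ⟨hadj, hu', hv'⟩

theorem edgesIn_ne_empty (h : (toIGraph hI hes).IsTau U a b) : S.edgesIn U ≠ ∅ := by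
  obtain ⟨u, hu, v, hv, huv⟩ := h.exists_ne
  obtain ⟨x, y, rfl, rfl, hadj⟩ := adj_fin h hu hv huv
  exact Finset.ne_empty_of_mem (mem_edgesIn.2 ⟨hadj, hu, hv⟩)

/-- The edges that attain `a` and `b` give one inclusion, adjacency during `[a, b]` the other. -/
theorem activeTime_edgesIn (h : (toIGraph hI hes).IsTau U a b) :
    S.activeTime (S.edgesIn U) = Finset.Icc a b := by
  ext t
  simp only [activeTime, Finset.mem_filter, Finset.mem_Icc]
  have hin : ∀ e < (toIGraph hI hes).E, (toIGraph hI hes).eu e ∈ U → (toIGraph hI hes).ev e ∈ U →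
      ∃ f ∈ S.edgesIn U,
        S.tau f = Finset.Icc ((toIGraph hI hes).st e) ((toIGraph hI hes).en e) := by
    intro e he hu hv
    have hun : (toIGraph hI hes).eu e < n := h.lt hu
    have hvn : (toIGraph hI hes).ev e < n := h.lt hv
    have := edge_of_joins hI hes (x := ⟨_, hun⟩) (y := ⟨_, hvn⟩) he (Or.inl ⟨rfl, rfl⟩)
    exact ⟨_, mem_edgesIn.2 ⟨this.1, hu, hv⟩, this.2⟩
  constructor
  · rintro ⟨-, ht⟩
    obtain ⟨-, ⟨e, he, hu, hv, rfl⟩, ⟨f, hf, hu', hv', rfl⟩⟩ := h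
    obtain ⟨k, hk, hk'⟩ := hin e he hu hv
    obtain ⟨k₂, hk₂, hk₂'⟩ := hin f hf hu' hv'
    have h1 := ht k hk
    have h2 := ht k₂ hk₂
    rw [hk', Finset.mem_Icc] at h1
    rw [hk₂', Finset.mem_Icc] at h2
    exact ⟨h1.1, h2.2⟩
  · rintro ⟨h1, h2⟩
    have h3 := h.one_le
    have h4 : b ≤ S.tmax := h.right_le
    refine ⟨by omega, fun f hf => ?_⟩
    induction f with
    | _ x y =>
      obtain ⟨hadj, hx, hy⟩ := mem_edgesIn.1 hf
      obtain ⟨e, he, hj, hst, hen⟩ := h.1 x hx y hy fun h => hadj.ne (Fin.ext h)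
      rw [(edge_of_joins hI hes he hj).2, Finset.mem_Icc]
      omega

theorem activeTime_clique {K : Finset (Sym2 (Fin n))} (hK : S.IsClique K)
    (h : (toIGraph hI hes).IsTau (ends K) a b) : S.activeTime K = Finset.Icc a b := by
  conv_lhs => rw [← edgesIn_ends hK]
  exact activeTime_edgesIn h

theorem ends_mono {K K' : Finset (Sym2 (Fin n))} (h : K ⊆ K') : ends K ⊆ ends K' := by
  intro u hu
  obtain ⟨v, rfl, e, he, hv⟩ := mem_ends.1 hu
  exact mem_ends.2 ⟨v, rfl, e, h he, hv⟩

theorem icc_inj {a b c d : ℕ} (hab : a ≤ b) (h : Finset.Icc a b = Finset.Icc c d) :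
    a = c ∧ b = d := by
  have h1 : a ∈ Finset.Icc c d := h ▸ Finset.mem_Icc.2 ⟨le_rfl, hab⟩
  have h2 : b ∈ Finset.Icc c d := h ▸ Finset.mem_Icc.2 ⟨hab, le_rfl⟩
  rw [Finset.mem_Icc] at h1 h2
  have h3 : c ∈ Finset.Icc a b := h ▸ Finset.mem_Icc.2 ⟨le_rfl, by omega⟩
  have h4 : d ∈ Finset.Icc a b := h ▸ Finset.mem_Icc.2 ⟨by omega, le_rfl⟩
  rw [Finset.mem_Icc] at h3 h4
  omega

theorem isTau_insert {G : IGraph} {z : ℕ} (h : G.IsTau U a b) (hz : ∀ u ∈ U, G.Adj a b u z) :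
    G.IsTau (insert z U) a b := by
  obtain ⟨h1, ⟨e, he, hu, hv, hea⟩, ⟨f, hf, hu', hv', hfb⟩⟩ := h
  refine ⟨fun p hp q hq hpq => ?_, ⟨e, he, Finset.mem_insert_of_mem hu, Finset.mem_insert_of_mem hv,
    hea⟩, ⟨f, hf, Finset.mem_insert_of_mem hu', Finset.mem_insert_of_mem hv', hfb⟩⟩
  rcases Finset.mem_insert.1 hp with rfl | hp' <;> rcases Finset.mem_insert.1 hq with rfl | hq'
  · exact absurd rfl hpq
  · exact (hz q hq').symm
  · exact hz p hp'
  · exact h1 p hp' q hq' hpq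

/-- A strictly larger edge set spans strictly more vertices. If its active time were the same, an
additional vertex would be adjacent to all of `U` during `[a, b]`. -/
theorem longCliques_of_isClosed {σ : ℕ} (h : (toIGraph hI hes).IsClosed σ U a b) :
    S.edgesIn U ∈ S.longCliques σ := by
  have hK := isClique_edgesIn h.tau
  have hact := activeTime_edgesIn h.tau
  have hle := h.le
  have hlong := h.long
  refine ⟨⟨hK, ?_, fun K' hK' hsub hEq => ?_⟩, ?_⟩
  · rw [hact]
    exact Finset.nonempty_Icc.2 hle
  · have hne : K' ≠ ∅ := by
      rintro rfl
      exact Finset.not_ssubset_empty _ hsub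
    obtain ⟨a', b', ht'⟩ := exists_isTau hI hes hK' hne
    rw [hact, activeTime_clique hK' ht'] at hEq
    obtain ⟨rfl, rfl⟩ := icc_inj hle hEq.symm
    have hss : U ⊂ ends K' := by
      have h1 := ends_mono hsub.subset
      rw [ends_edgesIn h.tau] at h1
      refine h1.ssubset_of_ne ?_
      rintro rfl
      rw [edgesIn_ends hK'] at hsub
      exact hsub.ne rfl
    obtain ⟨z, hz, hzU⟩ := Finset.exists_of_ssubset hss
    exact h.max z fun u hu => ht'.1 u (hss.subset hu) z hz fun h => hzU (h ▸ hu)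
  · rw [hact, Nat.card_Icc]
    omega

/-- A vertex adjacent to all endpoints during `[a, b]` could be added without changing the active
time, against closedness. -/
theorem isClosed_of_longCliques {σ : ℕ} {K : Finset (Sym2 (Fin n))} (h : K ∈ S.longCliques σ)
    (hne : K ≠ ∅) : ∃ a b, (toIGraph hI hes).IsClosed σ (ends K) a b := by
  obtain ⟨⟨hK, hact, hmax⟩, hlong⟩ := h
  obtain ⟨a, b, ht⟩ := exists_isTau hI hes hK hne
  have hT := activeTime_clique hK ht
  rw [hT] at hact hlong
  have hab := Finset.nonempty_Icc.1 hact
  rw [Nat.card_Icc] at hlong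
  refine ⟨a, b, ht, fun z hz => ?_, hab, by omega⟩
  have ht' := isTau_insert ht hz
  refine hmax _ (isClique_edgesIn ht') ?_ ?_
  · have hsub : K ⊆ S.edgesIn (insert z (ends K)) := by
      intro e he
      rw [← edgesIn_ends hK] at he
      simp only [edgesIn, Finset.mem_filter] at he ⊢
      exact ⟨he.1, he.2.1, fun v hv => Finset.mem_insert_of_mem (he.2.2 v hv)⟩
    refine hsub.ssubset_of_ne fun hEq => ?_
    have h1 : z ∈ ends K := by
      rw [hEq, ends_edgesIn ht']
      exact Finset.mem_insert_self _ _
    exact (hz z h1).ne rfl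
  · rw [activeTime_edgesIn ht', hT]

theorem activeTime_empty : S.activeTime ∅ = Finset.Icc 1 S.tmax := by
  simp [activeTime]

/-- The empty clique is active at all time stamps. It fails to be closed exactly if some nonempty
clique is always active, and then a single edge is. -/
theorem empty_mem_longCliques {σ : ℕ} :
    ∅ ∈ S.longCliques σ ↔ RAM.EmptyLong (toIGraph hI hes) σ := by
  have hfull : (∃ e < (toIGraph hI hes).E, (toIGraph hI hes).st e < 2 ∧
      (toIGraph hI hes).T ≤ (toIGraph hI hes).en e) ↔
      ∃ K, S.IsClique K ∧ ∅ ⊂ K ∧ S.activeTime K = S.activeTime ∅ := by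
    constructor
    · rintro ⟨e, he, h1, h2⟩
      have ht := isTau_pair he
      have h3 := (toIGraph hI hes).st_pos e he
      have h4 := (toIGraph hI hes).en_le e he
      refine ⟨_, isClique_edgesIn ht, Finset.empty_ssubset.2
        (Finset.nonempty_iff_ne_empty.2 (edgesIn_ne_empty ht)), ?_⟩
      rw [activeTime_edgesIn ht, activeTime_empty, show (toIGraph hI hes).st e = 1 by omega,
        show (toIGraph hI hes).en e = (toIGraph hI hes).T by omega]
      rfl
    · rintro ⟨K, hK, hne, hact⟩
      have hne' : K ≠ ∅ := hne.ne'
      obtain ⟨a, b, ht⟩ := exists_isTau hI hes hK hne'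
      rw [activeTime_clique hK ht, activeTime_empty] at hact
      obtain ⟨e, he, hu, hv, -⟩ := ht.2.1
      have hedge := ht.edge he hu hv
      have h1 := (toIGraph hI hes).st_le e he
      have h2 := (toIGraph hI hes).st_pos e he
      have h3 : (toIGraph hI hes).en e ≤ S.tmax := (toIGraph hI hes).en_le e he
      obtain ⟨rfl, rfl⟩ := icc_inj (by omega) hact.symm
      exact ⟨e, he, by omega, hedge.2⟩
  rw [RAM.EmptyLong, hfull]
  have hT : (toIGraph hI hes).T = S.tmax := rfl
  rw [hT]
  constructor
  · rintro ⟨⟨-, hact, hmax⟩, hlong⟩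
    rw [activeTime_empty] at hact hlong
    rw [Nat.card_Icc] at hlong
    refine ⟨Finset.nonempty_Icc.1 hact, by omega, ?_⟩
    rintro ⟨K, hK, hne, h⟩
    exact hmax K hK hne h
  · rintro ⟨h1, h2, h3⟩
    refine ⟨⟨⟨by simp, by simp⟩, ?_, fun K hK hne h => h3 ⟨K, hK, hne, h⟩⟩, ?_⟩
    · rw [activeTime_empty]
      exact Finset.nonempty_Icc.2 h1
    · rw [activeTime_empty, Nat.card_Icc]
      omega

theorem encodes_of_lists {r : List ℕ} (h : RAM.Lists (toIGraph hI hes) U r) :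
    Encodes es r (S.edgesIn U) := by
  refine ⟨h.1, fun j => ?_⟩
  rw [h.2 j]
  constructor
  · rintro ⟨hj, hu, hv⟩
    obtain ⟨p, hp, hmem, h0, h1, -⟩ := get_edge hI hes hj
    refine ⟨p, hp, mem_edgesIn.2 ⟨hmem, ?_, ?_⟩⟩
    · rw [← h0]; exact hu
    · rw [← h1]; exact hv
  · rintro ⟨p, hp, hmem⟩
    obtain ⟨h0, h1, -⟩ := input_of_get (S := S) (σ := 0) hp
    obtain ⟨-, hu, hv⟩ := mem_edgesIn.1 hmem
    refine ⟨(List.getElem?_eq_some_iff.1 hp).1, ?_, ?_⟩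
    · rw [← h0] at hu; exact hu
    · rw [← h1] at hv; exact hv

open Classical in
theorem enumerates_of_nodes {σ : ℕ} {L : List Nd} {rs : List (List ℕ)} (hnd : L.Nodup)
    (hmem : ∀ y, y ∈ L ↔ (toIGraph hI hes).IsNode σ y)
    (hrs : List.Forall₂ (fun r y => RAM.Lists (toIGraph hI hes) y.U r) rs L) :
    Enumerates es ((if RAM.EmptyLong (toIGraph hI hes) σ then [[]] else []) ++ rs)
      (S.longCliques σ) ∧ L.length ≤ (S.longCliques σ).ncard := by
  set Ks := (if RAM.EmptyLong (toIGraph hI hes) σ then [∅] else []) ++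
    L.map (fun y => S.edgesIn y.U) with hKs
  have hne : ∀ y ∈ L, S.edgesIn y.U ≠ ∅ := fun y hy =>
    edgesIn_ne_empty ((hmem y).1 hy).closed.tau
  have hKnd : Ks.Nodup := by
    rw [hKs, List.nodup_append]
    refine ⟨by split_ifs <;> simp, hnd.map_on ?_, ?_⟩
    · intro x hx y hy h
      have hx' := (hmem x).1 hx
      have hy' := (hmem y).1 hy
      refine hx'.ext hy' ?_
      rw [← ends_edgesIn hx'.closed.tau, ← ends_edgesIn hy'.closed.tau, h]
    · rintro K hK K' hK' rfl
      obtain ⟨y, hy, rfl⟩ := List.mem_map.1 hK'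
      refine hne y hy ?_
      split_ifs at hK with hel
      · exact List.mem_singleton.1 hK
      · simp at hK
  have hKmem : ∀ K, K ∈ Ks ↔ K ∈ S.longCliques σ := by
    intro K
    rw [hKs, List.mem_append, List.mem_map]
    constructor
    · rintro (h | ⟨y, hy, rfl⟩)
      · split_ifs at h with hel
        · rw [List.mem_singleton.1 h]
          exact empty_mem_longCliques.2 hel
        · simp at h
      · exact longCliques_of_isClosed ((hmem y).1 hy).closed
    · intro h
      by_cases hK : K = ∅
      · subst hK
        left
        rw [if_pos (empty_mem_longCliques.1 h)]
        simp
      · right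
        obtain ⟨a, b, hcl⟩ := isClosed_of_longCliques (hI := hI) (hes := hes) h hK
        obtain ⟨j, hj⟩ := hcl.exists_node
        exact ⟨_, (hmem _).2 hj, edgesIn_ends h.1.1⟩
  refine ⟨⟨Ks, hKnd, hKmem, List.rel_append ?_ ?_⟩, ?_⟩
  · split_ifs
    · exact .cons ⟨List.nodup_nil, by simp⟩ .nil
    · exact .nil
  · rw [List.forall₂_map_right_iff]
    exact hrs.imp fun r y h => encodes_of_lists h
  · have : S.longCliques σ = (Ks.toFinset : Set _) := by
      ext K
      simp [hKmem]
    rw [this, Set.ncard_coe_finset, List.toFinset_card_of_nodup hKnd, hKs, List.length_append,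
      List.length_map]
    omega

end GraphSeq

/-! ## The running time -/

namespace IGraph

variable {G : IGraph}

theorem sum_halves_le (i : ℕ) : ∑ v ∈ Finset.range G.n, (G.halves i v).length ≤ 2 * i := by
  induction i with
  | zero => simp [halves]
  | succ i ih =>
    have h : ∀ v, (G.halves (i + 1) v).length ≤
        (G.halves i v).length + ((if v = G.ev i then 1 else 0) + if v = G.eu i then 1 else 0) := by
      intro v
      rw [halves]
      split_ifs <;> simp
    refine (Finset.sum_le_sum fun v _ => h v).trans ?_
    rw [Finset.sum_add_distrib, Finset.sum_add_distrib, Finset.sum_ite_eq', Finset.sum_ite_eq']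
    split_ifs <;> omega

theorem card_le_deg {U : Finset ℕ} {u : ℕ} (hu : u ∈ U)
    (hU : ∀ v ∈ U, u ≠ v → ∃ e < G.E, G.Joins e u v) : U.card ≤ G.deg u + 1 := by
  have h : U.erase u ⊆ ((G.adjL u).map G.tgt).toFinset := by
    intro v hv
    obtain ⟨e, he, hj⟩ := hU v (Finset.mem_of_mem_erase hv) (Finset.ne_of_mem_erase hv).symm
    obtain ⟨g, hg, -, ht⟩ := exists_half he hj
    simp only [List.mem_toFinset, List.mem_map]
    exact ⟨g, hg, ht⟩
  have h1 := (Finset.card_le_card h).trans (List.toFinset_card_le _)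
  rw [List.length_map, Finset.card_erase_of_mem hu] at h1
  simp only [deg]
  omega

theorem deg_le_edges (v : ℕ) : G.deg v ≤ G.E := by
  have : (G.adjL v).map eid ⊆ List.range G.E := by
    intro e he
    obtain ⟨h, hh, rfl⟩ := List.mem_map.1 he
    exact List.mem_range.2 (mem_adjL hh).2.2.1
  have := (List.Nodup.subperm (nodup_eid (G := G) G.E v) this).length_le
  simpa [deg, adjL] using this

/-- A clique has at most `d + 1` vertices, each contributing at most `d + 1`. On the other hand the
degrees sum to at most `2 E`, and there are at most `deg u + 1 ≤ E + 1` vertices. -/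
theorem degBound {d : ℕ} (hd : ∀ v < G.n, G.deg v ≤ d) :
    G.DegBound (min ((d + 1) * (d + 1)) (3 * G.E + 1)) := by
  intro U hlt hU
  rcases U.eq_empty_or_nonempty with rfl | ⟨u, hu⟩
  · simp
  have hc := card_le_deg hu (hU u hu)
  have hd' := hd u (hlt u hu)
  have hE := deg_le_edges (G := G) u
  refine le_min ?_ ?_
  · calc ∑ u ∈ U, (G.deg u + 1) ≤ ∑ u ∈ U, (d + 1) :=
          Finset.sum_le_sum fun v hv => Nat.add_le_add_right (hd v (hlt v hv)) 1
      _ = U.card * (d + 1) := by rw [Finset.sum_const, smul_eq_mul]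
      _ ≤ _ := Nat.mul_le_mul_right _ (by omega)
  · have h1 : ∑ u ∈ U, G.deg u ≤ 2 * G.E := by
      refine le_trans (Finset.sum_le_sum_of_subset fun v hv => ?_) (sum_halves_le (G := G) G.E)
      exact Finset.mem_range.2 (hlt v hv)
    rw [Finset.sum_add_distrib, Finset.sum_const, smul_eq_mul]
    omega

/-- Every long edge lies in a long closed clique. -/
theorem exists_node_of_long {σ e : ℕ} (he : e < G.E) (h : σ + G.st e ≤ G.en e + 1) :
    ∃ x, G.IsNode σ x ∧ G.eu e ∈ x.U ∧ G.ev e ∈ x.U := by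
  have ht := isTau_pair he
  obtain ⟨C, hC⟩ := IsCl.exists_completion (G := G) (a := G.st e) (b := G.en e) ht.nonempty
  obtain ⟨j, hj⟩ := IsClosed.exists_node (σ := σ) (U := C) (a := G.st e) (b := G.en e)
    ⟨hC.tau ht, hC.maximal, G.st_le e he, h⟩
  exact ⟨_, hj, hC.1 (by simp), hC.1 (by simp)⟩

/-- Each long edge lies in a long closed clique, and a clique on at most `d + 1` vertices contains
at most `(d + 1)²` edges. -/
theorem card_longEdges_le {σ d : ℕ} (hd : ∀ v < G.n, G.deg v ≤ d) {L : List Nd}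
    (hL : ∀ y, y ∈ L ↔ G.IsNode σ y) :
    (RAM.longEdges G σ G.E).card ≤ L.length * ((d + 1) * (d + 1)) := by
  classical
  have hsub : RAM.longEdges G σ G.E ⊆ L.toFinset.biUnion fun x =>
      (Finset.range G.E).filter fun e => G.eu e ∈ x.U ∧ G.ev e ∈ x.U := by
    intro e he
    obtain ⟨he, hl⟩ := RAM.mem_longEdges.1 he
    obtain ⟨x, hx, h⟩ := exists_node_of_long he hl
    simp only [Finset.mem_biUnion, List.mem_toFinset, Finset.mem_filter, Finset.mem_range]
    exact ⟨x, (hL x).2 hx, he, h⟩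
  refine (Finset.card_le_card hsub).trans ((Finset.card_biUnion_le_card_mul _ _
    ((d + 1) * (d + 1)) ?_).trans (Nat.mul_le_mul_right _ (List.toFinset_card_le L)))
  intro x hx
  have hx := (hL x).1 (List.mem_toFinset.1 hx)
  have ht := hx.closed.tau
  have hcard : x.U.card ≤ d + 1 := by
    obtain ⟨u, hu⟩ := ht.nonempty
    refine (card_le_deg hu fun v hv huv => ?_).trans (Nat.add_le_add_right (hd u (ht.lt hu)) 1)
    obtain ⟨e, he, hj, -⟩ := ht.1 u hu v hv huv
    exact ⟨e, he, hj⟩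
  calc _ ≤ (x.U ×ˢ x.U).card := by
        refine Finset.card_le_card_of_injOn (fun e => (G.eu e, G.ev e)) ?_ ?_
        · intro e he
          have := (Finset.mem_filter.1 he).2
          exact Finset.mem_product.2 this
        · intro e he f hf h
          have he := (Finset.mem_filter.1 he).1
          have hf := (Finset.mem_filter.1 hf).1
          simp only [Prod.mk.injEq] at h
          exact G.simple e (Finset.mem_range.1 he) f (Finset.mem_range.1 hf) (Or.inl h)
    _ = x.U.card * x.U.card := Finset.card_product _ _
    _ ≤ _ := Nat.mul_le_mul hcard hcard

end IGraph

/-! ### Enlarging the arrays. -/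

namespace RAM

theorem Expr.Fits.mono {m m' w : ℕ} (hm : m ≤ m') {s : State} {e : Expr} (h : e.Fits m w s) :
    e.Fits m' w s := by
  induction e with
  | const c => exact h
  | reg x => exact h
  | read a i ih => exact ⟨ih h.1, h.2.1.trans_le hm, h.2.2⟩
  | add e f ihe ihf => exact ⟨ihe h.1, ihf h.2.1, h.2.2⟩
  | sub e f ihe ihf => exact ⟨ihe h.1, ihf h.2⟩
  | lt e f ihe ihf => exact ⟨ihe h.1, ihf h.2.1, h.2.2⟩
  | eq e f ihe ihf => exact ⟨ihe h.1, ihf h.2.1, h.2.2⟩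

theorem Exec.mono {m m' w : ℕ} (hm : m ≤ m') {p : Prog} {s s' : State} {t : ℕ}
    (h : Exec m w p s t s') : Exec m' w p s t s' := by
  induction h with
  | skip s => exact .skip s
  | assign s x e he => exact .assign s x e (he.mono hm)
  | write s a i e hi him he => exact .write s a i e (hi.mono hm) (him.trans_le hm) (he.mono hm)
  | emit s e he => exact .emit s e (he.mono hm)
  | flush s => exact .flush s
  | seq s s₁ s₂ p q t₁ t₂ _ _ ihp ihq => exact .seq s s₁ s₂ p q t₁ t₂ ihp ihq
  | ite_true s s' e p q t he h _ ih => exact .ite_true s s' e p q t (he.mono hm) h ih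
  | ite_false s s' e p q t he h _ ih => exact .ite_false s s' e p q t (he.mono hm) h ih
  | while_true s s₁ s₂ e p t₁ t₂ he h _ _ ihp ihq =>
    exact .while_true s s₁ s₂ e p t₁ t₂ (he.mono hm) h ihp ihq
  | while_false s e p he h => exact .while_false s e p (he.mono hm) h

end RAM

/-! ### The final estimate. -/

namespace GraphSeq

open IGraph

variable {n : ℕ} {S : GraphSeq n} {es : List (Fin n × Fin n)}

theorem numEdges_eq (hes : S.IsEdgeList es) : S.numEdges = es.length := by
  classical
  have : S.graph.edgeSet = ((es.map fun p => s(p.1, p.2)).toFinset : Set (Sym2 (Fin n))) := by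
    ext e
    rw [Finset.mem_coe, List.mem_toFinset, hes.2]
  rw [numEdges, this, Set.ncard_coe_finset, List.toFinset_card_of_nodup hes.1, List.length_map]

theorem deg_le_maxDeg (hI : S.IntervalAssumption) (hes : S.IsEdgeList es) (v : ℕ)
    (hv : v < (toIGraph hI hes).n) : (toIGraph hI hes).deg v ≤ S.maxDeg := by
  classical
  have hv : v < n := hv
  refine le_trans ?_ (SimpleGraph.degree_le_maxDegree S.graph ⟨v, hv⟩)
  have hnd : (((toIGraph hI hes).adjL v).map (toIGraph hI hes).tgt).Nodup :=
    (nodup_adjL v).map_on fun g hg h hh => tgt_inj hg hh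
  rw [deg, ← List.length_map (f := (toIGraph hI hes).tgt), ← List.toFinset_card_of_nodup hnd,
    ← SimpleGraph.card_neighborFinset_eq_degree, ← Finset.card_image_of_injective _ Fin.val_injective]
  refine Finset.card_le_card fun z hz => ?_
  simp only [List.mem_toFinset, List.mem_map] at hz
  obtain ⟨h, hh, rfl⟩ := hz
  obtain ⟨-, -, he, hj⟩ := mem_adjL hh
  have hz : (toIGraph hI hes).tgt h < n := tgt_lt hh
  refine Finset.mem_image.2 ⟨⟨_, hz⟩, ?_, rfl⟩
  rw [SimpleGraph.mem_neighborFinset]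
  exact (edge_of_joins hI hes (x := ⟨v, hv⟩) (y := ⟨_, hz⟩) he hj).1

/-- Without cliques there are no long edges either, and only the linear term remains. Otherwise `D ≤
4 d²` and `D ≤ 4 E`, so `d D²` is within a constant of both terms of the minimum. The `l` root tests
cost about `l D`: this is `O(k d⁴)` by the count of long edges per clique and `O(E²)` by `l ≤ E`,
and the share of one clique covers the latter. -/
theorem time_bound {E d D l k N : ℕ} (hD : D = min ((d + 1) * (d + 1)) (3 * E + 1))
    (hlE : l ≤ E) (hl : l ≤ k * ((d + 1) * (d + 1))) (hk : k ≤ N) (hE : E = 0 → k = 0)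
    (hd : d = 0 → k = 0) :
    144 * E + 20 + l * (300 * D + 40) + k * ((1200 * D + 502) * ((d + 2) * D + 2)) ≤
      200000 * (1 + E + N * min (d ^ 5) (E ^ 2 * d)) := by
  rcases Nat.eq_zero_or_pos k with rfl | hk0
  · obtain rfl : l = 0 := by simpa using hl
    have h : ∀ x : ℕ, 144 * E + 20 + 0 + 0 ≤ 200000 * (1 + E + x) := fun x => by omega
    simpa only [Nat.zero_mul] using h _
  have hE1 : 1 ≤ E := by
    by_contra h
    have := hE (by omega)
    omega
  have hd1 : 1 ≤ d := by
    by_contra h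
    have := hd (by omega)
    omega
  have hD1 : 1 ≤ D := by
    rw [hD]
    exact le_min (Nat.mul_pos (by omega) (by omega)) (by omega)
  have hdd : (d + 1) * (d + 1) ≤ 4 * (d * d) := by nlinarith
  have hDd : D ≤ 4 * (d * d) := by
    rw [hD]
    exact (min_le_left _ _).trans hdd
  have hDE : D ≤ 4 * E := by
    rw [hD]
    exact (min_le_right _ _).trans (by omega)
  set M := min (d ^ 5) (E ^ 2 * d) with hM
  have hDD : d * (D * D) ≤ 16 * M := by
    have h1 : d * (D * D) ≤ 16 * d ^ 5 := by
      calc d * (D * D) ≤ d * ((4 * (d * d)) * (4 * (d * d))) :=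
            Nat.mul_le_mul_left _ (Nat.mul_le_mul hDd hDd)
        _ = 16 * d ^ 5 := by ring
    have h2 : d * (D * D) ≤ 16 * (E ^ 2 * d) := by
      calc d * (D * D) ≤ d * ((4 * E) * (4 * E)) :=
            Nat.mul_le_mul_left _ (Nat.mul_le_mul hDE hDE)
        _ = 16 * (E ^ 2 * d) := by ring
    rw [hM]
    omega
  have hlD : l * D ≤ k * (16 * M) := by
    have h1 : l * D ≤ k * (16 * d ^ 5) := by
      calc l * D ≤ (k * (4 * (d * d))) * (4 * (d * d)) :=
            Nat.mul_le_mul (hl.trans (Nat.mul_le_mul_left _ hdd)) hDd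
        _ = k * (16 * d ^ 4) := by ring
        _ ≤ _ := Nat.mul_le_mul_left _ (Nat.mul_le_mul_left _ (Nat.pow_le_pow_right hd1 (by omega)))
    have h2 : l * D ≤ k * (16 * (E ^ 2 * d)) := by
      calc l * D ≤ E * (4 * E) := Nat.mul_le_mul hlE hDE
        _ = 1 * (4 * (E ^ 2 * 1)) := by ring
        _ ≤ k * (16 * (E ^ 2 * d)) := Nat.mul_le_mul hk0
            (Nat.mul_le_mul (by omega) (Nat.mul_le_mul_left _ hd1))
    rw [hM]
    rcases min_choice (d ^ 5) (E ^ 2 * d) with h | h <;> rw [h] <;> assumption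
  have hA : l * (300 * D + 40) ≤ 340 * (k * (16 * M)) := by
    calc l * (300 * D + 40) ≤ l * (340 * D) := Nat.mul_le_mul_left _ (by omega)
      _ = 340 * (l * D) := by ring
      _ ≤ _ := Nat.mul_le_mul_left _ hlD
  have hB : k * ((1200 * D + 502) * ((d + 2) * D + 2)) ≤ 8510 * (k * (16 * M)) := by
    have h1 : (d + 2) * D + 2 ≤ 5 * (d * D) := by nlinarith
    calc k * ((1200 * D + 502) * ((d + 2) * D + 2)) ≤ k * ((1702 * D) * (5 * (d * D))) :=
          Nat.mul_le_mul_left _ (Nat.mul_le_mul (by omega) h1)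
      _ = 8510 * (k * (d * (D * D))) := by ring
      _ ≤ _ := Nat.mul_le_mul_left _ (Nat.mul_le_mul_left _ hDD)
  have hC : k * (16 * M) ≤ 16 * (N * M) := by
    calc k * (16 * M) = 16 * (k * M) := by ring
      _ ≤ _ := Nat.mul_le_mul_left _ (Nat.mul_le_mul_right _ hk)
  -- The constants add up to `16 * (340 + 8510) = 141600`.
  omega

end GraphSeq

theorem mainTheorem7 :
    ∃ (p : RAM.Prog) (C : ℕ), ∀ (n : ℕ) (S : GraphSeq n) (es : List (Fin n × Fin n)) (σ : ℕ),
      S.IntervalAssumption → S.IsEdgeList es →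
      ∃ (t : ℕ) (s : RAM.State),
        RAM.Exec (C * (n + S.numEdges + 1)) (C * (n + S.numEdges + S.tmax + σ + 1)) p
          (S.inputState es σ) t s ∧
        GraphSeq.Enumerates es s.out (S.longCliques σ) ∧ s.cur = [] ∧
        t ≤ C * (1 + S.numEdges +
          (S.longCliques σ).ncard * min (S.maxDeg ^ 5) (S.numEdges ^ 2 * S.maxDeg)) := by
  refine ⟨RAM.main, 200000, fun n S es σ hI hes => ?_⟩
  set G := GraphSeq.toIGraph hI hes with hG
  have hE : S.numEdges = G.E := GraphSeq.numEdges_eq hes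
  have hn : G.n = n := rfl
  have hT : G.T = S.tmax := rfl
  have hd : ∀ v < G.n, G.deg v ≤ S.maxDeg := GraphSeq.deg_le_maxDeg hI hes
  -- The execution is built with smaller arrays: `Big` asks that words exceed the array length,
  -- which would fail for the final length if `tmax` and `σ` are `0`. The arrays are enlarged
  -- afterwards by `Exec.mono`.
  obtain ⟨t, s, hex, L, rs, hnd, hmem, hrs, hout, hcur, ht⟩ := RAM.wp_main (m := n + 2 * G.E + 4)
    (w := 200000 * (n + S.numEdges + S.tmax + σ + 1)) (G := G) (σ := σ)
    ⟨by omega, by omega⟩ (IGraph.degBound hd) hd (GraphSeq.init_inputState hI hes σ)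
  obtain ⟨henum, hlen⟩ := GraphSeq.enumerates_of_nodes hnd hmem hrs
  refine ⟨t, s, hex.mono (by omega), by rw [hout]; exact henum, hcur, ht.trans ?_⟩
  rw [hE]
  have hedge : ∀ x ∈ L, ∃ u < G.n, 1 ≤ G.deg u ∧ 1 ≤ G.E := by
    intro x hx
    have htau := ((hmem x).1 hx).closed.tau
    obtain ⟨u, hu, v, hv, huv⟩ := htau.exists_ne
    obtain ⟨e, he, hj, -⟩ := htau.1 u hu v hv huv
    obtain ⟨h, hh, -⟩ := IGraph.exists_half he hj
    exact ⟨u, htau.lt hu, List.length_pos_of_mem hh, by omega⟩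
  have hzero : (G.E = 0 ∨ S.maxDeg = 0) → L.length = 0 := by
    intro h
    by_contra hne
    obtain ⟨x, hx⟩ := List.exists_mem_of_length_pos (Nat.pos_of_ne_zero hne)
    obtain ⟨u, hu, h1, h2⟩ := hedge x hx
    have := hd u hu
    omega
  refine GraphSeq.time_bound rfl ?_ (IGraph.card_longEdges_le hd hmem) hlen
    (fun h => hzero (Or.inl h)) fun h => hzero (Or.inr h)
  exact (Finset.card_filter_le _ _).trans (by simp)
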